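/- **Setting.** Let $G$ be a finite simple graph, $M$ a matching of $G$, $\epsilon\in(0,1]$ with $1/\epsilon$ a power of $2$, $\ell_{\max}=3/\epsilon$, and let $h\in\{\frac12,\frac14,\frac18,\dots,\frac{\epsilon^2}{64}\}$ (the scale). A vertex is *free* if no edge of $M$ is incident to it. Each edge $\{u,v\}$ gives two arcs $(u,v)$ and $(v,u)$; an arc is *matched* if its edge is in $M$. An augmenting path $P=(\alpha,a_1,\dots,a_k,\beta)$ is a simple path between two distinct free vertices $\alpha,\beta$ whose edges are alternately unmatched and matched; $a_1,\dots,a_k$ are its matched arcs in order from $\alpha$ to $\beta$ (its unmatched arcs are not written, but belong to $P$). **Data.** In a phase, every free vertex $\alpha$ that is not removed holds a structure $S_\alpha=(G_\alpha,\Omega_\alpha,w'_\alpha)$: a set of vertices and arcs of $G$, a set of blossoms, and a working vertex (possibly $\emptyset$). Let $\Omega$ consist of all trivial blossoms $\{v\}$ and all blossoms in the sets $\Omega_\alpha$; $\Omega(v)$ is the maximal blossom of $\Omega$ containing $v$, $G'=G/\Omega$ is the graph obtained by contracting the maximal blossoms, and $T'_\alpha=G_\alpha/\Omega_\alpha$ is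 a tree with root $\Omega(\alpha)$, its arcs directed from parent to child. A vertex of $T'_\alpha$ is *outer* if its depth is even and *inner* otherwise; $w'_\alpha$ is $\emptyset$ or an outer vertex of $T'_\alpha$. $S_\alpha$ is *active* if $w'_\alpha\ne\emptyset$; its *active path* is then the path of $T'_\alpha$ from the root to $w'_\alpha$. Each matched arc $a$ has a label $\ell(a)$. At the start of the phase $S_\alpha$ is the single vertex $\alpha$ with $w'_\alpha=\{\alpha\}$ for every free $\alpha$, all labels are $\ell_{\max}+1$, and no vertex is removed. **Operations.** Each marks the structures whose data it changes as modified. - *Augment*$(u,v)$, for $\Omega(u),\Omega(v)$ outer vertices of different structures: record an augmenting path through $(u,v)$, remove all vertices of both structures, and delete both structures. - *Contract*$(u,v)$, for distinct outer vertices $\Omega(u)=w'_\alpha$ and $\Omega(v)$ of the same $T'_\alpha$: add $(u,v)$ to $G_\alpha$ and add to $\Omega_\alpha$ the blossom $B$ formed by the cycle of $T'_\alpha\cup\{(\Omega(u),\Omega(v))\}$; set to $0$ the labels of all matched arcs with both ends in $B$; set $w'_\alpha=B$. - *Overtake*$((u,v),(v,t),d)$, for $\Omega(u)=w'_\alpha$,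 with $(u,v)$ unmatched and $(v,t)$ matched: set $\ell(v,t)=d$. If $(v,t)$ is in no structure, add $(u,v),(v,t)$ and the trivial blossoms of $v,t$ to $S_\alpha$ and set $w'_\alpha=\Omega(t)$. If $(v,t)$ is in $S_\beta$, let $(p,v)$ be the arc of $G_\beta$ coming from the parent of $\Omega(v)$ and replace it by the arc $(u,v)$ of $G_\alpha$. If $\beta=\alpha$, set $w'_\alpha=\Omega(t)$. If $\beta\ne\alpha$, move the subtree of $\Omega(v)$ (vertices, arcs, blossoms) from $S_\beta$ to $S_\alpha$; if $w'_\beta$ was in the subtree of $\Omega(t)$, set $w'_\alpha$ to the old $w'_\beta$ and then $w'_\beta=\Omega(p)$, and otherwise set $w'_\alpha=\Omega(t)$. **Pass-bundle.** A phase is a sequence of pass-bundles. In each of them: 1. Mark $S_\alpha$ on hold iff $|V(G_\alpha)|\ge 6/h+1$; mark all structures not modified. 2. *Extend.* Read all arcs of $G$, each once, in arbitrary order. Skip $(u,v)$ if $u$ or $v$ is removed, if $\Omega(u)=\Omega(v)$, if $(u,v)$ is matched, or unless $\Omega(u)=w'_\alpha$ for some $S_\alpha$ that is neither on hold nor modified.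 Otherwise: if $\Omega(v)$ is outer in $T'_\alpha$, Contract; if it is outer in another tree, Augment; else let $(v,t)$ be the matched arc with tail $v$ and let $d=0$ if $\Omega(u)$ contains a free vertex, and otherwise let $d$ be the label of the matched arc entering $\Omega(u)$ from outside; if $d+1<\ell(v,t)$, Overtake$((u,v),(v,t),d+1)$. 3. *Contract and augment.* While some arc $(u,v)$ with both ends in some $G_\alpha$ has $\Omega(u)=w'_\alpha$ and $\Omega(v)\neq\Omega(u)$ outer, Contract$(u,v)$ (in any order). Then read all arcs once in arbitrary order and Augment$(u,v)$ whenever $\Omega(u),\Omega(v)$ are outer vertices of different structures. 4. *Backtrack.* For every $S_\alpha$ neither on hold nor modified with $w'_\alpha\ne\emptyset$: if $w'_\alpha$ is the root set $w'_\alpha=\emptyset$, otherwise replace $w'_\alpha$ by its grandparent in $T'_\alpha$. An arc $(u,v)$ of $G$ is *critical* if $\Omega(u)\ne\Omega(v)$ (a non-blossom arc) and $(\Omega(u),\Omega(v))$ is an arc of the active path of some structure. **Theorem (no short augmenting path is missed).** In every run of a phase, the following holds at the beginning of every pass-bundle, however many pass-bundles have been executed before. Let $P=(\alpha,a_1,\dots,a_k,\beta)$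 be an augmenting path in $G$ with $k\le\ell_{\max}$ none of whose vertices has been removed in the phase. Then $S_\alpha$ is active, or $P$, directed from $\alpha$ to $\beta$, contains a critical arc. -/

import Mathlib

/-! One phase of the semi-streaming search for augmenting paths: `G` is a finite simple graph and
`M` a matching of `G`.  An edge `{u, v}` is represented by the two arcs `(u, v)` and `(v, u)`. -/

namespace MatchingPhase

open Classical in
/-- Pointwise update of a function. -/
noncomputable def upd {A B : Type*} (f : A → B) (a : A) (b : B) : A → B :=
  fun x => if x = a then b else f x

section Basic

variable {V : Type*}

/-- A vertex is free if no matched edge is incident to it. -/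
def IsFree {G : SimpleGraph V} (M : G.Subgraph) (v : V) : Prop := ∀ u, ¬ M.Adj v u

/-- `p = (α, a₁, …, a_k, β)` is an augmenting path with exactly `k` matched arcs: a simple path
between the distinct free vertices `α` and `β` whose `2k + 1` edges are alternately unmatched and
matched. -/
def IsAugmentingPath {G : SimpleGraph V} (M : G.Subgraph) {α β : V} (p : G.Walk α β) (k : ℕ) :
    Prop :=
  IsFree M α ∧ IsFree M β ∧ p.IsPath ∧ p.length = 2 * k + 1 ∧
    ∀ i < 2 * k + 1, (M.Adj (p.getVert i) (p.getVert (i + 1)) ↔ Odd i)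

/-- A blossom, given by its vertex set `B` and its edge set `E_B`. -/
@[ext] structure Blossom (V : Type*) where
  verts : Set V
  edges : Set (Sym2 V)

/-- The trivial blossom `{v}`. -/
def Blossom.trivial (v : V) : Blossom V := ⟨{v}, ∅⟩

/-- The tuple `(G_α, Ω_α, w'_α)` maintained by a free vertex `α`: `verts` and `arcs` are the
vertices and arcs of `G_α`, `blossoms` is `Ω_α`, and `work` is the working vertex (`none` stands
for `∅`).  A vertex of a contracted graph is denoted by the vertex set of its root blossom. -/
@[ext] structure FreeStructure (V : Type*) where
  verts : Set V
  arcs : Set (V × V)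
  blossoms : Set (Blossom V)
  work : Option (Set V)

/-- The absent structure: the one of a vertex that is not free, or that has been removed. -/
def FreeStructure.empty : FreeStructure V := ⟨∅, ∅, ∅, none⟩

/-- The structure `S_α` at the start of a phase: the single vertex `α`, being the working vertex. -/
def FreeStructure.single (α : V) : FreeStructure V := ⟨{α}, ∅, {Blossom.trivial α}, some {α}⟩

/-- What is maintained during a phase: the structures, the labels `ℓ(u, v)` of the matched arcs
(values on other arcs are never used), the removed vertices, and the free vertices whose structures
are marked on hold, respectively modified. -/
@[ext] structure State (V : Type*) where
  str : V → FreeStructure V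
  label : V → V → ℕ
  removed : Set V
  onHold : Set V
  modified : Set V

namespace State

variable (σ : State V)

/-- The set `Ω`: all blossoms of all structures, and all trivial blossoms. -/
def Omega : Set (Blossom V) :=
  {B | (∃ α, B ∈ (σ.str α).blossoms) ∨ ∃ v, B = Blossom.trivial v}

/-- The vertex of `G' = G / Ω` that contains `v`, i.e. the root blossom `Ω(v)`.  As `Ω` is laminar,
the union of its blossoms that contain `v` is the largest one of them. -/
def root (v : V) : Set V := {x | ∃ B ∈ σ.Omega, v ∈ B.verts ∧ x ∈ B.verts}

/-- The arcs of the tree `T'_α = G_α / Ω_α`, directed from parent to child. -/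
def TreeArc (α : V) (X Y : Set V) : Prop :=
  X ≠ Y ∧ ∃ u v, (u, v) ∈ (σ.str α).arcs ∧ σ.root u = X ∧ σ.root v = Y

/-- `X` is an ancestor of `Y` in `T'_α`, or `X = Y`. -/
def Anc (α : V) : Set V → Set V → Prop := Relation.ReflTransGen (σ.TreeArc α)

/-- `AtDepth α n X`: in `T'_α` the path from the root `Ω(α)` to the vertex `X` has length `n`. -/
inductive AtDepth (α : V) : ℕ → Set V → Prop
  | root : α ∈ (σ.str α).verts → AtDepth α 0 (σ.root α)
  | child {n : ℕ} {X Y : Set V} : AtDepth α n X → σ.TreeArc α X Y → AtDepth α (n + 1) Y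

/-- `X` is an outer vertex of `T'_α`. -/
def IsOuterIn (α : V) (X : Set V) : Prop := ∃ n, Even n ∧ σ.AtDepth α n X

/-- `S_α` is active. -/
def IsActive (α : V) : Prop := (σ.str α).work ≠ none

/-- The arc `(X, Y)` of `G'` is active: it lies on the active path of `S_γ`, the path of `T'_γ`
from its root to the working vertex. -/
def IsActiveArc (γ : V) (X Y : Set V) : Prop :=
  ∃ W, (σ.str γ).work = some W ∧ σ.Anc γ (σ.root γ) X ∧ σ.TreeArc γ X Y ∧ σ.Anc γ Y W

/-- The arc `(u, v)` is critical: it is a non-blossom arc, and the arc `(Ω(u), Ω(v))` is active. -/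
def IsCriticalArc (u v : V) : Prop :=
  σ.root u ≠ σ.root v ∧ ∃ γ, σ.IsActiveArc γ (σ.root u) (σ.root v)

/-! ### The three basic operations -/

/-- Augment, for an unmatched arc between outer vertices of `S_α` and of `S_β`: both structures are
removed.  The augmenting path that is found is only written to the output of the phase; it is
not read again in the phase and hence not recorded here. -/
noncomputable def augment (α β : V) : State V where
  str := upd (upd σ.str α FreeStructure.empty) β FreeStructure.empty
  label := σ.label
  removed := σ.removed ∪ (σ.str α).verts ∪ (σ.str β).verts
  onHold := σ.onHold
  modified := σ.modified ∪ {α, β}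

/-- The vertices of `T'_α` on the cycle that an arc between `X` and `Y` closes, i.e. on the tree
path between `X` and `Y`: the ancestors of `X` or `Y` below (or equal to) the lowest common one. -/
def OnCycle (α : V) (X Y Z : Set V) : Prop :=
  (σ.Anc α Z X ∨ σ.Anc α Z Y) ∧ ∀ A, σ.Anc α A X → σ.Anc α A Y → σ.Anc α A Z

/-- The vertex set of the blossom in `T'_α ∪ {(Ω(u), Ω(v))}`. -/
def cycleVerts (α u v : V) : Set V :=
  {x | x ∈ (σ.str α).verts ∧ σ.OnCycle α (σ.root u) (σ.root v) (σ.root x)}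

/-- The blossom in `T'_α ∪ {(Ω(u), Ω(v))}`; its edges are those of the blossoms on the cycle,
the tree edges on the cycle, and `{u, v}`. -/
def cycleBlossom (α u v : V) : Blossom V where
  verts := σ.cycleVerts α u v
  edges := {e | (∃ A ∈ (σ.str α).blossoms, A.verts ⊆ σ.cycleVerts α u v ∧ e ∈ A.edges) ∨
    (∃ x y, (x, y) ∈ (σ.str α).arcs ∧ x ∈ σ.cycleVerts α u v ∧ y ∈ σ.cycleVerts α u v ∧
      σ.root x ≠ σ.root y ∧ e = s(x, y)) ∨ e = s(u, v)}

open Classical in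
/-- Contract, for an unmatched arc `(u, v)` between two outer vertices of `S_α`. -/
noncomputable def contract {G : SimpleGraph V} (M : G.Subgraph) (α u v : V) : State V where
  str := upd σ.str α
    { verts := (σ.str α).verts
      arcs := (σ.str α).arcs ∪ {(u, v)}
      blossoms := (σ.str α).blossoms ∪ {σ.cycleBlossom α u v}
      work := some (σ.cycleVerts α u v) }
  label := fun x y =>
    if M.Adj x y ∧ x ∈ σ.cycleVerts α u v ∧ y ∈ σ.cycleVerts α u v then 0 else σ.label x y
  removed := σ.removed
  onHold := σ.onHold
  modified := σ.modified ∪ {α}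

/-- The labels after `ℓ(v, t)` has been set to `k`. -/
noncomputable def relabel (v t : V) (k : ℕ) : V → V → ℕ := upd σ.label v (upd (σ.label v) t k)

/-- Overtake by `S_α` through `(u, v)` of a matched arc `(v, t)` that is in no structure. -/
noncomputable def overtakeUnvisited (α u v t : V) (k : ℕ) : State V where
  str := upd σ.str α
    { verts := (σ.str α).verts ∪ {v, t}
      arcs := (σ.str α).arcs ∪ {(u, v), (v, t)}
      blossoms := (σ.str α).blossoms ∪ {Blossom.trivial v, Blossom.trivial t}
      work := some (σ.root t) }
  label := σ.relabel v t k
  removed := σ.removed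
  onHold := σ.onHold
  modified := σ.modified ∪ {α}

/-- Overtake by `S_α` through `(u, v)` of a matched arc `(v, t)` of `S_α` itself, `(p, v)` being the
arc from the parent of `Ω(v)`. -/
noncomputable def overtakeSame (α p u v t : V) (k : ℕ) : State V where
  str := upd σ.str α
    { verts := (σ.str α).verts
      arcs := ((σ.str α).arcs \ {(p, v)}) ∪ {(u, v)}
      blossoms := (σ.str α).blossoms
      work := some (σ.root t) }
  label := σ.relabel v t k
  removed := σ.removed
  onHold := σ.onHold
  modified := σ.modified ∪ {α}

/-- The vertices `x` of `S_β` such that `Ω(x)` is in the subtree of `Ω(v)`. -/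
def subtreeVerts (β v : V) : Set V :=
  {x | x ∈ (σ.str β).verts ∧ σ.Anc β (σ.root v) (σ.root x)}

/-- The arcs of `S_β` inside the subtree of `Ω(v)`. -/
def subtreeArcs (β v : V) : Set (V × V) :=
  {a | a ∈ (σ.str β).arcs ∧ a.1 ∈ σ.subtreeVerts β v ∧ a.2 ∈ σ.subtreeVerts β v}

/-- The blossoms of `S_β` inside the subtree of `Ω(v)`. -/
def subtreeBlossoms (β v : V) : Set (Blossom V) :=
  {B | B ∈ (σ.str β).blossoms ∧ B.verts ⊆ σ.subtreeVerts β v}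

/-- The working vertex of `S_β` is in the subtree of `Ω(t)`. -/
def WorksBelow (β t : V) : Prop := ∃ W, (σ.str β).work = some W ∧ σ.Anc β (σ.root t) W

open Classical in
/-- Overtake by `S_α` through `(u, v)` of a matched arc `(v, t)` of another structure `S_β`,
`(p, v)` being the arc from the parent of `Ω(v)`: the subtree of `Ω(v)` moves to `S_α`. -/
noncomputable def overtakeOther (α β p u v t : V) (k : ℕ) : State V where
  str := upd (upd σ.str α
    { verts := (σ.str α).verts ∪ σ.subtreeVerts β v
      arcs := (σ.str α).arcs ∪ {(u, v)} ∪ σ.subtreeArcs β v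
      blossoms := (σ.str α).blossoms ∪ σ.subtreeBlossoms β v
      work := if σ.WorksBelow β t then (σ.str β).work else some (σ.root t) }) β
    { verts := (σ.str β).verts \ σ.subtreeVerts β v
      arcs := ((σ.str β).arcs \ {(p, v)}) \ σ.subtreeArcs β v
      blossoms := (σ.str β).blossoms \ σ.subtreeBlossoms β v
      work := if σ.WorksBelow β t then some (σ.root p) else (σ.str β).work }
  label := σ.relabel v t k
  removed := σ.removed
  onHold := σ.onHold
  modified := σ.modified ∪ {α, β}

/-- `σ.Overtake α u v t k σ'`: the result of overtaking the matched arc `(v, t)` by `S_α` through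
the unmatched arc `(u, v)` with new label `k` is `σ'`. -/
inductive Overtake (α u v t : V) (k : ℕ) : State V → Prop
  | unvisited : (∀ γ, (v, t) ∉ (σ.str γ).arcs) →
      Overtake α u v t k (σ.overtakeUnvisited α u v t k)
  | same {p : V} : (v, t) ∈ (σ.str α).arcs → (p, v) ∈ (σ.str α).arcs → σ.root p ≠ σ.root v →
      Overtake α u v t k (σ.overtakeSame α p u v t k)
  | other {β p : V} : β ≠ α → (v, t) ∈ (σ.str β).arcs → (p, v) ∈ (σ.str β).arcs →
      σ.root p ≠ σ.root v → Overtake α u v t k (σ.overtakeOther α β p u v t k)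

end State

/-! ### The procedures of a pass-bundle -/

/-- `L` is an order in which one pass presents the arcs of `G`, each exactly once. -/
def IsStream (G : SimpleGraph V) (L : List (V × V)) : Prop :=
  L.Nodup ∧ ∀ u v, (u, v) ∈ L ↔ G.Adj u v

/-- Processing the arcs of a list one after the other, each by `step`. -/
inductive Pass (step : V → V → State V → State V → Prop) :
    List (V × V) → State V → State V → Prop
  | nil (σ : State V) : Pass step [] σ σ
  | cons {u v : V} {L : List (V × V)} {σ₁ σ₂ σ₃ : State V} :
      step u v σ₁ σ₂ → Pass step L σ₂ σ₃ → Pass step ((u, v) :: L) σ₁ σ₃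

variable {G : SimpleGraph V} (M : G.Subgraph)

/-- The number `distance` of a working vertex `X`: `0` if `X` is a free vertex of `G'`, and
otherwise the label of the matched arc of `G'` whose head is `X`. -/
def IsDistance (σ : State V) (X : Set V) (d : ℕ) : Prop :=
  ((∃ γ ∈ X, IsFree M γ) ∧ d = 0) ∨
    ((∀ γ ∈ X, ¬ IsFree M γ) ∧ ∃ x y, M.Adj x y ∧ x ∉ X ∧ y ∈ X ∧ d = σ.label x y)

/-- The arc `(u, v)` is not ignored in Extend-Active-Path, and `S_α` is the structure to extend. -/
def IsEligible (σ : State V) (α u v : V) : Prop :=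
  u ∉ σ.removed ∧ v ∉ σ.removed ∧ σ.root u ≠ σ.root v ∧ (σ.str α).work = some (σ.root u) ∧
    ¬ M.Adj u v ∧ α ∉ σ.modified ∧ α ∉ σ.onHold

/-- Extend-Active-Path: the treatment of the arc `(u, v)`. -/
inductive ExtendArc (u v : V) (σ : State V) : State V → Prop
  | ignore : (∀ α, ¬ IsEligible M σ α u v) → ExtendArc u v σ σ
  | contract {α : V} : IsEligible M σ α u v → σ.IsOuterIn α (σ.root v) →
      ExtendArc u v σ (σ.contract M α u v)
  | augment {α β : V} : IsEligible M σ α u v → β ≠ α → σ.IsOuterIn β (σ.root v) →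
      ExtendArc u v σ (σ.augment α β)
  | overtake {α t : V} {d : ℕ} {σ' : State V} : IsEligible M σ α u v →
      (∀ β, ¬ σ.IsOuterIn β (σ.root v)) → M.Adj v t → IsDistance M σ (σ.root u) d →
      d + 1 < σ.label v t → σ.Overtake α u v t (d + 1) σ' → ExtendArc u v σ σ'
  | noGain {α t : V} {d : ℕ} : IsEligible M σ α u v →
      (∀ β, ¬ σ.IsOuterIn β (σ.root v)) → M.Adj v t → IsDistance M σ (σ.root u) d →
      ¬ d + 1 < σ.label v t → ExtendArc u v σ σ

/-- Contract-and-Augment, one contraction of its first step. -/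
def ContractStep (σ σ' : State V) : Prop :=
  ∃ α u v, G.Adj u v ∧ u ∈ (σ.str α).verts ∧ v ∈ (σ.str α).verts ∧
    (σ.str α).work = some (σ.root u) ∧ σ.root v ≠ σ.root u ∧ σ.IsOuterIn α (σ.root v) ∧
    σ' = σ.contract M α u v

/-- Contract-and-Augment, the treatment of the arc `(u, v)` in its second step. -/
inductive AugmentArc (u v : V) (σ : State V) : State V → Prop
  | augment {α β : V} : α ≠ β → σ.IsOuterIn α (σ.root u) → σ.IsOuterIn β (σ.root v) →
      AugmentArc u v σ (σ.augment α β)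
  | ignore : (∀ α β, α ≠ β → σ.IsOuterIn α (σ.root u) → ¬ σ.IsOuterIn β (σ.root v)) →
      AugmentArc u v σ σ

/-- The working vertex of `S_α` after backtracking: the grandparent of the working vertex, or `none`
if the working vertex is the root (or if there was none). -/
inductive BacktrackedWork (σ : State V) (α : V) : Option (Set V) → Prop
  | inactive : (σ.str α).work = none → BacktrackedWork σ α none
  | atRoot : (σ.str α).work = some (σ.root α) → BacktrackedWork σ α none
  | up {X Y W : Set V} : (σ.str α).work = some W → W ≠ σ.root α → σ.TreeArc α X Y →
      σ.TreeArc α Y W → BacktrackedWork σ α (some X)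

/-- Backtrack-Stuck-Structures: the structures neither on hold nor modified are backtracked. -/
def Backtrack (σ σ' : State V) : Prop :=
  ∃ w : V → Option (Set V),
    (∀ α, (α ∈ σ.onHold ∨ α ∈ σ.modified) → w α = (σ.str α).work) ∧
    (∀ α, ¬ (α ∈ σ.onHold ∨ α ∈ σ.modified) → BacktrackedWork σ α (w α)) ∧
    σ' = { σ with str := fun α => { σ.str α with work := w α } }

/-- The value `limit_h = 6 / h + 1`. -/
noncomputable def limit (h : ℝ) : ℝ := 6 / h + 1

/-- The value `ℓ_max = 3 / ε`, an integer when `1 / ε` is one. -/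
noncomputable def lmax (ε : ℝ) : ℕ := ⌊3 / ε⌋₊

/-- The marking of the structures at the start of a pass-bundle. -/
noncomputable def mark (h : ℝ) (σ : State V) : State V :=
  { σ with
    onHold := {α | limit h ≤ ((σ.str α).verts.ncard : ℝ)}
    modified := ∅ }

/-- One pass-bundle of scale `h`, which leads from `σ` to `σ'`; the order of the arcs in each pass
and the order of the contractions are arbitrary. -/
def PassBundle (h : ℝ) (σ σ' : State V) : Prop :=
  ∃ (L₁ L₂ : List (V × V)) (σ₁ σ₂ σ₃ : State V),
    IsStream G L₁ ∧ IsStream G L₂ ∧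
    Pass (ExtendArc M) L₁ (mark h σ) σ₁ ∧
    Relation.ReflTransGen (ContractStep M) σ₁ σ₂ ∧ (∀ σ', ¬ ContractStep M σ₂ σ') ∧
    Pass AugmentArc L₂ σ₂ σ₃ ∧
    Backtrack σ₃ σ'

open Classical in
/-- The state at the start of a phase. -/
noncomputable def init (ε : ℝ) : State V where
  str := fun α => if IsFree M α then FreeStructure.single α else FreeStructure.empty
  label := fun _ _ => lmax ε + 1
  removed := ∅
  onHold := ∅
  modified := ∅

/-- `AtStartOf M ε h τ σ`: in some run of a phase with parameter `ε` and scale `h`, `σ` is the state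
at the beginning of the pass-bundle number `τ` (counted from `1`). -/
inductive AtStartOf (ε h : ℝ) : ℕ → State V → Prop
  | first : AtStartOf ε h 1 (init M ε)
  | next {τ : ℕ} {σ σ' : State V} : AtStartOf ε h τ σ → PassBundle M h σ σ' →
      AtStartOf ε h (τ + 1) σ'

end Basic

end MatchingPhase

/-! At the start of every pass-bundle the state has three properties. Shape (`Inv`): the trees
alternate, at most one matched edge leaves an outer blossom, none leaves the blossom of a tree root,
and the label of the matched arc below an inner vertex exceeds the distance of its parent. Labels
(`LabelBound`): if an unmatched edge leads from an inactive outer vertex of distance `e` to a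
non-outer, unremoved `v` with mate `t`, then `ℓ(v, t) ≤ e + 1`. Outer vertices (`NoOuterArc`): no
edge joins two different ones; this may fail only in the initial state, where every `S_α` is active
anyway.

Suppose `S_α` is inactive and `P` has no critical arc. By induction along `P` (`Inv.outer_of_path`),
the vertex reached after `i` matched arcs lies in an inactive outer vertex of distance at most `i`.
If the next unmatched edge ends in a non-outer vertex, the label of the following matched arc is at
most `i + 1 ≤ ℓ_max`, below the initial value. So this arc was visited and is a tree arc from an
inner to an outer vertex, and its head is inactive because the arc is not critical. If the edge ends
in an outer vertex, it stays in the same blossom, and so does the following matched arc, because `P`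
has already used the only matched edge that can leave this blossom. In the end the last edge joins
an outer vertex to `β`, so both lie in one blossom; but no matched edge leaves the blossom of `β`,
so `P` cannot have entered it (`Inv.exists_critical`).

For the preservation, `Prog` records what an operation cannot destroy. A vertex that is outer and
inactive afterwards was so before, with the same blossom and distance, and labels never increase;
hence only backtracking can endanger the label bound. A structure that is backtracked was neither on
hold nor modified, so each arc out of its working vertex was read in vain, and that means the label
was small enough (`Inv.label_le_of_read`). New outer vertices always lie in working vertices of
modified structures, from which exhaustive contraction and the augmenting pass eliminate all edges
to other outer vertices (`Inv.noOuterArc`).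

That the trees remain trees follows from a rank, `2d + 1` on outer vertices of distance `d` and `2ℓ`
on inner ones, which increases along tree arcs (`Inv.exists_rank`). An overtaking arc starts at a
vertex of smaller rank than its target, hence outside the subtree that it moves. -/

namespace MatchingPhase

/-! ### The structural invariant, the rank, and the geometry of the alternating trees -/

section Invariant

variable {V : Type*} {G : SimpleGraph V} {M : G.Subgraph}

/-- The structural invariant of a phase.  `Out` is the set of the vertices of `G` that lie in outer
vertices of the trees; labels of matched arcs that were never visited exceed `L`. -/
structure Inv (M : G.Subgraph) (L : ℕ) (σ : State V) (Out : Set V) : Prop where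
  match_unique : ∀ {a b c : V}, M.Adj a b → M.Adj a c → b = c
  verts_unique : ∀ {α β x : V}, x ∈ (σ.str α).verts → x ∈ (σ.str β).verts → α = β
  arc_mem : ∀ {α a b : V}, (a, b) ∈ (σ.str α).arcs →
    a ∈ (σ.str α).verts ∧ b ∈ (σ.str α).verts
  blossom_sub : ∀ {α x : V} {B : Blossom V}, B ∈ (σ.str α).blossoms → x ∈ B.verts →
    x ∈ (σ.str α).verts
  root_trans : ∀ {x y z : V}, y ∈ σ.root x → z ∈ σ.root y → z ∈ σ.root x
  out_mem : ∀ {x : V}, x ∈ Out → ∃ α, x ∈ (σ.str α).verts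
  out_root : ∀ {x y : V}, y ∈ σ.root x → x ∈ Out → y ∈ Out
  inner_trivial : ∀ {α x y : V}, x ∈ (σ.str α).verts → x ∉ Out → y ∈ σ.root x → y = x
  base : ∀ {α x : V}, x ∈ (σ.str α).verts → α ∈ (σ.str α).verts ∧ IsFree M α ∧ α ∈ Out
  free_eq : ∀ {α γ : V}, IsFree M γ → γ ∈ (σ.str α).verts → γ = α
  free_mem : ∀ {γ : V}, IsFree M γ → γ ∉ σ.removed → γ ∈ (σ.str γ).verts
  not_removed : ∀ {α x : V}, x ∈ (σ.str α).verts → x ∉ σ.removed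
  match_mem : ∀ {α x y : V}, x ∈ (σ.str α).verts → M.Adj x y → y ∈ (σ.str α).verts
  match_removed : ∀ {x y : V}, x ∈ σ.removed → M.Adj x y → y ∈ σ.removed
  -- The condition on the roots singles out the tree arcs: arcs swallowed by a blossom stay in
  -- `G_α`, and nothing is required of them.
  arc_alt : ∀ {α a b : V}, (a, b) ∈ (σ.str α).arcs → σ.root a ≠ σ.root b →
    (a ∈ Out ↔ b ∉ Out)
  inner_arc : ∀ {α a b : V}, (a, b) ∈ (σ.str α).arcs → a ∉ Out → M.Adj a b
  inner_match : ∀ {α a b : V}, a ∈ (σ.str α).verts → a ∉ Out → M.Adj a b →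
    (a, b) ∈ (σ.str α).arcs
  enter_unique : ∀ {α a b a' b' : V}, (a, b) ∈ (σ.str α).arcs → (a', b') ∈ (σ.str α).arcs →
    σ.root a ≠ σ.root b → σ.root a' ≠ σ.root b' → σ.root b = σ.root b' → a = a' ∧ b = b'
  enter_base : ∀ {α a b : V}, (a, b) ∈ (σ.str α).arcs → σ.root a ≠ σ.root b →
    σ.root b ≠ σ.root α
  enter_exists : ∀ {α x : V}, x ∈ (σ.str α).verts → σ.root x ≠ σ.root α →
    ∃ a b, (a, b) ∈ (σ.str α).arcs ∧ σ.root a ≠ σ.root b ∧ σ.root b = σ.root x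
  -- Blossoms are not required to be odd cycles. All that is used of them is that matched edges
  -- leaving an outer blossom share their endpoint inside it.
  leave_unique : ∀ {x a b a' b' : V}, x ∈ Out → b ∈ σ.root x → b' ∈ σ.root x →
    M.Adj a b → M.Adj a' b' → a ∉ σ.root x → a' ∉ σ.root x → b = b'
  base_closed : ∀ {α a b : V}, α ∈ (σ.str α).verts → b ∈ σ.root α → M.Adj a b → a ∈ σ.root α
  -- This inequality makes the rank increase from an outer vertex to an inner child. It survives
  -- relabelling because distances can only fall, while a label falls only when its arc is
  -- reattached below a vertex of small distance.
  label_lt : ∀ {α b c t : V} {d : ℕ}, (b, c) ∈ (σ.str α).arcs → σ.root b ≠ σ.root c → c ∉ Out →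
    M.Adj c t → IsDistance M σ (σ.root b) d → d < σ.label c t
  label_visited : ∀ {x y : V}, M.Adj x y → σ.label x y ≤ L →
    x ∈ σ.removed ∨ ∃ α, x ∈ (σ.str α).verts
  work_outer : ∀ {α : V} {W : Set V}, (σ.str α).work = some W →
    ∃ x ∈ (σ.str α).verts, x ∈ Out ∧ σ.root x = W

namespace State

variable (σ : State V)

theorem mem_root_self (v : V) : v ∈ σ.root v :=
  ⟨Blossom.trivial v, Or.inr ⟨v, rfl⟩, rfl, rfl⟩

variable {σ}

theorem mem_root_comm {x y : V} : x ∈ σ.root y ↔ y ∈ σ.root x :=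
  ⟨fun ⟨B, h, h₁, h₂⟩ => ⟨B, h, h₂, h₁⟩, fun ⟨B, h, h₁, h₂⟩ => ⟨B, h, h₂, h₁⟩⟩

theorem mem_root_iff {x y : V} : y ∈ σ.root x ↔
    y = x ∨ ∃ α, ∃ B ∈ (σ.str α).blossoms, x ∈ B.verts ∧ y ∈ B.verts := by
  constructor
  · rintro ⟨B, ⟨α, h⟩ | ⟨v, rfl⟩, h₁, h₂⟩
    · exact Or.inr ⟨α, B, h, h₁, h₂⟩
    · exact Or.inl ((show y = v from h₂).trans (show x = v from h₁).symm)
  · rintro (rfl | ⟨α, B, h, h₁, h₂⟩)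
    · exact σ.mem_root_self _
    · exact ⟨B, Or.inl ⟨α, h⟩, h₁, h₂⟩

theorem root_congr {σ' : State V} (h : σ'.Omega = σ.Omega) : σ'.root = σ.root := by
  funext v
  simp only [root, h]

theorem anc_rank_le {rk : Set V → ℕ} (hrk : ∀ α X Y, σ.TreeArc α X Y → rk X < rk Y) {α : V}
    {X Y : Set V} (h : σ.Anc α X Y) : rk X ≤ rk Y := by
  induction h with
  | refl => exact le_rfl
  | tail _ h ih => exact ih.trans (hrk _ _ _ h).le

/-- `x` lies in a vertex of an active path. -/
def Active (σ : State V) (x : V) : Prop :=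
  ∃ γ W, (σ.str γ).work = some W ∧ σ.Anc γ (σ.root x) W

/-- `x` lies in the working vertex of a modified structure. -/
def InModifiedWork (σ : State V) (x : V) : Prop :=
  ∃ γ ∈ σ.modified, (σ.str γ).work = some (σ.root x)

end State

open State

namespace Inv

variable {L : ℕ} {σ : State V} {Out : Set V} (I : Inv M L σ Out)

include I

theorem root_eq_iff {x y : V} : σ.root x = σ.root y ↔ x ∈ σ.root y := by
  constructor
  · intro h
    rw [← h]
    exact σ.mem_root_self x
  · intro h
    ext z
    exact ⟨fun hz => I.root_trans h hz, fun hz => I.root_trans (mem_root_comm.1 h) hz⟩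

theorem mem_of_mem_root {α x y : V} (hx : x ∈ (σ.str α).verts) (h : y ∈ σ.root x) :
    y ∈ (σ.str α).verts := by
  rcases mem_root_iff.1 h with rfl | ⟨β, B, hB, h₁, h₂⟩
  · exact hx
  · rw [I.verts_unique hx (I.blossom_sub hB h₁)]
    exact I.blossom_sub hB h₂

theorem mem_of_root_eq {α x y : V} (hx : x ∈ (σ.str α).verts) (h : σ.root y = σ.root x) :
    y ∈ (σ.str α).verts :=
  I.mem_of_mem_root hx (I.root_eq_iff.1 h)

theorem out_of_root_eq {x y : V} (hx : x ∈ Out) (h : σ.root y = σ.root x) : y ∈ Out :=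
  I.out_root (I.root_eq_iff.1 h) hx

theorem eq_of_root_eq {α x y : V} (hx : x ∈ (σ.str α).verts) (ho : x ∉ Out)
    (h : σ.root y = σ.root x) : y = x :=
  I.inner_trivial hx ho (I.root_eq_iff.1 h)

theorem match_unique' {a b c : V} (h : M.Adj b a) (h' : M.Adj c a) : b = c :=
  I.match_unique h.symm h'.symm

theorem adj_of_enter {α a b : V} (h : (a, b) ∈ (σ.str α).arcs) (hr : σ.root a ≠ σ.root b)
    (hb : b ∈ Out) : M.Adj a b :=
  I.inner_arc h fun ha => (I.arc_alt h hr).1 ha hb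

theorem root_ne_of_inner {α a b : V} (ha : a ∈ (σ.str α).verts) (ho : a ∉ Out)
    (h : M.Adj a b) : σ.root a ≠ σ.root b := fun e =>
  h.ne (I.eq_of_root_eq ha ho e.symm).symm

theorem out_of_inner {α a b : V} (ha : a ∈ (σ.str α).verts) (ho : a ∉ Out)
    (h : M.Adj a b) : b ∈ Out := by
  by_contra hb
  exact ho ((I.arc_alt (I.inner_match ha ho h) (I.root_ne_of_inner ha ho h)).2 hb)

theorem exists_match_of_inner {α a : V} (ha : a ∈ (σ.str α).verts) (ho : a ∉ Out) :
    ∃ b, M.Adj a b := by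
  by_contra! h
  exact ho (I.free_eq h ha ▸ (I.base ha).2.2)

theorem not_free_of_root_ne {α x : V} (hx : x ∈ (σ.str α).verts) (h : σ.root x ≠ σ.root α) :
    ∀ γ ∈ σ.root x, ¬ IsFree M γ := fun γ hγ hf =>
  h (by rw [← I.free_eq hf (I.mem_of_mem_root hx hγ)]; exact (I.root_eq_iff.2 hγ).symm)

theorem distance_of_enter {α a b : V} (h : (a, b) ∈ (σ.str α).arcs)
    (hr : σ.root a ≠ σ.root b) (hb : b ∈ Out) :
    IsDistance M σ (σ.root b) (σ.label a b) :=
  Or.inr ⟨I.not_free_of_root_ne (I.arc_mem h).2 (I.enter_base h hr), a, b,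
    I.adj_of_enter h hr hb, fun e => hr (I.root_eq_iff.2 e), σ.mem_root_self b, rfl⟩

theorem exists_distance {x : V} (hx : x ∈ Out) : ∃ d, IsDistance M σ (σ.root x) d := by
  obtain ⟨α, hα⟩ := I.out_mem hx
  by_cases h : σ.root x = σ.root α
  · exact ⟨0, Or.inl ⟨⟨α, h ▸ σ.mem_root_self α, (I.base hα).2.1⟩, rfl⟩⟩
  · obtain ⟨a, b, hab, hr, hb⟩ := I.enter_exists hα h
    exact ⟨_, hb ▸ I.distance_of_enter hab hr (I.out_of_root_eq hx hb)⟩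

/-- Together with `exists_distance` this turns the relation `IsDistance` into a function on outer
vertices; uniqueness is `leave_unique`. -/
theorem distance_unique {x : V} (hx : x ∈ Out) {d d' : ℕ} (h : IsDistance M σ (σ.root x) d)
    (h' : IsDistance M σ (σ.root x) d') : d = d' := by
  rcases h with ⟨⟨γ, hγ, hf⟩, rfl⟩ | ⟨hn, a, b, hab, ha, hb, rfl⟩
  · rcases h' with ⟨-, rfl⟩ | ⟨hn, -⟩
    · rfl
    · exact absurd hf (hn γ hγ)
  · rcases h' with ⟨⟨γ, hγ, hf⟩, rfl⟩ | ⟨-, a', b', hab', ha', hb', rfl⟩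
    · exact absurd hf (hn γ hγ)
    · obtain rfl := I.leave_unique hx hb hb' hab hab' ha ha'
      rw [I.match_unique' hab hab']

/-- A rank that increases along the arcs of the trees. -/
theorem exists_rank : ∃ rk : Set V → ℕ, (∀ α X Y, σ.TreeArc α X Y → rk X < rk Y) ∧
    (∀ x d, x ∈ Out → IsDistance M σ (σ.root x) d → rk (σ.root x) = 2 * d + 1) ∧
    ∀ α v t, v ∈ (σ.str α).verts → v ∉ Out → M.Adj v t →
      rk (σ.root v) = 2 * σ.label v t := by
  classical
  -- Both sets are singletons on the vertices of the trees, so `sInf` merely reads off the distance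
  -- or the label. The doubling interleaves the two kinds: an arc from inner to outer goes from `2ℓ`
  -- to `2ℓ + 1`, and one from outer to inner from `2d + 1` to `2ℓ` with `d < ℓ`.
  let rk : Set V → ℕ := fun X => if ∃ x ∈ X, x ∈ Out then
    2 * sInf {d | IsDistance M σ X d} + 1 else 2 * sInf {l | ∃ c t, c ∈ X ∧ M.Adj c t ∧
      l = σ.label c t}
  have h₁ : ∀ x d, x ∈ Out → IsDistance M σ (σ.root x) d → rk (σ.root x) = 2 * d + 1 := by
    intro x d hx hd
    have : {d | IsDistance M σ (σ.root x) d} = {d} := by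
      ext d'
      exact ⟨fun h => I.distance_unique hx h hd, fun h => (show d' = d from h) ▸ hd⟩
    simp only [rk]
    rw [if_pos ⟨x, σ.mem_root_self x, hx⟩, this, csInf_singleton]
  have h₂ : ∀ α v t, v ∈ (σ.str α).verts → v ∉ Out → M.Adj v t →
      rk (σ.root v) = 2 * σ.label v t := by
    intro α v t hv ho hvt
    have : {l | ∃ c t, c ∈ σ.root v ∧ M.Adj c t ∧ l = σ.label c t} = {σ.label v t} := by
      ext l
      constructor
      · rintro ⟨c, s, hc, hcs, rfl⟩
        obtain rfl := I.inner_trivial hv ho hc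
        obtain rfl := I.match_unique hvt hcs
        rfl
      · rintro rfl
        exact ⟨v, t, σ.mem_root_self v, hvt, rfl⟩
    simp only [rk]
    rw [if_neg, this, csInf_singleton]
    rintro ⟨x, hx, hxo⟩
    exact ho (I.out_root (mem_root_comm.1 hx) hxo)
  refine ⟨rk, ?_, h₁, h₂⟩
  rintro α _ _ ⟨hne, a, b, hab, rfl, rfl⟩
  by_cases hb : b ∈ Out
  · have ha : a ∉ Out := fun h => (I.arc_alt hab hne).1 h hb
    rw [h₁ b _ hb (I.distance_of_enter hab hne hb),
      h₂ α a b (I.arc_mem hab).1 ha (I.inner_arc hab ha)]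
    omega
  · have ha : a ∈ Out := (I.arc_alt hab hne).2 hb
    obtain ⟨t, ht⟩ := I.exists_match_of_inner (I.arc_mem hab).2 hb
    obtain ⟨d, hd⟩ := I.exists_distance ha
    rw [h₁ a d ha hd, h₂ α b t (I.arc_mem hab).2 hb ht]
    have := I.label_lt hab hne hb ht hd
    omega

theorem parent_unique {α : V} {X Y Z : Set V} (h : σ.TreeArc α X Z) (h' : σ.TreeArc α Y Z) :
    X = Y := by
  obtain ⟨hne, a, b, hab, rfl, rfl⟩ := h
  obtain ⟨hne', a', b', hab', rfl, hb⟩ := h'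
  rw [(I.enter_unique hab hab' hne (hb ▸ hne') hb.symm).1]

theorem not_treeArc_base {α : V} {X : Set V} : ¬ σ.TreeArc α X (σ.root α) := by
  rintro ⟨hne, a, b, hab, rfl, hb⟩
  exact I.enter_base hab (hb ▸ hne) hb

theorem anc_base {α : V} {X : Set V} (h : σ.Anc α X (σ.root α)) : X = σ.root α := by
  rcases Relation.ReflTransGen.cases_tail h with h | ⟨Y, -, hY⟩
  · exact h.symm
  · exact absurd hY I.not_treeArc_base

/-- A directed cycle would contradict the strict growth of the rank. -/
theorem anc_antisymm {α : V} {X Y : Set V} (h : σ.Anc α X Y) (h' : σ.Anc α Y X) : X = Y := by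
  obtain ⟨rk, hrk, -⟩ := I.exists_rank
  rcases Relation.ReflTransGen.cases_tail h with h | ⟨Z, hZ, hZY⟩
  · exact h.symm
  · have := anc_rank_le hrk hZ
    have := anc_rank_le hrk h'
    have := hrk _ _ _ hZY
    omega

theorem not_anc_of_treeArc {α : V} {X Y : Set V} (h : σ.TreeArc α X Y) : ¬ σ.Anc α Y X :=
  fun h' => h.1 (I.anc_antisymm (Relation.ReflTransGen.single h) h')

theorem anc_total {α : V} {X Y Z : Set V} (h : σ.Anc α X Z) (h' : σ.Anc α Y Z) :
    σ.Anc α X Y ∨ σ.Anc α Y X := by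
  induction h with
  | refl => exact Or.inr h'
  | @tail Z W hX hZ ih =>
    rcases Relation.ReflTransGen.cases_tail h' with h | ⟨Z', hZ', h⟩
    · subst h
      exact Or.inl (hX.tail hZ)
    · obtain rfl := I.parent_unique h hZ
      exact ih hZ'

theorem anc_parent {α : V} {X Y Z : Set V} (h : σ.Anc α X Z) (hY : σ.TreeArc α Y Z)
    (hne : X ≠ Z) : σ.Anc α X Y := by
  rcases Relation.ReflTransGen.cases_tail h with h | ⟨Y', hY', h'⟩
  · exact absurd h.symm hne
  · rwa [I.parent_unique hY h']

/-- Going up from parent to parent lowers the rank, so the ascent stops, and only the root lacks a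
parent. -/
theorem base_anc {α x : V} (hx : x ∈ (σ.str α).verts) : σ.Anc α (σ.root α) (σ.root x) := by
  obtain ⟨rk, hrk, -⟩ := I.exists_rank
  generalize hn : rk (σ.root x) = n
  induction n using Nat.strong_induction_on generalizing x with
  | _ n ih =>
    by_cases h : σ.root x = σ.root α
    · rw [h]
      exact Relation.ReflTransGen.refl
    · obtain ⟨a, b, hab, hr, hb⟩ := I.enter_exists hx h
      have hT : σ.TreeArc α (σ.root a) (σ.root x) := ⟨hb ▸ hr, a, b, hab, rfl, hb⟩
      exact (ih _ (hn ▸ hrk _ _ _ hT) (I.arc_mem hab).1 rfl).tail hT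

theorem mem_of_anc {α y : V} {X : Set V} (h : σ.Anc α X (σ.root y)) (hy : y ∈ (σ.str α).verts) :
    ∃ x ∈ (σ.str α).verts, σ.root x = X := by
  rcases Relation.ReflTransGen.cases_head h with h | ⟨Z, ⟨-, a, b, hab, ha, -⟩, -⟩
  · exact ⟨y, hy, h.symm⟩
  · exact ⟨a, (I.arc_mem hab).1, ha⟩

/-- The only child of an inner vertex is its mate. -/
theorem anc_of_inner {α v t : V} {X : Set V} (hv : v ∈ (σ.str α).verts) (ho : v ∉ Out)
    (hvt : M.Adj v t) (h : σ.Anc α (σ.root v) X) (hne : X ≠ σ.root v) :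
    σ.Anc α (σ.root t) X := by
  rcases Relation.ReflTransGen.cases_head h with h | ⟨Z, ⟨-, a, b, hab, ha, rfl⟩, hZ⟩
  · exact absurd h.symm hne
  · obtain rfl := I.eq_of_root_eq hv ho ha
    obtain rfl := I.match_unique hvt (I.inner_arc hab ho)
    exact hZ

theorem treeArc_of_inner {α v t : V} (hv : v ∈ (σ.str α).verts) (ho : v ∉ Out)
    (hvt : M.Adj v t) : σ.TreeArc α (σ.root v) (σ.root t) :=
  ⟨I.root_ne_of_inner hv ho hvt, v, t, I.inner_match hv ho hvt, rfl, rfl⟩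

theorem exists_depth {α x : V} (hx : x ∈ (σ.str α).verts) : ∃ n, σ.AtDepth α n (σ.root x) := by
  have h := I.base_anc hx
  have hα := (I.base hx).1
  clear hx
  generalize σ.root x = X at h
  induction h with
  | refl => exact ⟨0, .root hα⟩
  | tail _ h ih =>
    obtain ⟨n, hn⟩ := ih
    exact ⟨n + 1, .child hn h⟩

/-- Tree arcs alternate between `Out` and its complement and the root is in `Out`, so membership in
`Out` is the parity of the depth. Hence `Out` is determined by the state. -/
theorem atDepth_parity {α : V} {n : ℕ} {X : Set V} (h : σ.AtDepth α n X) :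
    ∃ x ∈ (σ.str α).verts, σ.root x = X ∧ (x ∈ Out ↔ Even n) := by
  induction h with
  | root h => exact ⟨α, h, rfl, by simp [(I.base h).2.2]⟩
  | @child n X Y _ hT ih =>
    obtain ⟨x, -, rfl, hx⟩ := ih
    obtain ⟨hne, a, b, hab, ha, rfl⟩ := hT
    refine ⟨b, (I.arc_mem hab).2, rfl, ?_⟩
    have h₁ := I.arc_alt hab (ha ▸ hne)
    have h₂ : a ∈ Out ↔ x ∈ Out :=
      ⟨fun h => I.out_of_root_eq h ha.symm, fun h => I.out_of_root_eq h ha⟩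
    rw [Nat.even_add_one, ← hx, ← h₂, h₁, not_not]

theorem isOuterIn_iff {α x : V} :
    σ.IsOuterIn α (σ.root x) ↔ x ∈ (σ.str α).verts ∧ x ∈ Out := by
  constructor
  · rintro ⟨n, hn, h⟩
    obtain ⟨y, hy, hr, hi⟩ := I.atDepth_parity h
    exact ⟨I.mem_of_root_eq hy hr.symm, I.out_of_root_eq (hi.2 hn) hr.symm⟩
  · rintro ⟨hx, ho⟩
    obtain ⟨n, hn⟩ := I.exists_depth hx
    obtain ⟨y, -, hr, hi⟩ := I.atDepth_parity hn
    exact ⟨n, hi.1 (I.out_of_root_eq ho hr), hn⟩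

theorem work_mem {α x : V} (h : (σ.str α).work = some (σ.root x)) :
    x ∈ (σ.str α).verts ∧ x ∈ Out := by
  obtain ⟨y, hy, ho, hr⟩ := I.work_outer h
  exact ⟨I.mem_of_root_eq hy hr.symm, I.out_of_root_eq ho hr.symm⟩

end Inv

/-- How a state `σ` with outer vertices `Out` may evolve within a pass-bundle, before the final
backtracking, to the state `σ'` with outer vertices `Out'`. -/
structure Prog (M : G.Subgraph) (σ : State V) (Out : Set V) (σ' : State V) (Out' : Set V) :
    Prop where
  removed : ∀ {x : V}, x ∈ σ.removed → x ∈ σ'.removed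
  label : ∀ {x y : V}, M.Adj x y → σ'.label x y ≤ σ.label x y
  out : ∀ {x : V}, x ∈ Out → x ∉ σ'.removed → x ∈ Out'
  root : ∀ {x y : V}, x ∉ σ'.removed → σ.root x = σ.root y → σ'.root x = σ'.root y
  -- This clause carries `LabelBound` through an operation: no inactive outer vertex is created, and
  -- the distances of those that remain are untouched.
  inactive : ∀ {u : V}, u ∈ Out' → ¬ σ'.Active u → u ∈ Out ∧ ¬ σ.Active u ∧
    σ'.root u = σ.root u ∧ ∀ x y, M.Adj x y → y ∈ σ.root u → x ∉ σ.root u →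
      σ'.label x y = σ.label x y
  modified : ∀ {γ : V}, γ ∈ σ.modified → γ ∈ σ'.modified
  onHold : σ'.onHold = σ.onHold
  -- This clause serves the structures that are backtracked: they look at the end of the bundle as
  -- they did when their arcs were read.
  unmodified : ∀ {γ : V}, γ ∉ σ'.modified → σ'.str γ = σ.str γ ∧
    (∀ x ∈ (σ.str γ).verts, σ'.root x = σ.root x) ∧
    ∀ x ∈ (σ.str γ).verts, ∀ y, M.Adj x y → σ'.label x y = σ.label x y
  -- This clause and the next serve `NoOuterArc`: a vertex that has become outer stays in the
  -- working vertex of some modified structure until it is removed.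
  new_out : ∀ {x : V}, x ∈ Out' → x ∈ Out ∨ σ'.InModifiedWork x
  work : ∀ {x : V}, σ.InModifiedWork x → x ∉ σ'.removed → σ'.InModifiedWork x

theorem Prog.refl (σ : State V) (Out : Set V) : Prog M σ Out σ Out where
  removed := id
  label _ := le_rfl
  out h _ := h
  root _ := id
  inactive h h' := ⟨h, h', rfl, fun _ _ _ _ _ => rfl⟩
  modified := id
  onHold := rfl
  unmodified _ := ⟨rfl, fun _ _ => rfl, fun _ _ _ _ => rfl⟩
  new_out := Or.inl
  work h _ := h

/-- The invariant of the last state is needed for `new_out`: a vertex that is outer in the end is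
not removed, so its position in a modified working vertex persists. -/
theorem Prog.trans {L : ℕ} {σ σ' σ'' : State V} {Out Out' Out'' : Set V}
    (I : Inv M L σ'' Out'')
    (h : Prog M σ Out σ' Out') (h' : Prog M σ' Out' σ'' Out'') : Prog M σ Out σ'' Out'' where
  removed hx := h'.removed (h.removed hx)
  label hx := (h'.label hx).trans (h.label hx)
  out hx hn := h'.out (h.out hx fun e => hn (h'.removed e)) hn
  root hn e := h'.root hn (h.root (fun e => hn (h'.removed e)) e)
  inactive hu ha := by
    obtain ⟨h₁, h₂, h₃, h₄⟩ := h'.inactive hu ha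
    obtain ⟨k₁, k₂, k₃, k₄⟩ := h.inactive h₁ h₂
    rw [k₃] at h₃ h₄
    exact ⟨k₁, k₂, h₃, fun x y hxy hy hx => (h₄ x y hxy hy hx).trans (k₄ x y hxy hy hx)⟩
  modified hx := h'.modified (h.modified hx)
  onHold := h'.onHold.trans h.onHold
  unmodified hn := by
    obtain ⟨h₁, h₂, h₃⟩ := h'.unmodified hn
    obtain ⟨k₁, k₂, k₃⟩ := h.unmodified fun e => hn (h'.modified e)
    rw [k₁] at h₁ h₂ h₃
    exact ⟨h₁, fun x hx => (h₂ x hx).trans (k₂ x hx),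
      fun x hx y hxy => (h₃ x hx y hxy).trans (k₃ x hx y hxy)⟩
  new_out hx := by
    rcases h'.new_out hx with hx' | hx'
    · obtain ⟨α, hα⟩ := I.out_mem hx
      exact (h.new_out hx').imp_right fun e => h'.work e (I.not_removed hα)
    · exact Or.inr hx'
  work hx hn := h'.work (h.work hx fun e => hn (h'.removed e)) hn

/-- Paths in a tree survive a change of state that keeps its arcs, up to contractions. -/
theorem anc_map {σ σ' : State V} {γ δ : V} (hr : ∀ a b, a ∈ (σ.str γ).verts →
      σ.root a = σ.root b → σ'.root a = σ'.root b)
    (ha : ∀ a b, (a, b) ∈ (σ.str γ).arcs → a ∈ (σ.str γ).verts ∧ b ∈ (σ.str γ).verts ∧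
      (σ'.root a = σ'.root b ∨ (a, b) ∈ (σ'.str δ).arcs)) {x y : V}
    (hx : x ∈ (σ.str γ).verts) (h : σ.Anc γ (σ.root x) (σ.root y)) :
    σ'.Anc δ (σ'.root x) (σ'.root y) := by
  generalize hX : σ.root x = X at h
  generalize hY : σ.root y = Y at h
  induction h generalizing y with
  | refl =>
    rw [hr x y hx (hX.trans hY.symm)]
    exact Relation.ReflTransGen.refl
  | tail _ hT ih =>
    obtain ⟨hne, a, b, hab, ha', hb⟩ := hT
    obtain ⟨-, k₂, k₃⟩ := ha a b hab
    have ih' := ih ha'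
    rw [← hr b y k₂ (hb.trans hY.symm)]
    rcases k₃ with k₃ | k₃
    · rwa [← k₃]
    · by_cases hab' : σ'.root a = σ'.root b
      · rwa [← hab']
      · exact ih'.tail ⟨hab', a, b, k₃, rfl, rfl⟩

end Invariant

end MatchingPhase

namespace MatchingPhase

open State

/-! ### Augment: deleting two structures -/

section Augment

variable {V : Type*} {G : SimpleGraph V} {M : G.Subgraph} {L : ℕ} {σ : State V} {Out : Set V}
  {α β : V}

theorem augment_str_of_ne {γ : V} (hα : γ ≠ α) (hβ : γ ≠ β) :
    (σ.augment α β).str γ = σ.str γ := by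
  simp [State.augment, upd, hα, hβ]

theorem augment_str_of_eq {γ : V} (h : γ = α ∨ γ = β) :
    (σ.augment α β).str γ = FreeStructure.empty := by
  simp only [State.augment, upd]
  split_ifs <;> simp_all

theorem augment_cases (P : V → FreeStructure V → Prop)
    (h : ∀ γ, γ ≠ α → γ ≠ β → P γ (σ.str γ)) (h' : ∀ γ, P γ FreeStructure.empty) (γ : V) :
    P γ ((σ.augment α β).str γ) := by
  by_cases hγ : γ = α ∨ γ = β
  · rw [augment_str_of_eq hγ]
    exact h' γ
  · push Not at hγ
    rw [augment_str_of_ne hγ.1 hγ.2]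
    exact h γ hγ.1 hγ.2

theorem augment_mem {γ x : V} (hx : x ∈ ((σ.augment α β).str γ).verts) :
    γ ≠ α ∧ γ ≠ β ∧ x ∈ (σ.str γ).verts := by
  revert hx
  exact augment_cases (fun γ S => x ∈ S.verts → γ ≠ α ∧ γ ≠ β ∧ x ∈ (σ.str γ).verts)
    (fun γ h₁ h₂ h => ⟨h₁, h₂, h⟩) (fun γ h => h.elim) γ

theorem augment_arc {γ : V} {a : V × V} (ha : a ∈ ((σ.augment α β).str γ).arcs) :
    γ ≠ α ∧ γ ≠ β ∧ a ∈ (σ.str γ).arcs := by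
  revert ha
  exact augment_cases (fun γ S => a ∈ S.arcs → γ ≠ α ∧ γ ≠ β ∧ a ∈ (σ.str γ).arcs)
    (fun γ h₁ h₂ h => ⟨h₁, h₂, h⟩) (fun γ h => h.elim) γ

theorem augment_blossom {γ : V} {B : Blossom V} (hB : B ∈ ((σ.augment α β).str γ).blossoms) :
    γ ≠ α ∧ γ ≠ β ∧ B ∈ (σ.str γ).blossoms := by
  revert hB
  exact augment_cases (fun γ S => B ∈ S.blossoms → γ ≠ α ∧ γ ≠ β ∧ B ∈ (σ.str γ).blossoms)
    (fun γ h₁ h₂ h => ⟨h₁, h₂, h⟩) (fun γ h => h.elim) γ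

theorem augment_work {γ : V} {W : Set V} (hW : ((σ.augment α β).str γ).work = some W) :
    γ ≠ α ∧ γ ≠ β ∧ (σ.str γ).work = some W := by
  revert hW
  exact augment_cases (fun γ S => S.work = some W → γ ≠ α ∧ γ ≠ β ∧ (σ.str γ).work = some W)
    (fun γ h₁ h₂ h => ⟨h₁, h₂, h⟩) (fun γ h => by cases h) γ

theorem not_mem_augment_removed {x : V} : x ∉ (σ.augment α β).removed ↔
    x ∉ σ.removed ∧ x ∉ (σ.str α).verts ∧ x ∉ (σ.str β).verts := by
  simp [State.augment, not_or, and_assoc]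

namespace Inv

variable (I : Inv M L σ Out)

include I

theorem not_augment_removed {γ x : V} (hα : γ ≠ α) (hβ : γ ≠ β) (hx : x ∈ (σ.str γ).verts) :
    x ∉ (σ.augment α β).removed :=
  not_mem_augment_removed.2
    ⟨I.not_removed hx, fun h => hα (I.verts_unique hx h), fun h => hβ (I.verts_unique hx h)⟩

theorem augment_root {x : V} (hα : x ∉ (σ.str α).verts) (hβ : x ∉ (σ.str β).verts) :
    (σ.augment α β).root x = σ.root x := by
  ext y
  rw [mem_root_iff, mem_root_iff]
  constructor
  · rintro (rfl | ⟨γ, B, hB, hx, hy⟩)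
    · exact Or.inl rfl
    · exact Or.inr ⟨γ, B, (augment_blossom hB).2.2, hx, hy⟩
  · rintro (rfl | ⟨γ, B, hB, hx, hy⟩)
    · exact Or.inl rfl
    · have h := I.blossom_sub hB hx
      refine Or.inr ⟨γ, B, ?_, hx, hy⟩
      rwa [augment_str_of_ne]
      · rintro rfl
        exact hα h
      · rintro rfl
        exact hβ h

theorem augment_root' {x : V} (hx : x ∉ (σ.augment α β).removed) :
    (σ.augment α β).root x = σ.root x :=
  I.augment_root (not_mem_augment_removed.1 hx).2.1 (not_mem_augment_removed.1 hx).2.2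

theorem augment_root_mem {γ x : V} (hα : γ ≠ α) (hβ : γ ≠ β) (hx : x ∈ (σ.str γ).verts) :
    (σ.augment α β).root x = σ.root x :=
  I.augment_root' (I.not_augment_removed hα hβ hx)

/-- With the blossoms of the two structures deleted, their vertices fall back to trivial blossoms;
all other blossoms are untouched. -/
theorem augment_root_cases (x : V) : (σ.augment α β).root x = σ.root x ∨
    ∀ y ∈ (σ.augment α β).root x, y = x := by
  by_cases h : x ∈ (σ.str α).verts ∨ x ∈ (σ.str β).verts
  · right
    intro y hy
    rcases mem_root_iff.1 hy with rfl | ⟨γ, B, hB, hx, -⟩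
    · rfl
    · obtain ⟨h₁, h₂, h₃⟩ := augment_blossom hB
      have := I.blossom_sub h₃ hx
      rcases h with h | h
      · exact absurd (I.verts_unique this h) h₁
      · exact absurd (I.verts_unique this h) h₂
  · push Not at h
    exact Or.inl (I.augment_root h.1 h.2)

theorem augment_root_sub {x y : V} (h : y ∈ (σ.augment α β).root x) : y ∈ σ.root x := by
  rcases I.augment_root_cases (α := α) (β := β) x with h' | h'
  · rwa [← h']
  · rw [h' y h]
    exact σ.mem_root_self x

theorem augment_distance {x : V} (hx : x ∉ (σ.augment α β).removed) (d : ℕ) :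
    IsDistance M (σ.augment α β) ((σ.augment α β).root x) d ↔ IsDistance M σ (σ.root x) d := by
  rw [I.augment_root' hx]
  rfl

/-- Augment preserves the structural invariant. -/
theorem augment :
    Inv M L (σ.augment α β) (Out \ ((σ.str α).verts ∪ (σ.str β).verts)) where
  match_unique := I.match_unique
  verts_unique h h' := I.verts_unique (augment_mem h).2.2 (augment_mem h').2.2
  arc_mem h := by
    obtain ⟨h₁, h₂, h₃⟩ := augment_arc h
    rw [augment_str_of_ne h₁ h₂]
    exact I.arc_mem h₃
  blossom_sub h := by
    obtain ⟨h₁, h₂, h₃⟩ := augment_blossom h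
    rw [augment_str_of_ne h₁ h₂]
    exact I.blossom_sub h₃
  root_trans {x y z} hy hz := by
    rcases I.augment_root_cases (α := α) (β := β) x with h | h
    · rw [h] at hy ⊢
      exact I.root_trans hy (I.augment_root_sub hz)
    · obtain rfl := h y hy
      exact hz
  out_mem {x} hx := by
    obtain ⟨γ, hγ⟩ := I.out_mem hx.1
    refine ⟨γ, ?_⟩
    rw [augment_str_of_ne]
    · exact hγ
    · rintro rfl
      exact hx.2 (Or.inl hγ)
    · rintro rfl
      exact hx.2 (Or.inr hγ)
  out_root {x y} hy hx := by
    have h := I.augment_root_sub hy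
    refine ⟨I.out_root h hx.1, ?_⟩
    rintro (e | e)
    · exact hx.2 (Or.inl (I.mem_of_mem_root e (mem_root_comm.1 h)))
    · exact hx.2 (Or.inr (I.mem_of_mem_root e (mem_root_comm.1 h)))
  inner_trivial hx ho hy := by
    obtain ⟨h₁, h₂, h₃⟩ := augment_mem hx
    refine I.inner_trivial h₃ (fun h => ho ⟨h, ?_⟩) (I.augment_root_sub hy)
    rintro (e | e)
    · exact h₁ (I.verts_unique h₃ e)
    · exact h₂ (I.verts_unique h₃ e)
  base hx := by
    obtain ⟨h₁, h₂, h₃⟩ := augment_mem hx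
    obtain ⟨k₁, k₂, k₃⟩ := I.base h₃
    rw [augment_str_of_ne h₁ h₂]
    refine ⟨k₁, k₂, k₃, ?_⟩
    rintro (e | e)
    · exact h₁ (I.verts_unique k₁ e)
    · exact h₂ (I.verts_unique k₁ e)
  free_eq hf h := I.free_eq hf (augment_mem h).2.2
  free_mem {γ} hf h := by
    obtain ⟨h₁, h₂, h₃⟩ := not_mem_augment_removed.1 h
    have := I.free_mem hf h₁
    rwa [augment_str_of_ne]
    · rintro rfl
      exact h₂ this
    · rintro rfl
      exact h₃ this
  not_removed h := by
    obtain ⟨h₁, h₂, h₃⟩ := augment_mem h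
    exact I.not_augment_removed h₁ h₂ h₃
  match_mem h hxy := by
    obtain ⟨h₁, h₂, h₃⟩ := augment_mem h
    rw [augment_str_of_ne h₁ h₂]
    exact I.match_mem h₃ hxy
  match_removed h hxy := by
    rcases h with (h | h) | h
    · exact Or.inl (Or.inl (I.match_removed h hxy))
    · exact Or.inl (Or.inr (I.match_mem h hxy))
    · exact Or.inr (I.match_mem h hxy)
  arc_alt {γ a b} h hr := by
    obtain ⟨h₁, h₂, h₃⟩ := augment_arc h
    obtain ⟨ha, hb⟩ := I.arc_mem h₃
    rw [I.augment_root_mem h₁ h₂ ha, I.augment_root_mem h₁ h₂ hb] at hr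
    have := I.arc_alt h₃ hr
    have ha' := not_mem_augment_removed.1 (I.not_augment_removed h₁ h₂ ha)
    have hb' := not_mem_augment_removed.1 (I.not_augment_removed h₁ h₂ hb)
    simp [this, ha'.2.1, ha'.2.2, hb'.2.1, hb'.2.2]
  inner_arc {γ a b} h ho := by
    obtain ⟨h₁, h₂, h₃⟩ := augment_arc h
    have ha' := not_mem_augment_removed.1 (I.not_augment_removed h₁ h₂ (I.arc_mem h₃).1)
    exact I.inner_arc h₃ fun e => ho ⟨e, fun h => h.elim ha'.2.1 ha'.2.2⟩
  inner_match h ho hab := by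
    obtain ⟨h₁, h₂, h₃⟩ := augment_mem h
    have ha' := not_mem_augment_removed.1 (I.not_augment_removed h₁ h₂ h₃)
    rw [augment_str_of_ne h₁ h₂]
    exact I.inner_match h₃ (fun e => ho ⟨e, fun h => h.elim ha'.2.1 ha'.2.2⟩) hab
  enter_unique h h' hr hr' e := by
    obtain ⟨h₁, h₂, h₃⟩ := augment_arc h
    obtain ⟨k₁, k₂, k₃⟩ := augment_arc h'
    rw [I.augment_root_mem h₁ h₂ (I.arc_mem h₃).1, I.augment_root_mem h₁ h₂ (I.arc_mem h₃).2] at hr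
    rw [I.augment_root_mem k₁ k₂ (I.arc_mem k₃).1, I.augment_root_mem k₁ k₂ (I.arc_mem k₃).2] at hr'
    rw [I.augment_root_mem h₁ h₂ (I.arc_mem h₃).2, I.augment_root_mem k₁ k₂ (I.arc_mem k₃).2] at e
    exact I.enter_unique h₃ k₃ hr hr' e
  enter_base h hr := by
    obtain ⟨h₁, h₂, h₃⟩ := augment_arc h
    have hb := (I.arc_mem h₃).2
    rw [I.augment_root_mem h₁ h₂ (I.arc_mem h₃).1, I.augment_root_mem h₁ h₂ hb] at hr
    rw [I.augment_root_mem h₁ h₂ hb, I.augment_root_mem h₁ h₂ (I.base hb).1]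
    exact I.enter_base h₃ hr
  enter_exists h hr := by
    obtain ⟨h₁, h₂, h₃⟩ := augment_mem h
    rw [I.augment_root_mem h₁ h₂ h₃, I.augment_root_mem h₁ h₂ (I.base h₃).1] at hr
    obtain ⟨a, b, hab, k₁, k₂⟩ := I.enter_exists h₃ hr
    refine ⟨a, b, ?_, ?_⟩
    · rwa [augment_str_of_ne h₁ h₂]
    · rw [I.augment_root_mem h₁ h₂ h₃, I.augment_root_mem h₁ h₂ (I.arc_mem hab).1,
        I.augment_root_mem h₁ h₂ (I.arc_mem hab).2]
      exact ⟨k₁, k₂⟩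
  leave_unique {x a b a' b'} hx hb hb' hab hab' ha ha' := by
    have e := I.augment_root (fun h => hx.2 (Or.inl h)) (fun h => hx.2 (Or.inr h))
    rw [e] at hb hb' ha ha'
    exact I.leave_unique hx.1 hb hb' hab hab' ha ha'
  base_closed h hb hab := by
    obtain ⟨h₁, h₂, h₃⟩ := augment_mem h
    rw [I.augment_root_mem h₁ h₂ h₃] at hb ⊢
    exact I.base_closed h₃ hb hab
  label_lt h hr ho hct hd := by
    obtain ⟨h₁, h₂, h₃⟩ := augment_arc h
    obtain ⟨hb, hc⟩ := I.arc_mem h₃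
    rw [I.augment_root_mem h₁ h₂ hb, I.augment_root_mem h₁ h₂ hc] at hr
    have hc' := not_mem_augment_removed.1 (I.not_augment_removed h₁ h₂ hc)
    exact I.label_lt h₃ hr (fun e => ho ⟨e, fun h => h.elim hc'.2.1 hc'.2.2⟩) hct
      ((I.augment_distance (I.not_augment_removed h₁ h₂ hb) _).1 hd)
  label_visited {x y} hxy hl := by
    rcases I.label_visited hxy hl with h | ⟨γ, h⟩
    · exact Or.inl (Or.inl (Or.inl h))
    · by_cases hγ : γ = α
      · subst hγ
        exact Or.inl (Or.inl (Or.inr h))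
      · by_cases hγ' : γ = β
        · subst hγ'
          exact Or.inl (Or.inr h)
        · refine Or.inr ⟨γ, ?_⟩
          rwa [augment_str_of_ne hγ hγ']
  work_outer h := by
    obtain ⟨h₁, h₂, h₃⟩ := augment_work h
    obtain ⟨x, hx, ho, rfl⟩ := I.work_outer h₃
    have hx' := not_mem_augment_removed.1 (I.not_augment_removed h₁ h₂ hx)
    refine ⟨x, ?_, ⟨ho, fun h => h.elim hx'.2.1 hx'.2.2⟩, I.augment_root_mem h₁ h₂ hx⟩
    rwa [augment_str_of_ne h₁ h₂]

theorem augment_prog :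
    Prog M σ Out (σ.augment α β) (Out \ ((σ.str α).verts ∪ (σ.str β).verts)) where
  removed h := Or.inl (Or.inl h)
  label _ := le_rfl
  out h hn := ⟨h, fun e =>
    e.elim (not_mem_augment_removed.1 hn).2.1 (not_mem_augment_removed.1 hn).2.2⟩
  root {x y} hn e := by
    have hy : y ∉ (σ.augment α β).removed := by
      have := I.root_eq_iff.1 e
      rw [not_mem_augment_removed] at hn ⊢
      refine ⟨fun h => ?_, fun h => hn.2.1 (I.mem_of_mem_root h this),
        fun h => hn.2.2 (I.mem_of_mem_root h this)⟩
      rcases mem_root_iff.1 this with rfl | ⟨γ, B, hB, k₁, -⟩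
      · exact hn.1 h
      · exact I.not_removed (I.blossom_sub hB k₁) h
    rw [I.augment_root' hn, I.augment_root' hy, e]
  inactive {u} hu ha := by
    have e := I.augment_root (fun h => hu.2 (Or.inl h)) (fun h => hu.2 (Or.inr h))
    refine ⟨hu.1, fun ⟨γ, W, hW, hanc⟩ => ha ⟨γ, W, ?_⟩, e, fun _ _ _ _ _ => rfl⟩
    obtain ⟨w, hw, -, rfl⟩ := I.work_outer hW
    obtain ⟨x, hx, hr⟩ := I.mem_of_anc hanc hw
    have hu' := I.mem_of_root_eq hx hr.symm
    have h₁ : γ ≠ α := by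
      rintro rfl
      exact hu.2 (Or.inl hu')
    have h₂ : γ ≠ β := by
      rintro rfl
      exact hu.2 (Or.inr hu')
    have hs := augment_str_of_ne (σ := σ) h₁ h₂
    rw [hs]
    refine ⟨hW, ?_⟩
    rw [← I.augment_root_mem h₁ h₂ hw]
    refine anc_map (fun a b h e => ?_) (fun a b h => ?_) hu' hanc
    · rw [I.augment_root_mem h₁ h₂ h, e,
        I.augment_root_mem h₁ h₂ (I.mem_of_root_eq h e.symm)]
    · exact ⟨(I.arc_mem h).1, (I.arc_mem h).2, Or.inr (hs ▸ h)⟩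
  modified := Or.inl
  onHold := rfl
  unmodified {γ} h := by
    have h' : γ ≠ α ∧ γ ≠ β := by
      constructor
      · rintro rfl
        exact h (Or.inr (Or.inl rfl))
      · rintro rfl
        exact h (Or.inr (Or.inr rfl))
    exact ⟨augment_str_of_ne h'.1 h'.2, fun x hx => I.augment_root_mem h'.1 h'.2 hx,
      fun _ _ _ _ => rfl⟩
  new_out h := Or.inl h.1
  work {x} h hn := by
    obtain ⟨γ, hγ, hW⟩ := h
    have hx := (I.work_mem hW).1
    have hn' := not_mem_augment_removed.1 hn
    refine ⟨γ, Or.inl hγ, ?_⟩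
    rw [I.augment_root' hn, augment_str_of_ne]
    · exact hW
    · rintro rfl
      exact hn'.2.1 hx
    · rintro rfl
      exact hn'.2.2 hx

end Inv

end Augment

end MatchingPhase

namespace MatchingPhase

open State

/-! ### Contract: the cycle, its top vertex, and the new blossom -/

section Contract

variable {V : Type*} {G : SimpleGraph V} {M : G.Subgraph} {L : ℕ} {σ : State V} {Out : Set V}
  {α u v : V}

theorem contract_str_of_ne {γ : V} (h : γ ≠ α) :
    (σ.contract M α u v).str γ = σ.str γ := by
  simp [State.contract, upd, h]

theorem contract_str_self : (σ.contract M α u v).str α =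
    { verts := (σ.str α).verts
      arcs := (σ.str α).arcs ∪ {(u, v)}
      blossoms := (σ.str α).blossoms ∪ {σ.cycleBlossom α u v}
      work := some (σ.cycleVerts α u v) } := by
  simp [State.contract, upd]

theorem contract_verts (γ : V) :
    ((σ.contract M α u v).str γ).verts = (σ.str γ).verts := by
  by_cases h : γ = α
  · subst h
    rw [contract_str_self]
  · rw [contract_str_of_ne h]

theorem contract_arc {γ : V} {a : V × V} : a ∈ ((σ.contract M α u v).str γ).arcs ↔
    a ∈ (σ.str γ).arcs ∨ γ = α ∧ a = (u, v) := by
  by_cases h : γ = α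
  · subst h
    rw [contract_str_self]
    simp [or_comm]
  · rw [contract_str_of_ne h]
    simp [h]

theorem contract_blossom {γ : V} {B : Blossom V} :
    B ∈ ((σ.contract M α u v).str γ).blossoms ↔
      B ∈ (σ.str γ).blossoms ∨ γ = α ∧ B = σ.cycleBlossom α u v := by
  by_cases h : γ = α
  · subst h
    rw [contract_str_self]
    simp [or_comm]
  · rw [contract_str_of_ne h]
    simp [h]

theorem contract_label_of_notMem {x y : V} (h : x ∉ σ.cycleVerts α u v ∨ y ∉ σ.cycleVerts α u v) :
    (σ.contract M α u v).label x y = σ.label x y := by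
  simp only [State.contract]
  rw [if_neg]
  tauto

theorem contract_label_le (x y : V) : (σ.contract M α u v).label x y ≤ σ.label x y := by
  simp only [State.contract]
  split_ifs <;> simp

theorem mem_contract_root {x y : V} : y ∈ (σ.contract M α u v).root x ↔
    y ∈ σ.root x ∨ x ∈ σ.cycleVerts α u v ∧ y ∈ σ.cycleVerts α u v := by
  rw [mem_root_iff, mem_root_iff]
  simp only [contract_blossom]
  constructor
  · rintro (rfl | ⟨γ, B, hB | ⟨rfl, rfl⟩, hx, hy⟩)
    · exact Or.inl (Or.inl rfl)
    · exact Or.inl (Or.inr ⟨γ, B, hB, hx, hy⟩)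
    · exact Or.inr ⟨hx, hy⟩
  · rintro ((rfl | ⟨γ, B, hB, hx, hy⟩) | ⟨hx, hy⟩)
    · exact Or.inl rfl
    · exact Or.inr ⟨γ, B, Or.inl hB, hx, hy⟩
    · exact Or.inr ⟨α, _, Or.inr ⟨rfl, rfl⟩, hx, hy⟩

theorem contract_root_of_notMem {x : V} (h : x ∉ σ.cycleVerts α u v) :
    (σ.contract M α u v).root x = σ.root x := by
  ext y
  rw [mem_contract_root]
  tauto

theorem mem_cycle_left (hu : u ∈ (σ.str α).verts) : u ∈ σ.cycleVerts α u v :=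
  ⟨hu, Or.inl Relation.ReflTransGen.refl, fun _ h _ => h⟩

theorem mem_cycle_right (hv : v ∈ (σ.str α).verts) : v ∈ σ.cycleVerts α u v :=
  ⟨hv, Or.inr Relation.ReflTransGen.refl, fun _ _ h => h⟩

namespace Inv

variable (I : Inv M L σ Out)

include I

theorem cycle_sat {x y : V} (hx : x ∈ σ.cycleVerts α u v) (h : σ.root y = σ.root x) :
    y ∈ σ.cycleVerts α u v :=
  ⟨I.mem_of_root_eq hx.1 h, h ▸ hx.2⟩

theorem contract_root_of_mem {x : V} (h : x ∈ σ.cycleVerts α u v) :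
    (σ.contract M α u v).root x = σ.cycleVerts α u v := by
  ext y
  rw [mem_contract_root]
  constructor
  · rintro (hy | ⟨-, hy⟩)
    · exact I.cycle_sat h (I.root_eq_iff.2 hy)
    · exact hy
  · exact fun hy => Or.inr ⟨h, hy⟩

/-- A matched arc that enters an outer vertex is an arc of the tree. -/
theorem enter_of_match {γ x y : V} (hx : x ∈ (σ.str γ).verts) (ho : x ∈ Out) (hyx : M.Adj y x)
    (hy : y ∉ σ.root x) : σ.root x ≠ σ.root γ ∧ σ.root y ≠ σ.root x ∧
      (y, x) ∈ (σ.str γ).arcs := by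
  have hr : σ.root x ≠ σ.root γ := by
    intro e
    refine hy (e ▸ I.base_closed (I.base hx).1 ?_ hyx)
    rw [← e]
    exact σ.mem_root_self x
  obtain ⟨a, b, hab, hne, hb⟩ := I.enter_exists hx hr
  have hm := I.adj_of_enter hab hne (I.out_of_root_eq ho hb)
  obtain rfl := I.leave_unique ho (I.root_eq_iff.1 hb) (σ.mem_root_self x) hm hyx
    (fun h => hne ((I.root_eq_iff.2 h).trans hb.symm)) hy
  obtain rfl := I.match_unique' hm hyx
  exact ⟨hr, hne, hab⟩

theorem contract_root_mono {x y : V} (h : σ.root x = σ.root y) :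
    (σ.contract M α u v).root x = (σ.contract M α u v).root y := by
  by_cases hx : x ∈ σ.cycleVerts α u v
  · rw [I.contract_root_of_mem hx, I.contract_root_of_mem (I.cycle_sat hx h.symm)]
  · rw [contract_root_of_notMem hx, contract_root_of_notMem, h]
    exact fun hy => hx (I.cycle_sat hy h)

/-- The tree arcs after the contraction are the old ones that do not have both ends on the cycle; in
particular the added arc `(u, v)` is none. -/
theorem contract_root_ne_iff {x y : V} :
    (σ.contract M α u v).root x ≠ (σ.contract M α u v).root y ↔ σ.root x ≠ σ.root y ∧
      ¬ (x ∈ σ.cycleVerts α u v ∧ y ∈ σ.cycleVerts α u v) := by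
  constructor
  · refine fun h => ⟨fun e => h (I.contract_root_mono e), fun ⟨hx, hy⟩ => h ?_⟩
    rw [I.contract_root_of_mem hx, I.contract_root_of_mem hy]
  · rintro ⟨h₁, h₂⟩ h
    have : x ∈ (σ.contract M α u v).root y := h ▸ mem_root_self _ x
    rcases mem_contract_root.1 this with h | h
    · exact h₁ (I.root_eq_iff.2 h)
    · exact h₂ h.symm

variable (hu : u ∈ Out) (hv : v ∈ Out)

include hu hv

/-- The tree path from an inner cycle vertex to `Ω(u)` or `Ω(v)` is not trivial, as these are outer,
and it must pass through the mate, the only child. -/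
theorem cycle_inner {x y : V} (hx : x ∈ σ.cycleVerts α u v) (ho : x ∉ Out) (hxy : M.Adj x y) :
    y ∈ σ.cycleVerts α u v := by
  have hne : ∀ w ∈ Out, σ.root w ≠ σ.root x := fun w hw e =>
    ho (I.out_of_root_eq hw e.symm)
  refine ⟨I.match_mem hx.1 hxy, ?_, fun A h h' =>
    (hx.2.2 A h h').tail (I.treeArc_of_inner hx.1 ho hxy)⟩
  rcases hx.2.1 with h | h
  · exact Or.inl (I.anc_of_inner hx.1 ho hxy h (hne u hu))
  · exact Or.inr (I.anc_of_inner hx.1 ho hxy h (hne v hv))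

/-- Going up from a cycle vertex leaves the cycle only at the lowest common ancestor of `Ω(u)` and
`Ω(v)`. That vertex is outer: below an inner one, its only child would be a lower common ancestor.
-/
theorem cycle_parent {a b : V} (hb : b ∈ σ.cycleVerts α u v) (hab : (a, b) ∈ (σ.str α).arcs)
    (hr : σ.root a ≠ σ.root b) : a ∈ σ.cycleVerts α u v ∨
      b ∈ Out ∧ ∀ z ∈ σ.cycleVerts α u v, σ.Anc α (σ.root b) (σ.root z) := by
  have hT : σ.TreeArc α (σ.root a) (σ.root b) := ⟨hr, a, b, hab, rfl, rfl⟩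
  by_cases hc : σ.Anc α (σ.root b) (σ.root u) ∧ σ.Anc α (σ.root b) (σ.root v)
  · refine Or.inr ⟨?_, fun z hz => hz.2.2 _ hc.1 hc.2⟩
    by_contra ho
    obtain ⟨t, ht⟩ := I.exists_match_of_inner hb.1 ho
    have hne : ∀ w ∈ Out, σ.root w ≠ σ.root b := fun w hw e =>
      ho (I.out_of_root_eq hw e.symm)
    exact I.not_anc_of_treeArc (I.treeArc_of_inner hb.1 ho ht) (hb.2.2 _
      (I.anc_of_inner hb.1 ho ht hc.1 (hne u hu)) (I.anc_of_inner hb.1 ho ht hc.2 (hne v hv)))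
  · refine Or.inl ⟨(I.arc_mem hab).1, ?_, fun A h h' => ?_⟩
    · exact hb.2.1.imp (fun h => h.head hT) fun h => h.head hT
    · refine I.anc_parent (hb.2.2 A h h') hT ?_
      rintro rfl
      exact hc ⟨h, h'⟩

/-- Inner cycle vertices have their mates on the cycle, and the matched edge leaving an outer one is
its parent arc. So a matched edge can leave the new blossom only at the top of the cycle, which
yields `leave_unique` and `base_closed` for it. -/
theorem cycle_match {x y : V} (hx : x ∈ σ.cycleVerts α u v) (hyx : M.Adj y x)
    (hy : y ∉ σ.cycleVerts α u v) : x ∈ Out ∧ σ.root x ≠ σ.root α ∧ y ∉ σ.root x ∧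
      (y, x) ∈ (σ.str α).arcs ∧ ∀ z ∈ σ.cycleVerts α u v, σ.Anc α (σ.root x) (σ.root z) := by
  have ho : x ∈ Out := by
    by_contra ho
    exact hy (I.cycle_inner hu hv hx ho hyx.symm)
  have hyx' : y ∉ σ.root x := fun h => hy (I.cycle_sat hx (I.root_eq_iff.2 h))
  obtain ⟨hr, hne, hab⟩ := I.enter_of_match hx.1 ho hyx hyx'
  rcases I.cycle_parent hu hv hx hab hne with h | h
  · exact absurd h hy
  · exact ⟨ho, hr, hyx', hab, h.2⟩

omit hu hv in
theorem cycle_root_eq {a b : V} (ha : a ∈ σ.cycleVerts α u v) (hb : b ∈ σ.cycleVerts α u v)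
    (ha' : ∀ z ∈ σ.cycleVerts α u v, σ.Anc α (σ.root a) (σ.root z))
    (hb' : ∀ z ∈ σ.cycleVerts α u v, σ.Anc α (σ.root b) (σ.root z)) : σ.root a = σ.root b :=
  I.anc_antisymm (ha' b hb) (hb' a ha)

omit hu hv in
-- The tree path from the root to `x` has to enter `C` somewhere. Applied to the cycle, this gives
-- the new blossom its parent arc.
theorem exists_crossing {C : Set V} (hC : ∀ x ∈ C, ∀ y, σ.root y = σ.root x → y ∈ C) {x : V}
    (hx : x ∈ (σ.str α).verts) (hxC : x ∈ C) (hα : α ∉ C) :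
    ∃ a b, (a, b) ∈ (σ.str α).arcs ∧ a ∉ C ∧ b ∈ C := by
  have h := I.base_anc hx
  generalize hX : σ.root x = X at h
  induction h generalizing x with
  | refl => exact absurd (hC x hxC α hX.symm) hα
  | tail _ hT ih =>
    obtain ⟨-, a, b, hab, ha, hb⟩ := hT
    by_cases haC : a ∈ C
    · exact ih (I.arc_mem hab).1 haC ha
    · exact ⟨a, b, hab, haC, hC x hxC b (hb.trans hX.symm)⟩

theorem contract_label_lt {γ b c t : V} {d : ℕ} (hua : u ∈ (σ.str α).verts)
    (hva : v ∈ (σ.str α).verts)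
    (h : (b, c) ∈ ((σ.contract M α u v).str γ).arcs)
    (hr : (σ.contract M α u v).root b ≠ (σ.contract M α u v).root c)
    (ho : c ∉ Out ∪ σ.cycleVerts α u v) (hct : M.Adj c t)
    (hd : IsDistance M (σ.contract M α u v) ((σ.contract M α u v).root b) d) :
    d < (σ.contract M α u v).label c t := by
  have hcC : c ∉ σ.cycleVerts α u v := fun h => ho (Or.inr h)
  have hco : c ∉ Out := fun h => ho (Or.inl h)
  rw [contract_label_of_notMem (Or.inl hcC)]
  have hr' := (I.contract_root_ne_iff.1 hr).1
  rcases contract_arc.1 h with h | ⟨rfl, e⟩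
  swap
  · cases e
    exact absurd (mem_cycle_right hva) hcC
  by_cases hbC : b ∈ σ.cycleVerts α u v
  · obtain rfl := I.verts_unique hbC.1 (I.arc_mem h).1
    rw [I.contract_root_of_mem hbC] at hd
    have hbo : b ∈ Out := (I.arc_alt h hr').2 hco
    obtain ⟨d₀, hd₀⟩ := I.exists_distance hbo
    have hlt := I.label_lt h hr' hco hct hd₀
    rcases hd with ⟨-, rfl⟩ | ⟨hn, x, y, hxy, hx, hy, rfl⟩
    · omega
    · obtain ⟨k₁, k₂, k₃, k₄, k₅⟩ := I.cycle_match hu hv hy hxy hx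
      rw [contract_label_of_notMem (Or.inl hx)]
      have hdy := I.distance_of_enter k₄ (fun e => k₃ (I.root_eq_iff.1 e)) k₁
      -- The new distance is the label of the arc into the top of the cycle, which is not reset
      -- because its tail is off the cycle. The top is an ancestor of `Ω(b)`, so by the rank its
      -- distance is at most that of `Ω(b)`.
      obtain ⟨rk, hrk, hrk', -⟩ := I.exists_rank
      have := anc_rank_le hrk (k₅ b hbC)
      rw [hrk' _ _ k₁ hdy, hrk' _ _ hbo hd₀] at this
      omega
  · refine I.label_lt h hr' hco hct ?_
    rw [contract_root_of_notMem hbC] at hd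
    rcases hd with hd | ⟨hn, x, y, hxy, hx, hy, rfl⟩
    · exact Or.inl hd
    · refine Or.inr ⟨hn, x, y, hxy, hx, hy, contract_label_of_notMem (Or.inr fun h => hbC ?_)⟩
      exact I.cycle_sat h (I.root_eq_iff.2 hy).symm

/-- Contract preserves the structural invariant; all vertices of the blossom become outer. -/
theorem contract (hua : u ∈ (σ.str α).verts) (hva : v ∈ (σ.str α).verts) :
    Inv M L (σ.contract M α u v) (Out ∪ σ.cycleVerts α u v) where
  match_unique := I.match_unique
  verts_unique h h' := by
    rw [contract_verts] at h h'
    exact I.verts_unique h h'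
  arc_mem h := by
    rw [contract_verts]
    rcases contract_arc.1 h with h | ⟨rfl, e⟩
    · exact I.arc_mem h
    · cases e
      exact ⟨hua, hva⟩
  blossom_sub h hx := by
    rw [contract_verts]
    rcases contract_blossom.1 h with h | ⟨rfl, rfl⟩
    · exact I.blossom_sub h hx
    · exact hx.1
  root_trans {x y z} hy hz := by
    by_cases hx : x ∈ σ.cycleVerts α u v
    · rw [I.contract_root_of_mem hx] at hy ⊢
      rwa [I.contract_root_of_mem hy] at hz
    · rw [contract_root_of_notMem hx] at hy ⊢
      rw [contract_root_of_notMem] at hz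
      · exact I.root_trans hy hz
      · exact fun h => hx (I.cycle_sat h (I.root_eq_iff.2 hy).symm)
  out_mem h := by
    simp only [contract_verts]
    rcases h with h | h
    · exact I.out_mem h
    · exact ⟨α, h.1⟩
  out_root {x y} hy hx := by
    rcases mem_contract_root.1 hy with h | h
    · exact hx.imp (I.out_root h) fun hx => I.cycle_sat hx (I.root_eq_iff.2 h)
    · exact Or.inr h.2
  inner_trivial hx ho hy := by
    rw [contract_verts] at hx
    rw [contract_root_of_notMem fun h => ho (Or.inr h)] at hy
    exact I.inner_trivial hx (fun h => ho (Or.inl h)) hy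
  base hx := by
    rw [contract_verts] at hx ⊢
    exact ⟨(I.base hx).1, (I.base hx).2.1, Or.inl (I.base hx).2.2⟩
  free_eq hf h := by
    rw [contract_verts] at h
    exact I.free_eq hf h
  free_mem hf h := by
    rw [contract_verts]
    exact I.free_mem hf h
  not_removed h := by
    rw [contract_verts] at h
    exact I.not_removed h
  match_mem h hxy := by
    rw [contract_verts] at h ⊢
    exact I.match_mem h hxy
  match_removed h hxy := I.match_removed h hxy
  arc_alt {γ a b} h hr := by
    obtain ⟨hr, hC⟩ := I.contract_root_ne_iff.1 hr
    rcases contract_arc.1 h with h | ⟨rfl, e⟩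
    swap
    · cases e
      exact absurd ⟨mem_cycle_left hua, mem_cycle_right hva⟩ hC
    have halt := I.arc_alt h hr
    by_cases ha : a ∈ σ.cycleVerts α u v
    · have hb : b ∉ σ.cycleVerts α u v := fun hb => hC ⟨ha, hb⟩
      have : a ∈ Out := by
        by_contra ho
        exact hb (I.cycle_inner hu hv ha ho (I.inner_arc h ho))
      simp [this, ha, hb, halt.1 this]
    · by_cases hb : b ∈ σ.cycleVerts α u v
      · obtain rfl := I.verts_unique hb.1 (I.arc_mem h).2
        rcases I.cycle_parent hu hv hb h hr with h | h
        · exact absurd h ha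
        · have : a ∉ Out := fun e => halt.1 e h.1
          simp [this, ha, hb]
      · simp [ha, hb, halt]
  inner_arc h ho := by
    rcases contract_arc.1 h with h | ⟨rfl, e⟩
    · exact I.inner_arc h fun e => ho (Or.inl e)
    · cases e
      exact absurd (Or.inl hu) ho
  inner_match h ho hab := by
    rw [contract_verts] at h
    exact contract_arc.2 (Or.inl (I.inner_match h (fun e => ho (Or.inl e)) hab))
  enter_unique {γ a b a' b'} h h' hr hr' e := by
    obtain ⟨hr, hC⟩ := I.contract_root_ne_iff.1 hr
    obtain ⟨hr', hC'⟩ := I.contract_root_ne_iff.1 hr'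
    rcases contract_arc.1 h with h | ⟨rfl, e'⟩
    swap
    · cases e'
      exact absurd ⟨mem_cycle_left hua, mem_cycle_right hva⟩ hC
    rcases contract_arc.1 h' with h' | ⟨rfl, e'⟩
    swap
    · cases e'
      exact absurd ⟨mem_cycle_left hua, mem_cycle_right hva⟩ hC'
    have hmem : b ∈ (σ.contract M α u v).root b' := e ▸ mem_root_self _ b
    rcases mem_contract_root.1 hmem with hb | ⟨hb', hb⟩
    · exact I.enter_unique h h' hr hr' (I.root_eq_iff.2 hb)
    · obtain rfl := I.verts_unique hb.1 (I.arc_mem h).2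
      rcases I.cycle_parent hu hv hb h hr with k | k
      · exact absurd ⟨k, hb⟩ hC
      rcases I.cycle_parent hu hv hb' h' hr' with k' | k'
      · exact absurd ⟨k', hb'⟩ hC'
      exact I.enter_unique h h' hr hr' (I.cycle_root_eq hb hb' k.2 k'.2)
  enter_base {γ a b} h hr e := by
    obtain ⟨hr, hC⟩ := I.contract_root_ne_iff.1 hr
    rcases contract_arc.1 h with h | ⟨rfl, e'⟩
    swap
    · cases e'
      exact absurd ⟨mem_cycle_left hua, mem_cycle_right hva⟩ hC
    have hmem : b ∈ (σ.contract M α u v).root γ := e ▸ mem_root_self _ b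
    rcases mem_contract_root.1 hmem with hb | ⟨hγ, hb⟩
    · exact I.enter_base h hr (I.root_eq_iff.2 hb)
    · obtain rfl := I.verts_unique hb.1 (I.arc_mem h).2
      rcases I.cycle_parent hu hv hb h hr with k | k
      · exact hC ⟨k, hb⟩
      · exact I.enter_base h hr (I.anc_base (k.2 _ hγ))
  enter_exists {γ x} hx hr := by
    rw [contract_verts] at hx
    obtain ⟨hr, hC⟩ := I.contract_root_ne_iff.1 hr
    by_cases hxC : x ∈ σ.cycleVerts α u v
    · obtain rfl := I.verts_unique hxC.1 hx
      obtain ⟨a, b, hab, ha, hb⟩ := I.exists_crossing (C := σ.cycleVerts α u v)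
        (fun x hx y hy => I.cycle_sat hx hy) hx hxC fun h => hC ⟨hxC, h⟩
      refine ⟨a, b, contract_arc.2 (Or.inl hab), I.contract_root_ne_iff.2
        ⟨fun e => ha (I.cycle_sat hb e), fun h => ha h.1⟩, ?_⟩
      rw [I.contract_root_of_mem hxC, I.contract_root_of_mem hb]
    · obtain ⟨a, b, hab, hne, hb⟩ := I.enter_exists hx hr
      exact ⟨a, b, contract_arc.2 (Or.inl hab), I.contract_root_ne_iff.2
        ⟨hne, fun h => hxC (I.cycle_sat h.2 hb.symm)⟩, I.contract_root_mono hb⟩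
  leave_unique {x a b a' b'} hx hb hb' hab hab' ha ha' := by
    by_cases hxC : x ∈ σ.cycleVerts α u v
    · rw [I.contract_root_of_mem hxC] at hb hb' ha ha'
      obtain ⟨k₁, -, k₂, -, k₃⟩ := I.cycle_match hu hv hb hab ha
      obtain ⟨l₁, -, l₂, -, l₃⟩ := I.cycle_match hu hv hb' hab' ha'
      have e := I.cycle_root_eq hb hb' k₃ l₃
      exact I.leave_unique k₁ (σ.mem_root_self b) (e ▸ σ.mem_root_self b') hab hab' k₂ (e ▸ l₂)
    · rw [contract_root_of_notMem hxC] at hb hb' ha ha'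
      exact I.leave_unique (hx.resolve_right hxC) hb hb' hab hab' ha ha'
  base_closed {γ a b} h hb hab := by
    rw [contract_verts] at h
    by_cases hγ : γ ∈ σ.cycleVerts α u v
    · obtain rfl := I.verts_unique hγ.1 h
      rw [I.contract_root_of_mem hγ] at hb ⊢
      by_contra ha
      obtain ⟨-, k₁, -, -, k₂⟩ := I.cycle_match hu hv hb hab ha
      exact k₁ (I.anc_base (k₂ _ hγ))
    · rw [contract_root_of_notMem hγ] at hb ⊢
      exact I.base_closed h hb hab
  label_lt h hr ho hct hd := I.contract_label_lt hu hv hua hva h hr ho hct hd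
  label_visited {x y} hxy hl := by
    simp only [contract_verts]
    by_cases hC : x ∈ σ.cycleVerts α u v
    · exact Or.inr ⟨α, hC.1⟩
    · rw [contract_label_of_notMem (Or.inl hC)] at hl
      exact I.label_visited hxy hl
  work_outer {γ W} h := by
    rw [contract_verts]
    by_cases hγ : γ = α
    · subst hγ
      rw [contract_str_self] at h
      cases h
      exact ⟨u, hua, Or.inl hu, I.contract_root_of_mem (mem_cycle_left hua)⟩
    · rw [contract_str_of_ne hγ] at h
      obtain ⟨x, hx, ho, rfl⟩ := I.work_outer h
      exact ⟨x, hx, Or.inl ho, contract_root_of_notMem fun hC => hγ (I.verts_unique hx hC.1)⟩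

omit hu hv in
theorem contract_prog (hW : (σ.str α).work = some (σ.root u)) :
    Prog M σ Out (σ.contract M α u v) (Out ∪ σ.cycleVerts α u v) where
  removed := id
  label _ := contract_label_le _ _
  out h _ := Or.inl h
  root _ := I.contract_root_mono
  inactive {w} hw ha := by
    -- The blossom becomes the working vertex, so everything that the contraction makes outer is
    -- active, and the labels reset to `0` concern no inactive vertex.
    have hwC : w ∉ σ.cycleVerts α u v := by
      intro h
      refine ha ⟨α, _, by rw [contract_str_self], ?_⟩
      rw [I.contract_root_of_mem h]
      exact Relation.ReflTransGen.refl
    have hwo := hw.resolve_right hwC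
    refine ⟨hwo, fun ⟨γ, W, hW', hanc⟩ => ha ?_, contract_root_of_notMem hwC,
      fun x y _ hy _ => contract_label_of_notMem (Or.inr fun h => hwC ?_)⟩
    · obtain ⟨z, hz, -, rfl⟩ := I.work_outer hW'
      obtain ⟨x, hx, hr⟩ := I.mem_of_anc hanc hz
      have := anc_map (σ' := σ.contract M α u v) (δ := γ)
        (fun a b _ e => I.contract_root_mono e)
        (fun a b h => ⟨(I.arc_mem h).1, (I.arc_mem h).2, Or.inr (contract_arc.2 (Or.inl h))⟩)
        (I.mem_of_root_eq hx hr.symm) hanc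
      refine ⟨γ, _, ?_, this⟩
      -- In `S_α` the old working vertex `Ω(u)` is absorbed by the new one, so the image of the old
      -- active path is still active.
      by_cases hγ : γ = α
      · subst hγ
        rw [hW] at hW'
        have e : σ.root z = σ.root u := (Option.some.inj hW').symm
        rw [contract_str_self, I.contract_root_mono e,
          I.contract_root_of_mem (mem_cycle_left (I.work_mem hW).1)]
      · rw [contract_str_of_ne hγ, hW', contract_root_of_notMem]
        exact fun h => hγ (I.verts_unique hz h.1)
    · exact I.cycle_sat h (I.root_eq_iff.2 hy).symm
  modified := Or.inl
  onHold := rfl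
  unmodified {γ} h := by
    have hγ : γ ≠ α := fun e => h (Or.inr e)
    have hC : ∀ x ∈ (σ.str γ).verts, x ∉ σ.cycleVerts α u v := fun x hx h =>
      hγ (I.verts_unique hx h.1)
    exact ⟨contract_str_of_ne hγ, fun x hx => contract_root_of_notMem (hC x hx),
      fun x hx y _ => contract_label_of_notMem (Or.inl (hC x hx))⟩
  new_out {x} h := by
    refine h.imp_right fun h => ⟨α, Or.inr rfl, ?_⟩
    rw [contract_str_self, I.contract_root_of_mem h]
  work {x} h _ := by
    obtain ⟨γ, hγ, h⟩ := h
    refine ⟨γ, Or.inl hγ, ?_⟩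
    by_cases e : γ = α
    · subst e
      rw [contract_str_self, I.contract_root_of_mem]
      rw [hW] at h
      exact I.cycle_sat (mem_cycle_left (I.work_mem hW).1) (Option.some.inj h).symm
    · rw [contract_str_of_ne e, h, contract_root_of_notMem]
      exact fun hC => e (I.verts_unique (I.work_mem h).1 hC.1)

end Inv

end Contract

end MatchingPhase

namespace MatchingPhase

open State

/-! ### Relabelling, and Overtake of an unvisited matched arc -/

section Overtake

variable {V : Type*} {G : SimpleGraph V} {M : G.Subgraph} {L : ℕ} {σ σ' : State V} {Out : Set V}
  {α β p u v t : V} {k d : ℕ}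

theorem relabel_self : σ.relabel v t k v t = k := by
  simp [State.relabel, upd]

theorem relabel_of_ne {x y : V} (h : x ≠ v ∨ y ≠ t) : σ.relabel v t k x y = σ.label x y := by
  by_cases hx : x = v
  · subst hx
    have hy : y ≠ t := h.resolve_left (not_not_intro rfl)
    simp [State.relabel, upd, hy]
  · simp [State.relabel, upd, hx]

theorem relabel_le (hk : k ≤ σ.label v t) (x y : V) : σ.relabel v t k x y ≤ σ.label x y := by
  by_cases h : x = v ∧ y = t
  · rw [h.1, h.2, relabel_self]
    exact hk
  · rw [relabel_of_ne]
    tauto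

theorem relabel_distance (hk : k ≤ σ.label v t) (hl : σ'.label = σ.relabel v t k) {X : Set V}
    {e : ℕ} (h : IsDistance M σ' X e) : ∃ e', e ≤ e' ∧ IsDistance M σ X e' := by
  rcases h with h | ⟨hn, x, y, hxy, hx, hy, rfl⟩
  · exact ⟨e, le_rfl, Or.inl h⟩
  · exact ⟨σ.label x y, hl ▸ relabel_le hk x y, Or.inr ⟨hn, x, y, hxy, hx, hy, rfl⟩⟩

namespace Inv

variable (I : Inv M L σ Out)

include I

/-- Common to all forms of Overtake. Below the new arc `(u, v)` the label is `d + 1`, just above the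
distance `d` of `Ω(u)`; other arcs have a head different from `v`, so their label is unchanged while
the distance of the tail cannot grow. -/
theorem relabel_label_lt (hk : d + 1 ≤ σ.label v t) (hl : σ'.label = σ.relabel v t (d + 1))
    (hu : u ∈ Out) (hd : IsDistance M σ (σ.root u) d) (hvt : M.Adj v t) {b c s : V} {e : ℕ}
    (h : b = u ∧ c = v ∨ c ≠ v ∧ ∃ γ, (b, c) ∈ (σ.str γ).arcs)
    (hr : σ.root b ≠ σ.root c) (ho : c ∉ Out) (hcs : M.Adj c s)
    (he : IsDistance M σ' (σ.root b) e) : e < σ'.label c s := by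
  obtain ⟨e', hee', he'⟩ := relabel_distance hk hl he
  rcases h with ⟨rfl, rfl⟩ | ⟨hc, γ, h⟩
  · obtain rfl := I.match_unique hvt hcs
    obtain rfl := I.distance_unique hu hd he'
    rw [hl, relabel_self]
    omega
  · have := I.label_lt h hr ho hcs he'
    rw [hl, relabel_of_ne (Or.inl hc)]
    omega

/-- A non-outer vertex of a structure always carries its matched arc there. So if `(v, t)` is in no
structure, neither are `v` and `t`. -/
theorem not_mem_verts_of_unvisited (hv : v ∉ Out) (hvt : M.Adj v t)
    (hn : ∀ γ, (v, t) ∉ (σ.str γ).arcs) (γ : V) : v ∉ (σ.str γ).verts ∧ t ∉ (σ.str γ).verts :=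
  have h : v ∉ (σ.str γ).verts := fun h => hn γ (I.inner_match h hv hvt)
  ⟨h, fun h' => h (I.match_mem h' hvt.symm)⟩

theorem root_of_unvisited {x y : V} (hx : ∀ γ, x ∉ (σ.str γ).verts) (hy : y ∈ σ.root x) :
    y = x := by
  rcases mem_root_iff.1 hy with h | ⟨γ, B, hB, h, -⟩
  · exact h
  · exact absurd (I.blossom_sub hB h) (hx γ)

end Inv

theorem overtakeUnvisited_str_of_ne {γ : V} (h : γ ≠ α) :
    (σ.overtakeUnvisited α u v t k).str γ = σ.str γ := by
  simp [State.overtakeUnvisited, upd, h]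

theorem overtakeUnvisited_str_self : (σ.overtakeUnvisited α u v t k).str α =
    { verts := (σ.str α).verts ∪ {v, t}
      arcs := (σ.str α).arcs ∪ {(u, v), (v, t)}
      blossoms := (σ.str α).blossoms ∪ {Blossom.trivial v, Blossom.trivial t}
      work := some (σ.root t) } := by
  simp [State.overtakeUnvisited, upd]

theorem overtakeUnvisited_mem {γ x : V} : x ∈ ((σ.overtakeUnvisited α u v t k).str γ).verts ↔
    x ∈ (σ.str γ).verts ∨ γ = α ∧ (x = v ∨ x = t) := by
  by_cases h : γ = α
  · subst h
    rw [overtakeUnvisited_str_self]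
    simp only [Set.mem_union, Set.mem_insert_iff, Set.mem_singleton_iff, true_and]
  · rw [overtakeUnvisited_str_of_ne h]
    simp [h]

theorem overtakeUnvisited_arc {γ : V} {a : V × V} :
    a ∈ ((σ.overtakeUnvisited α u v t k).str γ).arcs ↔
    a ∈ (σ.str γ).arcs ∨ γ = α ∧ (a = (u, v) ∨ a = (v, t)) := by
  by_cases h : γ = α
  · subst h
    rw [overtakeUnvisited_str_self]
    simp only [Set.mem_union, Set.mem_insert_iff, Set.mem_singleton_iff, true_and]
  · rw [overtakeUnvisited_str_of_ne h]
    simp [h]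

theorem overtakeUnvisited_blossom {γ : V} {B : Blossom V} :
    B ∈ ((σ.overtakeUnvisited α u v t k).str γ).blossoms ↔
    B ∈ (σ.str γ).blossoms ∨ γ = α ∧ (B = Blossom.trivial v ∨ B = Blossom.trivial t) := by
  by_cases h : γ = α
  · subst h
    rw [overtakeUnvisited_str_self]
    simp only [Set.mem_union, Set.mem_insert_iff, Set.mem_singleton_iff, true_and]
  · rw [overtakeUnvisited_str_of_ne h]
    simp [h]

theorem overtakeUnvisited_root : (σ.overtakeUnvisited α u v t k).root = σ.root := by
  refine root_congr ?_
  ext B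
  simp only [State.Omega, overtakeUnvisited_blossom, Set.mem_ofPred_eq]
  constructor
  · rintro (⟨γ, h | ⟨rfl, rfl | rfl⟩⟩ | h)
    · exact Or.inl ⟨γ, h⟩
    · exact Or.inr ⟨_, rfl⟩
    · exact Or.inr ⟨_, rfl⟩
    · exact Or.inr h
  · rintro (⟨γ, h⟩ | h)
    · exact Or.inl ⟨γ, Or.inl h⟩
    · exact Or.inr h

namespace Inv

variable (I : Inv M L σ Out)

include I

/-- Overtaking an unvisited matched arc preserves the structural invariant. -/
theorem overtakeUnvisited (hW : (σ.str α).work = some (σ.root u)) (hv : v ∉ Out)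
    (hvr : v ∉ σ.removed) (hvt : M.Adj v t) (hd : IsDistance M σ (σ.root u) d)
    (hlt : d + 1 < σ.label v t) (hn : ∀ γ, (v, t) ∉ (σ.str γ).arcs) :
    Inv M L (σ.overtakeUnvisited α u v t (d + 1)) (Out ∪ {t}) := by
  have hnv := I.not_mem_verts_of_unvisited hv hvt hn
  obtain ⟨hua, huo⟩ := I.work_mem hW
  have hRv : ∀ y, y ∈ σ.root v → y = v := fun y => I.root_of_unvisited fun γ => (hnv γ).1
  have hRt : ∀ y, y ∈ σ.root t → y = t := fun y => I.root_of_unvisited fun γ => (hnv γ).2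
  have hold : ∀ {γ x}, x ∈ (σ.str γ).verts → x ≠ v ∧ x ≠ t := by
    intro γ x hx
    constructor
    · rintro rfl
      exact (hnv γ).1 hx
    · rintro rfl
      exact (hnv γ).2 hx
  have hRvt : ∀ {γ x}, x ∈ (σ.str γ).verts → σ.root x ≠ σ.root v ∧ σ.root x ≠ σ.root t :=
    fun hx => ⟨fun e => (hold hx).1 (hRv _ (I.root_eq_iff.1 e)),
      fun e => (hold hx).2 (hRt _ (I.root_eq_iff.1 e))⟩
  have htv : t ≠ v := hvt.ne.symm
  have hrvt : σ.root v ≠ σ.root t := fun e => hvt.ne (hRt _ (I.root_eq_iff.1 e))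
  have hto : t ∉ Out := fun h => by
    obtain ⟨γ, hγ⟩ := I.out_mem h
    exact (hnv γ).2 hγ
  have hnf : ¬ IsFree M v ∧ ¬ IsFree M t := ⟨fun h => h t hvt, fun h => h v hvt.symm⟩
  have hαα := (I.base hua).1
  constructor
  case match_unique => exact I.match_unique
  case verts_unique =>
    intro γ δ x h h'
    rw [overtakeUnvisited_mem] at h h'
    rcases h with h | ⟨rfl, h⟩
    · rcases h' with h' | ⟨rfl, h'⟩
      · exact I.verts_unique h h'
      · have := hold h
        tauto
    · rcases h' with h' | ⟨rfl, h'⟩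
      · have := hold h'
        tauto
      · rfl
  case arc_mem =>
    intro γ a b h
    simp only [overtakeUnvisited_mem]
    rcases overtakeUnvisited_arc.1 h with h | ⟨rfl, h | h⟩
    · exact (I.arc_mem h).imp Or.inl Or.inl
    · cases h
      simp [hua]
    · cases h
      simp
  case blossom_sub =>
    intro γ x B h hx
    rw [overtakeUnvisited_mem]
    rcases overtakeUnvisited_blossom.1 h with h | ⟨rfl, rfl | rfl⟩
    · exact Or.inl (I.blossom_sub h hx)
    · exact Or.inr ⟨rfl, Or.inl hx⟩
    · exact Or.inr ⟨rfl, Or.inr hx⟩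
  case root_trans =>
    rw [overtakeUnvisited_root]
    exact I.root_trans
  case out_mem =>
    rintro x (hx | rfl)
    · obtain ⟨γ, hγ⟩ := I.out_mem hx
      exact ⟨γ, overtakeUnvisited_mem.2 (Or.inl hγ)⟩
    · exact ⟨α, overtakeUnvisited_mem.2 (Or.inr ⟨rfl, Or.inr rfl⟩)⟩
  case out_root =>
    rw [overtakeUnvisited_root]
    rintro x y hy (hx | rfl)
    · exact Or.inl (I.out_root hy hx)
    · exact Or.inr (hRt y hy)
  case inner_trivial =>
    rw [overtakeUnvisited_root]
    intro γ x y hx ho hy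
    rcases overtakeUnvisited_mem.1 hx with hx | ⟨rfl, rfl | rfl⟩
    · exact I.inner_trivial hx (fun h => ho (Or.inl h)) hy
    · exact hRv y hy
    · exact hRt y hy
  case base =>
    intro γ x hx
    rw [overtakeUnvisited_mem]
    rcases overtakeUnvisited_mem.1 hx with hx | ⟨rfl, -⟩
    · exact ⟨Or.inl (I.base hx).1, (I.base hx).2.1, Or.inl (I.base hx).2.2⟩
    · exact ⟨Or.inl hαα, (I.base hua).2.1, Or.inl (I.base hua).2.2⟩
  case free_eq =>
    intro γ x hf hx
    rcases overtakeUnvisited_mem.1 hx with hx | ⟨rfl, rfl | rfl⟩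
    · exact I.free_eq hf hx
    · exact absurd hf hnf.1
    · exact absurd hf hnf.2
  case free_mem => exact fun hf h => overtakeUnvisited_mem.2 (Or.inl (I.free_mem hf h))
  case not_removed =>
    intro γ x hx
    rcases overtakeUnvisited_mem.1 hx with hx | ⟨rfl, rfl | rfl⟩
    · exact I.not_removed hx
    · exact hvr
    · exact fun h => hvr (I.match_removed h hvt.symm)
  case match_mem =>
    intro γ x y hx hxy
    rw [overtakeUnvisited_mem]
    rcases overtakeUnvisited_mem.1 hx with hx | ⟨rfl, rfl | rfl⟩
    · exact Or.inl (I.match_mem hx hxy)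
    · exact Or.inr ⟨rfl, Or.inr (I.match_unique hxy hvt)⟩
    · exact Or.inr ⟨rfl, Or.inl (I.match_unique hxy hvt.symm)⟩
  case match_removed => exact I.match_removed
  case arc_alt =>
    rw [overtakeUnvisited_root]
    intro γ a b h hr
    rcases overtakeUnvisited_arc.1 h with h | ⟨rfl, h | h⟩
    · have h₁ := (hold (I.arc_mem h).1).2
      have h₂ := (hold (I.arc_mem h).2).2
      simp [h₁, h₂, I.arc_alt h hr]
    · cases h
      simp [huo, hv, htv.symm]
    · cases h
      simp [hv, htv.symm]
  case inner_arc =>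
    intro γ a b h ho
    rcases overtakeUnvisited_arc.1 h with h | ⟨rfl, h | h⟩
    · exact I.inner_arc h fun h => ho (Or.inl h)
    · cases h
      exact absurd (Or.inl huo) ho
    · cases h
      exact hvt
  case inner_match =>
    intro γ a b h ho hab
    rw [overtakeUnvisited_arc]
    rcases overtakeUnvisited_mem.1 h with h | ⟨rfl, rfl | rfl⟩
    · exact Or.inl (I.inner_match h (fun h => ho (Or.inl h)) hab)
    · rw [I.match_unique hab hvt]
      exact Or.inr ⟨rfl, Or.inr rfl⟩
    · exact absurd (Or.inr rfl) ho
  case enter_unique =>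
    rw [overtakeUnvisited_root]
    intro γ a b a' b' h h' hr hr' e
    rcases overtakeUnvisited_arc.1 h with h | ⟨rfl, h | h⟩ <;>
    rcases overtakeUnvisited_arc.1 h' with h' | ⟨e', h' | h'⟩
    · exact I.enter_unique h h' hr hr' e
    · cases h'
      exact absurd e (hRvt (I.arc_mem h).2).1
    · cases h'
      exact absurd e (hRvt (I.arc_mem h).2).2
    · cases h
      exact absurd e.symm (hRvt (I.arc_mem h').2).1
    · cases h
      cases h'
      exact ⟨rfl, rfl⟩
    · cases h
      cases h'
      exact absurd e hrvt
    · cases h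
      exact absurd e.symm (hRvt (I.arc_mem h').2).2
    · cases h
      cases h'
      exact absurd e.symm hrvt
    · cases h
      cases h'
      exact ⟨rfl, rfl⟩
  case enter_base =>
    rw [overtakeUnvisited_root]
    intro γ a b h hr
    rcases overtakeUnvisited_arc.1 h with h | ⟨rfl, h | h⟩
    · exact I.enter_base h hr
    · cases h
      exact (hRvt hαα).1.symm
    · cases h
      exact (hRvt hαα).2.symm
  case enter_exists =>
    rw [overtakeUnvisited_root]
    intro γ x hx hr
    simp only [overtakeUnvisited_arc]
    rcases overtakeUnvisited_mem.1 hx with hx | ⟨rfl, rfl | rfl⟩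
    · obtain ⟨a, b, hab, h⟩ := I.enter_exists hx hr
      exact ⟨a, b, Or.inl hab, h⟩
    · exact ⟨u, x, Or.inr ⟨rfl, Or.inl rfl⟩, (hRvt hua).1, rfl⟩
    · exact ⟨v, x, Or.inr ⟨rfl, Or.inr rfl⟩, hrvt, rfl⟩
  case leave_unique =>
    rw [overtakeUnvisited_root]
    rintro x a b a' b' (hx | rfl) hb hb' hab hab' ha ha'
    · exact I.leave_unique hx hb hb' hab hab' ha ha'
    · rw [hRt b hb, hRt b' hb']
  case base_closed =>
    rw [overtakeUnvisited_root]
    intro γ a b h hb hab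
    rcases overtakeUnvisited_mem.1 h with h | ⟨rfl, -⟩
    · exact I.base_closed h hb hab
    · exact I.base_closed hαα hb hab
  case label_lt =>
    rw [overtakeUnvisited_root]
    intro γ b c s e h hr ho hcs he
    refine I.relabel_label_lt hlt.le rfl huo hd hvt ?_ hr (fun h => ho (Or.inl h)) hcs he
    rcases overtakeUnvisited_arc.1 h with h | ⟨rfl, h | h⟩
    · exact Or.inr ⟨(hold (I.arc_mem h).2).1, γ, h⟩
    · cases h
      exact Or.inl ⟨rfl, rfl⟩
    · cases h
      exact absurd (Or.inr rfl) ho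
  case label_visited =>
    intro x y hxy hl
    simp only [overtakeUnvisited_mem]
    by_cases hx : x = v
    · exact Or.inr ⟨α, Or.inr ⟨rfl, Or.inl hx⟩⟩
    · rcases I.label_visited hxy (relabel_of_ne (σ := σ) (k := d + 1) (Or.inl hx) ▸ hl) with
        h | ⟨γ, h⟩
      · exact Or.inl h
      · exact Or.inr ⟨γ, Or.inl h⟩
  case work_outer =>
    rw [overtakeUnvisited_root]
    intro γ W h
    simp only [overtakeUnvisited_mem]
    by_cases hγ : γ = α
    · subst hγ
      rw [overtakeUnvisited_str_self] at h
      cases h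
      exact ⟨t, Or.inr ⟨rfl, Or.inr rfl⟩, Or.inr rfl, rfl⟩
    · rw [overtakeUnvisited_str_of_ne hγ] at h
      obtain ⟨x, hx, ho, hr⟩ := I.work_outer h
      exact ⟨x, Or.inl hx, Or.inl ho, hr⟩

theorem overtakeUnvisited_prog (hW : (σ.str α).work = some (σ.root u)) (hv : v ∉ Out)
    (hvt : M.Adj v t) (hlt : d + 1 < σ.label v t) (hn : ∀ γ, (v, t) ∉ (σ.str γ).arcs)
    (hm : α ∉ σ.modified) :
    Prog M σ Out (σ.overtakeUnvisited α u v t (d + 1)) (Out ∪ {t}) := by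
  have hnv := I.not_mem_verts_of_unvisited hv hvt hn
  obtain ⟨hua, huo⟩ := I.work_mem hW
  have hRv : ∀ y, y ∈ σ.root v → y = v := fun y => I.root_of_unvisited fun γ => (hnv γ).1
  have hRt : ∀ y, y ∈ σ.root t → y = t := fun y => I.root_of_unvisited fun γ => (hnv γ).2
  have hT : (σ.overtakeUnvisited α u v t (d + 1)).Active t :=
    ⟨α, σ.root t, by rw [overtakeUnvisited_str_self], by
      rw [overtakeUnvisited_root]
      exact Relation.ReflTransGen.refl⟩
  have hact : ∀ x, σ.Active x → (σ.overtakeUnvisited α u v t (d + 1)).Active x := by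
    rintro x ⟨γ, W, hγ, hanc⟩
    obtain ⟨w, hw, -, rfl⟩ := I.work_outer hγ
    obtain ⟨y, hy, hr⟩ := I.mem_of_anc hanc hw
    have := anc_map (σ' := σ.overtakeUnvisited α u v t (d + 1)) (δ := γ)
      (fun a b _ e => by rwa [overtakeUnvisited_root])
      (fun a b h => ⟨(I.arc_mem h).1, (I.arc_mem h).2, Or.inr (overtakeUnvisited_arc.2 (Or.inl h))⟩)
      (I.mem_of_root_eq hy hr.symm) hanc
    -- The active path of `S_α` ended at `Ω(u)` and is prolonged by `Ω(v)` and `Ω(t)`; the other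
    -- active paths are unchanged.
    by_cases e : γ = α
    · subst e
      have hwu : σ.root w = σ.root u := (Option.some.inj (hW.symm.trans hγ)).symm
      refine ⟨γ, σ.root t, by rw [overtakeUnvisited_str_self], ?_⟩
      rw [overtakeUnvisited_root] at this ⊢
      rw [hwu] at this
      refine (this.tail (b := σ.root u) (c := σ.root v) ?_).tail ?_
      · refine ⟨fun e => (hnv γ).1 ?_, u, v, overtakeUnvisited_arc.2 (Or.inr ⟨rfl, Or.inl rfl⟩),
          congrFun overtakeUnvisited_root u, congrFun overtakeUnvisited_root v⟩
        exact I.mem_of_root_eq hua e.symm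
      · refine ⟨fun e => ?_, v, t, overtakeUnvisited_arc.2 (Or.inr ⟨rfl, Or.inr rfl⟩),
          congrFun overtakeUnvisited_root v, congrFun overtakeUnvisited_root t⟩
        exact hvt.ne (hRt _ (I.root_eq_iff.1 e))
    · refine ⟨γ, σ.root w, by rw [overtakeUnvisited_str_of_ne e, hγ], ?_⟩
      rwa [overtakeUnvisited_root] at this ⊢
  constructor
  case removed => exact id
  case label => exact fun _ => relabel_le hlt.le _ _
  case out => exact fun h _ => Or.inl h
  case root =>
    rw [overtakeUnvisited_root]
    exact fun _ => id
  case inactive =>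
    rintro w (hw | rfl) ha
    · refine ⟨hw, fun h => ha (hact w h), by rw [overtakeUnvisited_root], ?_⟩
      intro x y _ hy _
      refine relabel_of_ne (Or.inr ?_)
      rintro rfl
      obtain ⟨γ, hγ⟩ := I.out_mem (I.out_root hy hw)
      exact (hnv γ).2 hγ
    · exact absurd hT ha
  case modified => exact Or.inl
  case onHold => rfl
  case unmodified =>
    intro γ h
    have hγ : γ ≠ α := fun e => h (Or.inr e)
    refine ⟨overtakeUnvisited_str_of_ne hγ, fun x _ => by rw [overtakeUnvisited_root],
      fun x hx y _ => relabel_of_ne (Or.inl ?_)⟩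
    rintro rfl
    exact (hnv γ).1 hx
  case new_out =>
    rintro x (h | rfl)
    · exact Or.inl h
    · exact Or.inr ⟨α, Or.inr rfl, by rw [overtakeUnvisited_str_self, overtakeUnvisited_root]⟩
  case work =>
    rintro x ⟨γ, hγ, h⟩ -
    refine ⟨γ, Or.inl hγ, ?_⟩
    -- The extended structure moves its working vertex forward, out of `Ω(u)`; this loses nothing,
    -- because the structure was not yet modified.
    rw [overtakeUnvisited_str_of_ne, h, overtakeUnvisited_root]
    rintro rfl
    exact hm hγ

end Inv

end Overtake

end MatchingPhase

namespace MatchingPhase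

open State

/-! ### Moving a subtree under a new parent, within one tree or between two -/

section Regraft

variable {V : Type*} {G : SimpleGraph V} {M : G.Subgraph} {L : ℕ} {σ σ' : State V} {Out : Set V}
  {α β p u v t : V} {d : ℕ}

/-- The state `σ'` arises from `σ` when `S_α` takes over, through the arc `(u, v)`, the subtree of
`Ω(v)` in the tree `T'_β`, where `β = α` is allowed. -/
structure Regraft (σ σ' : State V) (α β p u v t : V) (k : ℕ) : Prop where
  root : σ'.root = σ.root
  label : σ'.label = σ.relabel v t k
  removed : σ'.removed = σ.removed
  onHold : σ'.onHold = σ.onHold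
  modified : ∀ γ, γ ∈ σ'.modified ↔ γ ∈ σ.modified ∨ γ = α ∨ γ = β
  str : ∀ γ, γ ≠ α → γ ≠ β → σ'.str γ = σ.str γ
  verts : ∀ γ x, x ∈ (σ'.str γ).verts ↔
    γ = α ∧ x ∈ σ.subtreeVerts β v ∨ x ∈ (σ.str γ).verts ∧ x ∉ σ.subtreeVerts β v
  arcs : ∀ γ a, a ∈ (σ'.str γ).arcs ↔ γ = α ∧ a = (u, v) ∨ γ = α ∧ a ∈ σ.subtreeArcs β v ∨
    a ∈ (σ.str γ).arcs ∧ a ≠ (p, v) ∧ a ∉ σ.subtreeArcs β v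
  -- A blossom without vertices would lie in every subtree vacuously, so only nonempty ones can be
  -- located.
  blossoms : ∀ γ B, B ∈ (σ'.str γ).blossoms → B.verts.Nonempty → γ = α ∧ B ∈ σ.subtreeBlossoms β v ∨
    B ∈ (σ.str γ).blossoms ∧ B ∉ σ.subtreeBlossoms β v
  work_below : σ.WorksBelow β t → α ≠ β ∧ (σ'.str α).work = (σ.str β).work ∧
    (σ'.str β).work = some (σ.root p)
  work_not_below : ¬ σ.WorksBelow β t → (σ'.str α).work = some (σ.root t) ∧
    (α ≠ β → (σ'.str β).work = (σ.str β).work)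

namespace Inv

variable (I : Inv M L σ Out)

include I

theorem subtree_root {x y : V} (hx : x ∈ σ.subtreeVerts β v) (h : σ.root y = σ.root x) :
    y ∈ σ.subtreeVerts β v :=
  ⟨I.mem_of_root_eq hx.1 h, h ▸ hx.2⟩

theorem subtree_arc {γ a b : V} (h : (a, b) ∈ (σ.str γ).arcs) (ha : a ∈ σ.subtreeVerts β v) :
    b ∈ σ.subtreeVerts β v := by
  obtain rfl := I.verts_unique ha.1 (I.arc_mem h).1
  by_cases hr : σ.root a = σ.root b
  · exact I.subtree_root ha hr.symm
  · exact ⟨(I.arc_mem h).2, ha.2.tail ⟨hr, a, b, h, rfl, rfl⟩⟩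

theorem subtree_anc {γ y : V} {X : Set V} (h : σ.Anc γ X (σ.root y))
    (hy : y ∈ (σ.str γ).verts) (hX : ∃ x ∈ σ.subtreeVerts β v, σ.root x = X) :
    y ∈ σ.subtreeVerts β v := by
  obtain ⟨x, hx, rfl⟩ := hX
  rcases Relation.ReflTransGen.cases_head h with e | ⟨Z, ⟨-, a, b, hab, ha, -⟩, -⟩
  · exact I.subtree_root hx e.symm
  · obtain rfl := I.verts_unique hx.1 (I.mem_of_root_eq (I.arc_mem hab).1 ha.symm)
    exact ⟨hy, hx.2.trans h⟩

variable (hpv : (p, v) ∈ (σ.str β).arcs) (hpr : σ.root p ≠ σ.root v) (hv : v ∉ Out)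

include hpv

omit I in
theorem mem_subtree_self (I : Inv M L σ Out) : v ∈ σ.subtreeVerts β v :=
  ⟨(I.arc_mem hpv).2, Relation.ReflTransGen.refl⟩

include hpr

/-- The subtree is entered only by the arc from the parent of its top vertex. -/
theorem subtree_arc' {γ a b : V} (h : (a, b) ∈ (σ.str γ).arcs) (hne : (a, b) ≠ (p, v))
    (hb : b ∈ σ.subtreeVerts β v) : a ∈ σ.subtreeVerts β v := by
  obtain rfl := I.verts_unique hb.1 (I.arc_mem h).2
  by_cases hr : σ.root a = σ.root b
  · exact I.subtree_root hb hr
  · refine ⟨(I.arc_mem h).1, I.anc_parent hb.2 ⟨hr, a, b, h, rfl, rfl⟩ fun e => hne ?_⟩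
    obtain ⟨rfl, rfl⟩ := I.enter_unique h hpv hr hpr e.symm
    rfl

theorem parent_notMem_subtree : p ∉ σ.subtreeVerts β v := fun h =>
  I.not_anc_of_treeArc ⟨hpr, p, v, hpv, rfl, rfl⟩ h.2

theorem free_notMem_subtree {γ : V} (hf : IsFree M γ) : γ ∉ σ.subtreeVerts β v := fun h => by
  obtain rfl := I.free_eq hf h.1
  exact I.enter_base hpv hpr (I.anc_base h.2)

include hv

/-- A matched edge from an outer blossom to its parent cannot be `(p, v)`, because `v` is inner. So
the subtree is a union of matched pairs, and moving it separates no vertex from its mate. -/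
theorem subtree_match {x y : V} (hx : x ∈ σ.subtreeVerts β v) (h : M.Adj x y) :
    y ∈ σ.subtreeVerts β v := by
  by_cases ho : x ∈ Out
  · by_cases hy : y ∈ σ.root x
    · exact I.subtree_root hx (I.root_eq_iff.2 hy)
    · obtain ⟨-, hr, hyx⟩ := I.enter_of_match hx.1 ho h.symm hy
      refine I.subtree_arc' hpv hpr hyx ?_ hx
      rintro ⟨⟩
      exact hv ho
  · exact I.subtree_arc (I.inner_match hx.1 ho h) hx

end Inv

namespace Regraft

/-- No old arc except `(p, v)` crosses the boundary of the subtree. Hence each surviving arc either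
moves with both ends or stays with both ends. -/
theorem arc_old (R : Regraft σ σ' α β p u v t (d + 1)) (I : Inv M L σ Out)
    (hpv : (p, v) ∈ (σ.str β).arcs) (hpr : σ.root p ≠ σ.root v) {γ a b : V}
    (h : (a, b) ∈ (σ'.str γ).arcs) : γ = α ∧ a = u ∧ b = v ∨ ∃ δ, (a, b) ∈ (σ.str δ).arcs ∧
      (a, b) ≠ (p, v) ∧ (γ = α ∧ δ = β ∧ a ∈ σ.subtreeVerts β v ∧ b ∈ σ.subtreeVerts β v ∨
        γ = δ ∧ a ∉ σ.subtreeVerts β v ∧ b ∉ σ.subtreeVerts β v) := by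
  rcases (R.arcs γ _).1 h with ⟨rfl, e⟩ | ⟨rfl, h, h₁, h₂⟩ | ⟨h, hne, hs⟩
  · cases e
    exact Or.inl ⟨rfl, rfl, rfl⟩
  · refine Or.inr ⟨β, h, ?_, Or.inl ⟨rfl, rfl, h₁, h₂⟩⟩
    rintro e
    cases e
    exact I.parent_notMem_subtree hpv hpr h₁
  · have ha : a ∉ σ.subtreeVerts β v := by
      intro ha
      obtain rfl := I.verts_unique ha.1 (I.arc_mem h).1
      exact hs ⟨h, ha, I.subtree_arc h ha⟩
    exact Or.inr ⟨γ, h, hne, Or.inr ⟨rfl, ha, fun hb => ha (I.subtree_arc' hpv hpr h hne hb)⟩⟩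

theorem arc_inside (R : Regraft σ σ' α β p u v t (d + 1)) (I : Inv M L σ Out) {γ a b : V}
    (h : (a, b) ∈ (σ.str γ).arcs) (ha : a ∈ σ.subtreeVerts β v) : (a, b) ∈ (σ'.str α).arcs := by
  obtain rfl := I.verts_unique ha.1 (I.arc_mem h).1
  exact (R.arcs α _).2 (Or.inr (Or.inl ⟨rfl, h, ha, I.subtree_arc h ha⟩))

theorem arc_outside (R : Regraft σ σ' α β p u v t (d + 1)) (I : Inv M L σ Out)
    (hpv : (p, v) ∈ (σ.str β).arcs) {γ a b : V}
    (h : (a, b) ∈ (σ.str γ).arcs) (hb : b ∉ σ.subtreeVerts β v) : (a, b) ∈ (σ'.str γ).arcs := by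
  refine (R.arcs γ _).2 (Or.inr (Or.inr ⟨h, ?_, fun h => hb h.2.2⟩))
  rintro e
  cases e
  exact hb (Inv.mem_subtree_self hpv I)

theorem arc_new (R : Regraft σ σ' α β p u v t (d + 1)) : (u, v) ∈ (σ'.str α).arcs :=
  (R.arcs α _).2 (Or.inl ⟨rfl, rfl⟩)

theorem mem_cases (R : Regraft σ σ' α β p u v t (d + 1)) {γ x : V} (h : x ∈ (σ'.str γ).verts) :
    ∃ δ, x ∈ (σ.str δ).verts ∧
      (γ = α ∧ δ = β ∧ x ∈ σ.subtreeVerts β v ∨ γ = δ ∧ x ∉ σ.subtreeVerts β v) := by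
  rcases (R.verts γ x).1 h with ⟨rfl, h⟩ | ⟨h, h'⟩
  · exact ⟨β, h.1, Or.inl ⟨rfl, rfl, h⟩⟩
  · exact ⟨γ, h, Or.inr ⟨rfl, h'⟩⟩

theorem mem_of_mem (R : Regraft σ σ' α β p u v t (d + 1)) {γ x : V} (h : x ∈ (σ.str γ).verts) :
    ∃ δ, x ∈ (σ'.str δ).verts := by
  by_cases hx : x ∈ σ.subtreeVerts β v
  · exact ⟨α, (R.verts α x).2 (Or.inl ⟨rfl, hx⟩)⟩
  · exact ⟨γ, (R.verts γ x).2 (Or.inr ⟨h, hx⟩)⟩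

section

variable (R : Regraft σ σ' α β p u v t (d + 1)) (I : Inv M L σ Out)
  (hpv : (p, v) ∈ (σ.str β).arcs) (hpr : σ.root p ≠ σ.root v) (hv : v ∉ Out)
  (hW : (σ.str α).work = some (σ.root u)) (hvt : M.Adj v t)
  (hd : IsDistance M σ (σ.root u) d) (hlt : d + 1 < σ.label v t)

include I hpv hW hd hlt hv hvt in
-- A descendant of `Ω(v)` has rank at least `2ℓ(v, t)`, while `Ω(u)` has rank `2d + 1` with `d + 1 <
-- ℓ(v, t)`. This is why overtaking within one tree closes no cycle.
theorem notMem_subtree : u ∉ σ.subtreeVerts β v := by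
  intro h
  obtain ⟨rk, hrk, hrk', hrk''⟩ := I.exists_rank
  have := anc_rank_le hrk h.2
  rw [hrk' u d (I.work_mem hW).2 hd, hrk'' β v t (I.arc_mem hpv).2 hv hvt] at this
  omega

include I hpv hv hvt in
theorem mate_mem_subtree : t ∈ σ.subtreeVerts β v :=
  I.subtree_arc (I.inner_match (I.arc_mem hpv).2 hv hvt) (Inv.mem_subtree_self hpv I)

include I hpv hv hvt in
theorem work_notMem_subtree (hb : ¬ σ.WorksBelow β t) {w : V} (hw : w ∈ Out)
    (h : (σ.str β).work = some (σ.root w)) : w ∉ σ.subtreeVerts β v := fun hs => by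
  refine hb ⟨_, h, I.anc_of_inner (I.arc_mem hpv).2 hv hvt hs.2 fun e => ?_⟩
  exact hv (I.out_of_root_eq hw e.symm)

include R I hpv hpr hv hW hvt hd hlt in
/-- Regrafting a subtree preserves the structural invariant. -/
theorem inv : Inv M L σ' Out := by
  have hus := notMem_subtree I hpv hv hW hvt hd hlt
  have hvs := Inv.mem_subtree_self hpv I
  have hts := mate_mem_subtree I hpv hv hvt
  have hps := I.parent_notMem_subtree hpv hpr
  have hfree : ∀ {γ}, IsFree M γ → γ ∉ σ.subtreeVerts β v :=
    fun hf => I.free_notMem_subtree hpv hpr hf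
  obtain ⟨hua, huo⟩ := I.work_mem hW
  have hvβ := hvs.1
  have hpo : p ∈ Out := (I.arc_alt hpv hpr).2 hv
  constructor
  case match_unique => exact I.match_unique
  case verts_unique =>
    intro γ δ x h h'
    obtain ⟨γ', h, k⟩ := R.mem_cases h
    obtain ⟨δ', h', k'⟩ := R.mem_cases h'
    obtain rfl := I.verts_unique h h'
    rcases k with ⟨rfl, rfl, k⟩ | ⟨rfl, k⟩ <;> rcases k' with ⟨rfl, e, k'⟩ | ⟨rfl, k'⟩
    · rfl
    · exact absurd k k'
    · exact absurd k' k
    · rfl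
  case arc_mem =>
    intro γ a b h
    rw [R.verts, R.verts]
    rcases R.arc_old I hpv hpr h with ⟨rfl, rfl, rfl⟩ | ⟨δ, h, -, ⟨rfl, rfl, h₁, h₂⟩ | ⟨rfl, h₁, h₂⟩⟩
    · exact ⟨Or.inr ⟨hua, hus⟩, Or.inl ⟨rfl, hvs⟩⟩
    · exact ⟨Or.inl ⟨rfl, h₁⟩, Or.inl ⟨rfl, h₂⟩⟩
    · exact ⟨Or.inr ⟨(I.arc_mem h).1, h₁⟩, Or.inr ⟨(I.arc_mem h).2, h₂⟩⟩
  case blossom_sub =>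
    intro γ x B h hx
    rw [R.verts]
    rcases R.blossoms γ B h ⟨x, hx⟩ with ⟨rfl, h⟩ | ⟨h, hs⟩
    · exact Or.inl ⟨rfl, h.2 hx⟩
    · refine Or.inr ⟨I.blossom_sub h hx, fun hxs => hs ?_⟩
      obtain rfl := I.verts_unique hxs.1 (I.blossom_sub h hx)
      refine ⟨h, fun y hy => I.subtree_root hxs (I.root_eq_iff.2 ?_)⟩
      exact mem_root_iff.2 (Or.inr ⟨_, B, h, hx, hy⟩)
  case root_trans =>
    rw [R.root]
    exact I.root_trans
  case out_mem =>
    intro x hx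
    obtain ⟨γ, hγ⟩ := I.out_mem hx
    exact R.mem_of_mem hγ
  case out_root =>
    rw [R.root]
    exact I.out_root
  case inner_trivial =>
    rw [R.root]
    intro γ x y hx ho hy
    obtain ⟨δ, hx, -⟩ := R.mem_cases hx
    exact I.inner_trivial hx ho hy
  case base =>
    intro γ x hx
    rw [R.verts]
    obtain ⟨δ, hx, ⟨rfl, rfl, -⟩ | ⟨rfl, -⟩⟩ := R.mem_cases hx
    · obtain ⟨h₁, h₂, h₃⟩ := I.base hua
      exact ⟨Or.inr ⟨h₁, hfree h₂⟩, h₂, h₃⟩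
    · obtain ⟨h₁, h₂, h₃⟩ := I.base hx
      exact ⟨Or.inr ⟨h₁, hfree h₂⟩, h₂, h₃⟩
  case free_eq =>
    intro γ x hf hx
    obtain ⟨δ, hx, ⟨rfl, rfl, h⟩ | ⟨rfl, -⟩⟩ := R.mem_cases hx
    · exact absurd h (hfree hf)
    · exact I.free_eq hf hx
  case free_mem =>
    rw [R.removed]
    exact fun hf h => (R.verts _ _).2 (Or.inr ⟨I.free_mem hf h, hfree hf⟩)
  case not_removed =>
    rw [R.removed]
    intro γ x hx
    obtain ⟨δ, hx, -⟩ := R.mem_cases hx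
    exact I.not_removed hx
  case match_mem =>
    intro γ x y hx hxy
    rw [R.verts]
    obtain ⟨δ, hx, ⟨rfl, rfl, h⟩ | ⟨rfl, h⟩⟩ := R.mem_cases hx
    · exact Or.inl ⟨rfl, I.subtree_match hpv hpr hv h hxy⟩
    · exact Or.inr ⟨I.match_mem hx hxy, fun hy => h (I.subtree_match hpv hpr hv hy hxy.symm)⟩
  case match_removed =>
    rw [R.removed]
    exact I.match_removed
  case arc_alt =>
    rw [R.root]
    intro γ a b h hr
    rcases R.arc_old I hpv hpr h with ⟨rfl, rfl, rfl⟩ | ⟨δ, h, -⟩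
    · simp [huo, hv]
    · exact I.arc_alt h hr
  case inner_arc =>
    intro γ a b h ho
    rcases R.arc_old I hpv hpr h with ⟨rfl, rfl, rfl⟩ | ⟨δ, h, -⟩
    · exact absurd huo ho
    · exact I.inner_arc h ho
  case inner_match =>
    intro γ a b h ho hab
    obtain ⟨δ, h, k⟩ := R.mem_cases h
    have h' := I.inner_match h ho hab
    rcases k with ⟨rfl, rfl, k⟩ | ⟨rfl, k⟩
    · exact R.arc_inside I h' k
    · exact R.arc_outside I hpv h' fun hb => k (I.subtree_match hpv hpr hv hb hab.symm)
  case enter_unique =>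
    rw [R.root]
    intro γ a b a' b' h h' hr hr' e
    -- The deleted arc `(p, v)` was the only tree arc into `Ω(v)`, so `(u, v)` is the only one
    -- afterwards.
    have aux : ∀ {δ a b}, (a, b) ∈ (σ.str δ).arcs → (a, b) ≠ (p, v) → σ.root a ≠ σ.root b →
        σ.root b ≠ σ.root v := by
      intro δ a b h hne hr e
      obtain rfl := I.verts_unique hvβ (I.mem_of_root_eq (I.arc_mem h).2 e.symm)
      obtain ⟨rfl, rfl⟩ := I.enter_unique h hpv hr hpr e
      exact hne rfl
    rcases R.arc_old I hpv hpr h with ⟨-, rfl, rfl⟩ | ⟨δ, h, hne, -⟩ <;>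
    rcases R.arc_old I hpv hpr h' with ⟨-, rfl, rfl⟩ | ⟨δ', h', hne', -⟩
    · exact ⟨rfl, rfl⟩
    · exact absurd e.symm (aux h' hne' hr')
    · exact absurd e (aux h hne hr)
    · obtain rfl := I.verts_unique (I.arc_mem h).2 (I.mem_of_root_eq (I.arc_mem h').2 e)
      exact I.enter_unique h h' hr hr' e
  case enter_base =>
    rw [R.root]
    intro γ a b h hr e
    rcases R.arc_old I hpv hpr h with ⟨rfl, rfl, rfl⟩ | ⟨δ, h, -, ⟨rfl, rfl, h₁, h₂⟩ | ⟨rfl, h₁, h₂⟩⟩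
    · exact hv (I.out_of_root_eq (I.base hua).2.2 e)
    · exact hfree (I.base hua).2.1 (I.subtree_root h₂ e.symm)
    · exact I.enter_base h hr e
  case enter_exists =>
    rw [R.root]
    intro γ x hx hr
    obtain ⟨δ, hx, ⟨rfl, rfl, hs⟩ | ⟨rfl, hs⟩⟩ := R.mem_cases hx
    · have : σ.root x ≠ σ.root δ := fun e => hfree (I.base hx).2.1 (I.subtree_root hs e.symm)
      obtain ⟨a, b, hab, hne, hb⟩ := I.enter_exists hx this
      by_cases e : (a, b) = (p, v)
      · cases e
        refine ⟨u, v, R.arc_new, fun e => ?_, hb⟩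
        exact hv (I.out_of_root_eq huo e.symm)
      · exact ⟨a, b, R.arc_inside I hab
          (I.subtree_arc' hpv hpr hab e (I.subtree_root hs hb)), hne, hb⟩
    · obtain ⟨a, b, hab, hne, hb⟩ := I.enter_exists hx hr
      exact ⟨a, b, R.arc_outside I hpv hab fun h => hs (I.subtree_root h hb.symm), hne, hb⟩
  case leave_unique =>
    rw [R.root]
    exact I.leave_unique
  case base_closed =>
    rw [R.root]
    intro γ a b h hb hab
    obtain ⟨δ, h, ⟨rfl, rfl, -⟩ | ⟨rfl, -⟩⟩ := R.mem_cases h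
    · exact I.base_closed (I.base hua).1 hb hab
    · exact I.base_closed h hb hab
  case label_lt =>
    rw [R.root]
    intro γ b c s e h hr ho hcs he
    refine I.relabel_label_lt hlt.le R.label huo hd hvt ?_ hr ho hcs he
    rcases R.arc_old I hpv hpr h with ⟨rfl, rfl, rfl⟩ | ⟨δ, h, hne, -⟩
    · exact Or.inl ⟨rfl, rfl⟩
    · refine Or.inr ⟨?_, δ, h⟩
      rintro rfl
      obtain rfl := I.verts_unique hvβ (I.arc_mem h).2
      obtain ⟨rfl, -⟩ := I.enter_unique h hpv hr hpr rfl
      exact hne rfl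
  case label_visited =>
    intro x y hxy hl
    rw [R.removed]
    by_cases hx : x = v
    · rw [hx]
      exact Or.inr (R.mem_of_mem hvβ)
    · rw [R.label, relabel_of_ne (Or.inl hx)] at hl
      exact (I.label_visited hxy hl).imp_right fun ⟨γ, h⟩ => R.mem_of_mem h
  case work_outer =>
    rw [R.root]
    intro γ W h
    have hto : t ∈ Out := I.out_of_inner hvβ hv hvt
    by_cases hb : σ.WorksBelow β t
    · obtain ⟨hne, h₁, h₂⟩ := R.work_below hb
      by_cases hγ : γ = α
      · rw [hγ, h₁] at h
        obtain ⟨W', hW', hanc⟩ := hb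
        obtain ⟨x, hx, ho, rfl⟩ := I.work_outer h
        cases hW'.symm.trans h
        exact ⟨x, (R.verts _ _).2 (Or.inl ⟨hγ, I.subtree_anc hanc hx ⟨t, hts, rfl⟩⟩), ho, rfl⟩
      · by_cases hγ' : γ = β
        · rw [hγ', h₂] at h
          cases h
          exact ⟨p, (R.verts _ _).2 (Or.inr ⟨hγ' ▸ (I.arc_mem hpv).1, hps⟩), hpo, rfl⟩
        · rw [R.str γ hγ hγ'] at h
          obtain ⟨x, hx, ho, rfl⟩ := I.work_outer h
          exact ⟨x, by rwa [R.str γ hγ hγ'], ho, rfl⟩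
    · obtain ⟨h₁, h₂⟩ := R.work_not_below hb
      by_cases hγ : γ = α
      · rw [hγ, h₁] at h
        cases h
        exact ⟨t, (R.verts _ _).2 (Or.inl ⟨hγ, hts⟩), hto, rfl⟩
      · by_cases hγ' : γ = β
        · rw [hγ', h₂ fun e => hγ (hγ'.trans e.symm)] at h
          obtain ⟨x, hx, ho, rfl⟩ := I.work_outer h
          exact ⟨x, (R.verts _ _).2 (Or.inr ⟨hγ' ▸ hx,
            work_notMem_subtree I hpv hv hvt hb ho h⟩), ho, rfl⟩
        · rw [R.str γ hγ hγ'] at h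
          obtain ⟨x, hx, ho, rfl⟩ := I.work_outer h
          exact ⟨x, by rwa [R.str γ hγ hγ'], ho, rfl⟩

include R I hpv in
theorem anc_outside {γ x y : V} (hy : y ∉ σ.subtreeVerts β v)
    (hyγ : y ∈ (σ.str γ).verts) (h : σ.Anc γ (σ.root x) (σ.root y)) :
    σ'.Anc γ (σ.root x) (σ.root y) := by
  generalize hY : σ.root y = Y at h
  induction h generalizing y with
  | refl => exact Relation.ReflTransGen.refl
  | tail _ hT ih =>
    obtain ⟨hne, a, b, hab, ha, hb⟩ := hT
    have hbs : b ∉ σ.subtreeVerts β v := fun h => hy (I.subtree_root h (hY.trans hb.symm))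
    have has : a ∉ σ.subtreeVerts β v := fun h => hbs (I.subtree_arc hab h)
    refine (ih has (I.arc_mem hab).1 ha).tail ⟨hne, a, b, R.arc_outside I hpv hab hbs, ?_, ?_⟩
    · rwa [R.root]
    · rwa [R.root]

include R I in
theorem anc_inside {x y : V} (hx : x ∈ σ.subtreeVerts β v)
    (h : σ.Anc β (σ.root x) (σ.root y)) : σ'.Anc α (σ.root x) (σ.root y) := by
  generalize σ.root y = Y at h
  induction h with
  | refl => exact Relation.ReflTransGen.refl
  | tail h hT ih =>
    obtain ⟨hne, a, b, hab, rfl, rfl⟩ := hT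
    have has := I.subtree_anc h (I.arc_mem hab).1 ⟨x, hx, rfl⟩
    exact ih.tail ⟨hne, a, b, R.arc_inside I hab has, by rw [R.root], by rw [R.root]⟩

include R I hpv hv hvt in
-- Whether `S_α` inherits the working vertex of `S_β` or gets `Ω(t)`, its active path passes through
-- `Ω(t)`.
theorem exists_work : ∃ W, (σ'.str α).work = some W ∧ σ'.Anc α (σ.root t) W := by
  by_cases hb : σ.WorksBelow β t
  · have h₁ := (R.work_below hb).2.1
    obtain ⟨W, hW, hanc⟩ := hb
    obtain ⟨w, -, -, rfl⟩ := I.work_outer hW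
    exact ⟨_, h₁.trans hW, R.anc_inside I (mate_mem_subtree I hpv hv hvt) hanc⟩
  · exact ⟨_, (R.work_not_below hb).1, Relation.ReflTransGen.refl⟩

include R I hpv hpr hv hW hvt hd hlt in
-- The old active path of `S_α` is prolonged through `Ω(v)` and `Ω(t)`. If the active path of `S_β`
-- runs through `Ω(t)`, it is cut at `(p, v)`: the lower piece becomes part of the active path of
-- `S_α`, and the upper one ends at `Ω(p)`, the new working vertex of `S_β`. Any other active path
-- avoids the moved subtree.
theorem active {x : V} (h : σ.Active x) : σ'.Active x := by
  have hus := notMem_subtree I hpv hv hW hvt hd hlt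
  have hvs := Inv.mem_subtree_self hpv I
  have hts := mate_mem_subtree I hpv hv hvt
  obtain ⟨hua, huo⟩ := I.work_mem hW
  obtain ⟨γ, W, hγ, hanc⟩ := h
  obtain ⟨w, hw, hwo, rfl⟩ := I.work_outer hγ
  unfold Active
  rw [R.root]
  by_cases e : γ = α
  · subst e
    rw [Option.some.inj (hγ.symm.trans hW)] at hanc
    obtain ⟨W', hW', hanc'⟩ := R.exists_work I hpv hv hvt
    have h₁ : σ'.TreeArc γ (σ.root u) (σ.root v) :=
      ⟨fun e => hv (I.out_of_root_eq huo e.symm), u, v, R.arc_new, by rw [R.root], by rw [R.root]⟩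
    have h₂ : σ'.TreeArc γ (σ.root v) (σ.root t) :=
      ⟨I.root_ne_of_inner hvs.1 hv hvt, v, t, R.arc_inside I (I.inner_match hvs.1 hv hvt) hvs,
        by rw [R.root], by rw [R.root]⟩
    exact ⟨γ, W', hW', (R.anc_outside I hpv hus hua hanc).trans (.head h₁ (.head h₂ hanc'))⟩
  · by_cases e' : γ = β
    · subst e'
      by_cases hb : σ.WorksBelow γ t
      · obtain ⟨-, h₁, h₂⟩ := R.work_below hb
        obtain ⟨W', hW', hanc'⟩ := hb
        cases hW'.symm.trans hγ
        have hvw : σ.Anc γ (σ.root v) (σ.root w) :=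
          .head (I.treeArc_of_inner hvs.1 hv hvt) hanc'
        by_cases hx : x ∈ σ.subtreeVerts γ v
        · exact ⟨α, _, h₁.trans hγ, R.anc_inside I hx hanc⟩
        · obtain ⟨y, hy, hyr⟩ := I.mem_of_anc hanc hw
          have hxv : σ.Anc γ (σ.root x) (σ.root v) :=
            (I.anc_total hanc hvw).resolve_right fun h =>
              hx ⟨I.mem_of_root_eq hy hyr.symm, h⟩
          refine ⟨γ, _, h₂, R.anc_outside I hpv (I.parent_notMem_subtree hpv hpr)
            (I.arc_mem hpv).1 (I.anc_parent hxv ⟨hpr, p, v, hpv, rfl, rfl⟩ fun e => ?_)⟩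
          exact hx (I.subtree_root hvs e)
      · exact ⟨γ, _, ((R.work_not_below hb).2 (Ne.symm e)).trans hγ, R.anc_outside I hpv
          (work_notMem_subtree I hpv hv hvt hb hwo hγ) hw hanc⟩
    · refine ⟨γ, σ.root w, by rw [R.str γ e e', hγ], R.anc_outside I hpv ?_ hw hanc⟩
      exact fun h => e' (I.verts_unique hw h.1)

include R I hpv hpr hv hW hvt hd hlt in
theorem prog (hm : α ∉ σ.modified) : Prog M σ Out σ' Out := by
  have hvs := Inv.mem_subtree_self hpv I
  constructor
  case removed =>
    rw [R.removed]
    exact id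
  case label =>
    rw [R.label]
    exact fun _ => relabel_le hlt.le _ _
  case out => exact fun h _ => h
  case root =>
    rw [R.root]
    exact fun _ => id
  case inactive =>
    intro w hw ha
    refine ⟨hw, fun h => ha (R.active I hpv hpr hv hW hvt hd hlt h), by rw [R.root], ?_⟩
    intro x y _ hy _
    rw [R.label]
    -- Only the label of `(v, t)` changes, and the outer vertex containing `t` is active afterwards.
    refine relabel_of_ne (Or.inr ?_)
    rintro rfl
    obtain ⟨W', hW', hanc⟩ := R.exists_work I hpv hv hvt
    exact ha ⟨α, W', hW', by rwa [R.root, ← I.root_eq_iff.2 hy]⟩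
  case modified => exact fun h => (R.modified _).2 (Or.inl h)
  case onHold => exact R.onHold
  case unmodified =>
    intro γ h
    rw [R.modified] at h
    push Not at h
    refine ⟨R.str γ h.2.1 h.2.2, fun x _ => by rw [R.root], fun x hx y _ => ?_⟩
    rw [R.label]
    refine relabel_of_ne (Or.inl ?_)
    rintro rfl
    exact h.2.2 (I.verts_unique hx hvs.1)
  case new_out => exact Or.inl
  case work =>
    rintro x ⟨γ, hγ, h⟩ -
    unfold InModifiedWork
    rw [R.root]
    have hγα : γ ≠ α := by
      rintro rfl
      exact hm hγ
    by_cases e : γ = β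
    · subst e
      -- If `S_β` gives up its working vertex, it is taken over by `S_α`, which is marked modified
      -- as well.
      by_cases hb : σ.WorksBelow γ t
      · exact ⟨α, (R.modified _).2 (Or.inr (Or.inl rfl)), (R.work_below hb).2.1.trans h⟩
      · exact ⟨γ, (R.modified _).2 (Or.inl hγ), ((R.work_not_below hb).2 hγα.symm).trans h⟩
    · exact ⟨γ, (R.modified _).2 (Or.inl hγ), by rw [R.str γ hγα e, h]⟩

end

end Regraft

end Regraft

end MatchingPhase

namespace MatchingPhase

open State

/-! ### The two Overtakes of a visited arc as instances of `Regraft` -/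

section OvertakeVisited

variable {V : Type*} {G : SimpleGraph V} {M : G.Subgraph} {L : ℕ} {σ σ' : State V} {Out : Set V}
  {α β p u v t : V} {d k : ℕ}

theorem overtakeSame_str_of_ne {γ : V} (h : γ ≠ α) :
    (σ.overtakeSame α p u v t k).str γ = σ.str γ := by
  simp [State.overtakeSame, upd, h]

theorem overtakeSame_str_self : (σ.overtakeSame α p u v t k).str α =
    { verts := (σ.str α).verts
      arcs := ((σ.str α).arcs \ {(p, v)}) ∪ {(u, v)}
      blossoms := (σ.str α).blossoms
      work := some (σ.root t) } := by
  simp [State.overtakeSame, upd]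

theorem overtakeSame_blossoms (γ : V) :
    ((σ.overtakeSame α p u v t k).str γ).blossoms = (σ.str γ).blossoms := by
  by_cases h : γ = α
  · subst h
    rw [overtakeSame_str_self]
  · rw [overtakeSame_str_of_ne h]

theorem overtakeOther_str_of_ne {γ : V} (h : γ ≠ α) (h' : γ ≠ β) :
    (σ.overtakeOther α β p u v t k).str γ = σ.str γ := by
  simp [State.overtakeOther, upd, h, h']

open Classical in
theorem overtakeOther_str_left (h : β ≠ α) : (σ.overtakeOther α β p u v t k).str α =
    { verts := (σ.str α).verts ∪ σ.subtreeVerts β v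
      arcs := (σ.str α).arcs ∪ {(u, v)} ∪ σ.subtreeArcs β v
      blossoms := (σ.str α).blossoms ∪ σ.subtreeBlossoms β v
      work := if σ.WorksBelow β t then (σ.str β).work else some (σ.root t) } := by
  simp [State.overtakeOther, upd, h.symm]

open Classical in
theorem overtakeOther_str_right : (σ.overtakeOther α β p u v t k).str β =
    { verts := (σ.str β).verts \ σ.subtreeVerts β v
      arcs := ((σ.str β).arcs \ {(p, v)}) \ σ.subtreeArcs β v
      blossoms := (σ.str β).blossoms \ σ.subtreeBlossoms β v
      work := if σ.WorksBelow β t then some (σ.root p) else (σ.str β).work } := by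
  simp [State.overtakeOther, upd]

namespace Inv

variable (I : Inv M L σ Out)

include I

theorem regraft_same (hpv : (p, v) ∈ (σ.str α).arcs) (hpr : σ.root p ≠ σ.root v) (hv : v ∉ Out)
    (hW : (σ.str α).work = some (σ.root u)) (hvt : M.Adj v t)
    (hd : IsDistance M σ (σ.root u) d) (hlt : d + 1 < σ.label v t) :
    Regraft σ (σ.overtakeSame α p u v t k) α α p u v t k := by
  -- Within one tree the working vertex is `Ω(u)`, which the rank keeps out of the subtree.
  have hwb : ¬ σ.WorksBelow α t := by
    rintro ⟨W, hW', h⟩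
    cases hW.symm.trans hW'
    exact Regraft.notMem_subtree I hpv hv hW hvt hd hlt
      ⟨(I.work_mem hW).1, .head (I.treeArc_of_inner (I.arc_mem hpv).2 hv hvt) h⟩
  constructor
  case root =>
    refine root_congr ?_
    simp only [State.Omega, overtakeSame_blossoms]
  case label => rfl
  case removed => rfl
  case onHold => rfl
  case modified =>
    intro γ
    simp [State.overtakeSame, or_comm]
  case str => exact fun γ h _ => overtakeSame_str_of_ne h
  case verts =>
    intro γ x
    by_cases h : γ = α
    · subst h
      rw [overtakeSame_str_self]
      by_cases hx : x ∈ σ.subtreeVerts γ v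
      · simp [hx, hx.1]
      · simp [hx]
    · rw [overtakeSame_str_of_ne h]
      have : x ∈ (σ.str γ).verts → x ∉ σ.subtreeVerts α v :=
        fun hx hs => h (I.verts_unique hx hs.1)
      simpa [h] using this
  case arcs =>
    intro γ a
    by_cases h : γ = α
    · subst h
      rw [overtakeSame_str_self]
      simp only [Set.mem_union, Set.mem_sdiff, Set.mem_singleton_iff, true_and]
      by_cases ha : a ∈ σ.subtreeArcs γ v
      · have : a ≠ (p, v) := by
          rintro rfl
          exact I.parent_notMem_subtree hpv hpr ha.2.1
        simp [ha, ha.1, this]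
      · simp [ha, or_comm]
    · rw [overtakeSame_str_of_ne h]
      have h₁ : a ∈ (σ.str γ).arcs → a ≠ (p, v) := by
        rintro ha rfl
        exact h (I.verts_unique (I.arc_mem ha).1 (I.arc_mem hpv).1)
      have h₂ : a ∈ (σ.str γ).arcs → a ∉ σ.subtreeArcs α v :=
        fun ha hs => h (I.verts_unique (I.arc_mem (a := a.1) (b := a.2) ha).1 hs.2.1.1)
      constructor
      · exact fun ha => Or.inr (Or.inr ⟨ha, h₁ ha, h₂ ha⟩)
      · rintro (h' | h' | h')
        · exact absurd h'.1 h
        · exact absurd h'.1 h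
        · exact h'.1
  case blossoms =>
    rintro γ B h ⟨x, hx⟩
    rw [overtakeSame_blossoms] at h
    by_cases hB : B ∈ σ.subtreeBlossoms α v
    · by_cases e : γ = α
      · exact Or.inl ⟨e, hB⟩
      · exact absurd (I.verts_unique (I.blossom_sub h hx) (hB.2 hx).1) e
    · exact Or.inr ⟨h, hB⟩
  case work_below => exact fun h => absurd h hwb
  case work_not_below =>
    exact fun _ => ⟨by rw [overtakeSame_str_self], fun h => absurd rfl h⟩

theorem regraft_other (hne : β ≠ α) (hpv : (p, v) ∈ (σ.str β).arcs) :
    Regraft σ (σ.overtakeOther α β p u v t k) α β p u v t k := by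
  constructor
  case root =>
    refine root_congr ?_
    ext B
    constructor
    · rintro (⟨γ, h⟩ | h)
      · left
        by_cases e : γ = α
        · subst e
          rw [overtakeOther_str_left hne] at h
          rcases h with h | h
          · exact ⟨γ, h⟩
          · exact ⟨β, h.1⟩
        · by_cases e' : γ = β
          · subst e'
            rw [overtakeOther_str_right] at h
            exact ⟨γ, h.1⟩
          · rw [overtakeOther_str_of_ne e e'] at h
            exact ⟨γ, h⟩
      · exact Or.inr h
    · rintro (⟨γ, h⟩ | h)
      · left
        by_cases e : γ = α
        · subst e
          exact ⟨γ, by rw [overtakeOther_str_left hne]; exact Or.inl h⟩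
        · by_cases e' : γ = β
          · subst e'
            by_cases hB : B ∈ σ.subtreeBlossoms γ v
            · exact ⟨α, by rw [overtakeOther_str_left hne]; exact Or.inr hB⟩
            · exact ⟨γ, by rw [overtakeOther_str_right]; exact ⟨h, hB⟩⟩
          · exact ⟨γ, by rwa [overtakeOther_str_of_ne e e']⟩
      · exact Or.inr h
  case label => rfl
  case removed => rfl
  case onHold => rfl
  case modified =>
    intro γ
    simp [State.overtakeOther, or_comm, or_assoc]
  case str => exact fun γ h h' => overtakeOther_str_of_ne h h'
  case verts =>
    intro γ x
    have hx : x ∈ (σ.str γ).verts → γ ≠ β → x ∉ σ.subtreeVerts β v :=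
      fun hx h hs => h (I.verts_unique hx hs.1)
    by_cases e : γ = α
    · subst e
      rw [overtakeOther_str_left hne]
      have := fun h => hx h hne.symm
      simp only [Set.mem_union, true_and]
      tauto
    · by_cases e' : γ = β
      · subst e'
        rw [overtakeOther_str_right]
        simp [e]
      · rw [overtakeOther_str_of_ne e e']
        have := fun h => hx h e'
        tauto
  case arcs =>
    intro γ a
    have h₁ : γ ≠ β → a ∈ (σ.str γ).arcs → a ≠ (p, v) := by
      rintro h ha rfl
      exact h (I.verts_unique (I.arc_mem ha).1 (I.arc_mem hpv).1)
    have h₂ : γ ≠ β → a ∈ (σ.str γ).arcs → a ∉ σ.subtreeArcs β v :=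
      fun h ha hs => h (I.verts_unique (I.arc_mem (a := a.1) (b := a.2) ha).1 hs.2.1.1)
    by_cases e : γ = α
    · subst e
      rw [overtakeOther_str_left hne]
      have h₁ := h₁ hne.symm
      have h₂ := h₂ hne.symm
      simp only [Set.mem_union, Set.mem_singleton_iff, true_and]
      tauto
    · by_cases e' : γ = β
      · subst e'
        rw [overtakeOther_str_right]
        simp only [Set.mem_sdiff, Set.mem_singleton_iff, e, false_and, false_or, and_assoc, ne_eq]
      · rw [overtakeOther_str_of_ne e e']
        have h₁ := h₁ e'
        have h₂ := h₂ e'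
        tauto
  case blossoms =>
    rintro γ B h ⟨x, hx⟩
    by_cases e : γ = α
    · subst e
      rw [overtakeOther_str_left hne] at h
      by_cases hB : B ∈ σ.subtreeBlossoms β v
      · exact Or.inl ⟨rfl, hB⟩
      · exact Or.inr ⟨h.resolve_right hB, hB⟩
    · by_cases e' : γ = β
      · subst e'
        rw [overtakeOther_str_right] at h
        exact Or.inr h
      · rw [overtakeOther_str_of_ne e e'] at h
        exact Or.inr ⟨h, fun hB => e' (I.verts_unique (I.blossom_sub h hx) (hB.2 hx).1)⟩
  case work_below =>
    intro h
    rw [overtakeOther_str_left hne, overtakeOther_str_right]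
    simp [h, hne.symm]
  case work_not_below =>
    intro h
    rw [overtakeOther_str_left hne, overtakeOther_str_right]
    simp [h]

end Inv

end OvertakeVisited

end MatchingPhase

namespace MatchingPhase

open State

/-! ### The invariants through one pass-bundle -/

section PassBundle

variable {V : Type*} {G : SimpleGraph V} {M : G.Subgraph} {L : ℕ} {σ σ' : State V} {Out : Set V}

/-- The structural invariant holds for `σ'`, which may have evolved from `σ`. -/
def Evolves (M : G.Subgraph) (L : ℕ) (σ : State V) (Out : Set V) (σ' : State V) : Prop :=
  ∃ Out', Inv M L σ' Out' ∧ Prog M σ Out σ' Out'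

/-- The labels next to a vertex that is no longer active have been updated. -/
def LabelBound (M : G.Subgraph) (σ : State V) (Out : Set V) : Prop :=
  ∀ u v t e, u ∈ Out → ¬ σ.Active u → v ∉ Out → v ∉ σ.removed → G.Adj u v → ¬ M.Adj u v →
    M.Adj v t → IsDistance M σ (σ.root u) e → σ.label v t ≤ e + 1

/-- No arc joins two different outer vertices. -/
def NoOuterArc (G : SimpleGraph V) (σ : State V) (Out : Set V) : Prop :=
  ∀ u v, G.Adj u v → u ∈ Out → v ∈ Out → σ.root u = σ.root v

theorem Prog.labelBound {Out' : Set V} (h : Prog M σ Out σ' Out') (hL : LabelBound M σ Out) :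
    LabelBound M σ' Out' := by
  intro u v t e hu ha hv hr huv hm hvt he
  obtain ⟨h₁, h₂, h₃, h₄⟩ := h.inactive hu ha
  rw [h₃] at he
  refine (h.label hvt).trans (hL u v t e h₁ h₂ (fun hv' => hv (h.out hv' hr))
    (fun hv' => hr (h.removed hv')) huv hm hvt ?_)
  rcases he with he | ⟨hn, x, y, hxy, hx, hy, rfl⟩
  · exact Or.inl he
  · exact Or.inr ⟨hn, x, y, hxy, hx, hy, h₄ x y hxy hy hx⟩

theorem Evolves.trans {σ'' : State V} (h : Evolves M L σ Out σ')
    (h' : ∀ Out', Inv M L σ' Out' → Evolves M L σ' Out' σ'') : Evolves M L σ Out σ'' := by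
  obtain ⟨O', I', P⟩ := h
  obtain ⟨O'', I'', P'⟩ := h' O' I'
  exact ⟨O'', I'', P.trans I'' P'⟩

namespace Inv

variable (I : Inv M L σ Out)

include I

/-- `Out` is only asserted to exist along the way. Its description by depth parity allows the sets
obtained from different arguments to be identified. -/
theorem out_unique {Out' : Set V} (I' : Inv M L σ Out') : Out = Out' := by
  have aux : ∀ {O₁ O₂}, Inv M L σ O₁ → Inv M L σ O₂ → O₁ ⊆ O₂ := by
    intro O₁ O₂ I₁ I₂ x hx
    obtain ⟨γ, hγ⟩ := I₁.out_mem hx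
    exact (I₂.isOuterIn_iff.1 (I₁.isOuterIn_iff.2 ⟨hγ, hx⟩)).2
  exact Set.Subset.antisymm (aux I I') (aux I' I)

theorem notMem_out {v : V} (h : ∀ β, ¬ σ.IsOuterIn β (σ.root v)) : v ∉ Out := fun hv => by
  obtain ⟨γ, hγ⟩ := I.out_mem hv
  exact h γ (I.isOuterIn_iff.2 ⟨hγ, hv⟩)

theorem evolves_refl : Evolves M L σ Out σ := ⟨Out, I, Prog.refl σ Out⟩

theorem evolves_contract {α u v : V} (hW : (σ.str α).work = some (σ.root u))
    (hv : σ.IsOuterIn α (σ.root v)) : Evolves M L σ Out (σ.contract M α u v) :=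
  have hu := I.work_mem hW
  have hv := I.isOuterIn_iff.1 hv
  ⟨_, I.contract hu.2 hv.2 hu.1 hv.1, I.contract_prog hW⟩

theorem evolves_overtake {α u v t : V} {d : ℕ} (hE : IsEligible M σ α u v)
    (hv : ∀ β, ¬ σ.IsOuterIn β (σ.root v)) (hvt : M.Adj v t)
    (hd : IsDistance M σ (σ.root u) d) (hlt : d + 1 < σ.label v t)
    (h : σ.Overtake α u v t (d + 1) σ') : Evolves M L σ Out σ' := by
  obtain ⟨-, hvr, -, hW, -, hm, -⟩ := hE
  have hvo := I.notMem_out hv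
  cases h with
  | unvisited hn =>
    exact ⟨_, I.overtakeUnvisited hW hvo hvr hvt hd hlt hn,
      I.overtakeUnvisited_prog hW hvo hvt hlt hn hm⟩
  | same _ hpv hpr =>
    have R := I.regraft_same (k := d + 1) hpv hpr hvo hW hvt hd hlt
    exact ⟨_, R.inv I hpv hpr hvo hW hvt hd hlt, R.prog I hpv hpr hvo hW hvt hd hlt hm⟩
  | other hne _ hpv hpr =>
    have R := I.regraft_other (u := u) (t := t) (k := d + 1) hne hpv
    exact ⟨_, R.inv I hpv hpr hvo hW hvt hd hlt, R.prog I hpv hpr hvo hW hvt hd hlt hm⟩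

theorem evolves_extendArc {u v : V} (h : ExtendArc M u v σ σ') : Evolves M L σ Out σ' := by
  cases h with
  | ignore => exact I.evolves_refl
  | contract hE hv => exact I.evolves_contract hE.2.2.2.1 hv
  | augment => exact ⟨_, I.augment, I.augment_prog⟩
  | overtake hE hv hvt hd hlt ho => exact I.evolves_overtake hE hv hvt hd hlt ho
  | noGain => exact I.evolves_refl

theorem evolves_extend {A : List (V × V)} (h : Pass (ExtendArc M) A σ σ') :
    Evolves M L σ Out σ' := by
  induction h generalizing Out with
  | nil => exact I.evolves_refl
  | cons h _ ih => exact (I.evolves_extendArc h).trans fun O' I' => ih I'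

theorem evolves_contractSteps (h : Relation.ReflTransGen (ContractStep M) σ σ') :
    Evolves M L σ Out σ' := by
  induction h with
  | refl => exact I.evolves_refl
  | tail _ h ih =>
    refine ih.trans fun O' I' => ?_
    obtain ⟨α, u, v, -, -, -, hW, -, hv, rfl⟩ := h
    exact I'.evolves_contract hW hv

/-- Every arc of the list is read at some moment of the pass. -/
theorem exists_read {A : List (V × V)} (h : Pass (ExtendArc M) A σ σ') {u v : V}
    (huv : (u, v) ∈ A) : ∃ σa Oa σb Ob, Inv M L σa Oa ∧ Inv M L σb Ob ∧ ExtendArc M u v σa σb ∧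
      Prog M σa Oa σb Ob ∧ Evolves M L σb Ob σ' := by
  induction h generalizing Out with
  | nil => cases huv
  | cons h h' ih =>
    obtain ⟨O', I', P⟩ := I.evolves_extendArc h
    rcases List.mem_cons.1 huv with e | e
    · cases e
      exact ⟨_, _, _, _, I, I', h, P, I'.evolves_extend h'⟩
    · exact ih I' e

/-- A structure that was not modified since `(u, v)` was read could not use this arc. -/
theorem label_le_of_read {u v t γ : V} {e : ℕ} {σb : State V} {Ob Out' : Set V}
    (I' : Inv M L σ' Out') (h : ExtendArc M u v σ σb) (P : Prog M σ Out σb Ob)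
    (P' : Prog M σb Ob σ' Out') (hm : γ ∉ σ'.modified) (hh : γ ∉ σ'.onHold)
    (hW : (σ'.str γ).work = some (σ'.root u)) (hv : v ∉ Out') (hvr : v ∉ σ'.removed)
    (huv : ¬ M.Adj u v) (hvt : M.Adj v t) (he : IsDistance M σ' (σ'.root u) e) :
    σ'.label v t ≤ e + 1 := by
  have Q := P.trans I' P'
  obtain ⟨h₁, h₂, h₃⟩ := Q.unmodified hm
  obtain ⟨hu', huo'⟩ := I'.work_mem hW
  have hu : u ∈ (σ.str γ).verts := h₁ ▸ hu'
  have hWa : (σ.str γ).work = some (σ.root u) := by rw [← h₁, hW, h₂ u hu]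
  have hmb : γ ∉ σb.modified := fun h => hm (P'.modified h)
  have huniq : ∀ {α}, IsEligible M σ α u v → α = γ := fun hE =>
    I.verts_unique (I.work_mem hE.2.2.2.1).1 hu
  cases h with
  | ignore hn =>
    -- `S_γ` has not changed since, so the arc was eligible when it was read. The two roots differed
    -- then, for otherwise they would still agree and `v` would be outer.
    refine absurd ?_ (hn γ)
    refine ⟨I.not_removed hu, fun h => hvr (Q.removed h), fun hr => hv ?_, hWa, huv,
      fun h => hm (Q.modified h), by rwa [← Q.onHold]⟩
    exact I'.out_of_root_eq huo' (Q.root hvr hr.symm)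
  | contract hE _ =>
    obtain rfl := huniq hE
    exact absurd (Or.inr rfl) hmb
  | augment hE _ _ =>
    obtain rfl := huniq hE
    exact absurd (Or.inr (Or.inl rfl)) hmb
  | overtake hE _ _ _ _ ho =>
    obtain rfl := huniq hE
    refine absurd ?_ hmb
    cases ho with
    | unvisited => exact Or.inr rfl
    | same => exact Or.inr rfl
    | other => exact Or.inr (Or.inl rfl)
  | noGain hE _ hvt' hd hlt =>
    obtain rfl := I.match_unique hvt hvt'
    have he' : IsDistance M σ (σ.root u) e := by
      rw [h₂ u hu] at he
      rcases he with he | ⟨hn, x, y, hxy, hx, hy, rfl⟩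
      · exact Or.inl he
      · have hy' := I.mem_of_mem_root hu hy
        exact Or.inr ⟨hn, x, y, hxy, hx, hy, h₃ x (I.match_mem hy' hxy.symm) y hxy⟩
    rw [I.distance_unique (I.work_mem hWa).2 he' hd]
    exact (Q.label hvt).trans (not_lt.1 hlt)

/-- The second step of Contract-and-Augment. -/
theorem augment_pass {A : List (V × V)} (h : Pass AugmentArc A σ σ') :
    ∃ Out', Inv M L σ' Out' ∧ Prog M σ Out σ' Out' ∧
      (∀ γ x, x ∈ (σ'.str γ).verts → σ'.str γ = σ.str γ ∧ σ'.root x = σ.root x ∧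
        (x ∈ Out' → x ∈ Out)) ∧
      ∀ u v γ δ, (u, v) ∈ A → u ∈ (σ'.str γ).verts → v ∈ (σ'.str δ).verts → u ∈ Out' →
        v ∈ Out' → γ = δ := by
  induction h generalizing Out with
  | nil =>
    exact ⟨Out, I, Prog.refl _ _, fun _ _ _ => ⟨rfl, rfl, id⟩, fun _ _ _ _ h => by cases h⟩
  | @cons a b A σ₁ σ₂ σ₃ h _ ih =>
    cases h with
    | @augment α β hne hu hv =>
      obtain ⟨O', I', P', hs, ha⟩ := ih I.augment
      have hs' : ∀ γ x, x ∈ (σ₃.str γ).verts → γ ≠ α ∧ γ ≠ β ∧ σ₃.str γ = σ₁.str γ ∧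
          σ₃.root x = σ₁.root x ∧ (x ∈ O' → x ∈ Out) := by
        intro γ x hx
        obtain ⟨h₁, h₂, h₃⟩ := hs γ x hx
        rw [h₁] at hx
        obtain ⟨k₁, k₂, k₃⟩ := augment_mem hx
        rw [augment_str_of_ne k₁ k₂] at h₁
        exact ⟨k₁, k₂, h₁, h₂.trans (I.augment_root_mem k₁ k₂ k₃), fun h => (h₃ h).1⟩
      refine ⟨O', I', I.augment_prog.trans I' P', fun γ x hx => (hs' γ x hx).2.2, ?_⟩
      intro x y γ δ hxy hx hy hxo hyo
      rcases List.mem_cons.1 hxy with e | e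
      · cases e
        -- The arc just used has lost its ends: the structures containing them are deleted for the
        -- rest of the pass.
        obtain ⟨k, -, h₁, -⟩ := hs' γ _ hx
        rw [h₁] at hx
        exact absurd (I.verts_unique hx (I.isOuterIn_iff.1 hu).1) k
      · exact ha x y γ δ e hx hy hxo hyo
    | ignore hn =>
      obtain ⟨O', I', P', hs, ha⟩ := ih I
      refine ⟨O', I', P', hs, fun x y γ δ hxy hx hy hxo hyo => ?_⟩
      rcases List.mem_cons.1 hxy with e | e
      · cases e
        by_contra hne
        have h₁ := hs γ _ hx
        have h₂ := hs δ _ hy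
        rw [h₁.1] at hx
        rw [h₂.1] at hy
        exact hn γ δ hne (I.isOuterIn_iff.2 ⟨hx, h₁.2.2 hxo⟩) (I.isOuterIn_iff.2 ⟨hy, h₂.2.2 hyo⟩)
      · exact ha x y γ δ e hx hy hxo hyo

/-- The structural invariant depends on the working vertices only through `work_outer`. -/
theorem with_work {w : V → Option (Set V)} (hw : ∀ α W, w α = some W →
    ∃ x ∈ (σ.str α).verts, x ∈ Out ∧ σ.root x = W) (H D : Set V) :
    Inv M L ⟨fun α => { σ.str α with work := w α }, σ.label, σ.removed, H, D⟩ Out where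
  match_unique := I.match_unique
  verts_unique := I.verts_unique
  arc_mem := I.arc_mem
  blossom_sub := I.blossom_sub
  root_trans := I.root_trans
  out_mem := I.out_mem
  out_root := I.out_root
  inner_trivial := I.inner_trivial
  base := I.base
  free_eq := I.free_eq
  free_mem := I.free_mem
  not_removed := I.not_removed
  match_mem := I.match_mem
  match_removed := I.match_removed
  arc_alt := I.arc_alt
  inner_arc := I.inner_arc
  inner_match := I.inner_match
  enter_unique := I.enter_unique
  enter_base := I.enter_base
  enter_exists := I.enter_exists
  leave_unique := I.leave_unique
  base_closed := I.base_closed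
  label_lt := I.label_lt
  label_visited := I.label_visited
  work_outer {α W} h := hw α W h

omit I in
/-- After the contractions and augmentations no arc joins two different outer vertices. -/
theorem noOuterArc {σ₁ σ₂ : State V} {A : List (V × V)} (hA : IsStream G A)
    (hfree : ∀ u v, G.Adj u v → u ∈ Out → v ∈ Out → σ.root u = σ.root v ∨
      IsFree M u ∧ IsFree M v)
    {O₁ : Set V} (I₁ : Inv M L σ₁ O₁) (P₁ : Prog M σ Out σ₁ O₁)
    (hc : ∀ σ', ¬ ContractStep M σ₁ σ') (h : Pass AugmentArc A σ₁ σ₂) :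
    ∃ O₂, Inv M L σ₂ O₂ ∧ Prog M σ₁ O₁ σ₂ O₂ ∧ NoOuterArc G σ₂ O₂ := by
  obtain ⟨O₂, I₂, P₂, hs, ha⟩ := I₁.augment_pass h
  refine ⟨O₂, I₂, P₂, fun u v huv hu hv => ?_⟩
  obtain ⟨γ, hγ⟩ := I₂.out_mem hu
  obtain ⟨δ, hδ⟩ := I₂.out_mem hv
  obtain rfl := ha u v γ δ ((hA.2 u v).2 huv) hγ hδ hu hv
  by_contra hr
  have Q := P₁.trans I₂ P₂
  -- If one end were in a working vertex, the arc would have permitted a further contraction before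
  -- the augmenting pass, as that pass leaves the surviving structures unchanged.
  have key : ∀ x y, G.Adj x y → x ∈ O₂ → y ∈ O₂ → x ∈ (σ₂.str γ).verts →
      y ∈ (σ₂.str γ).verts → σ₂.root x ≠ σ₂.root y → ¬ σ₂.InModifiedWork x := by
    rintro x y hxy hxo hyo hx hy hne ⟨δ, -, hW⟩
    obtain rfl := I₂.verts_unique hx (I₂.work_mem hW).1
    obtain ⟨h₁, h₂, h₃⟩ := hs γ x hx
    obtain ⟨-, k₂, k₃⟩ := hs γ y hy
    rw [h₁] at hx hy hW
    rw [h₂] at hne hW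
    rw [k₂] at hne
    exact hc _ ⟨γ, x, y, hxy, hx, hy, hW, hne.symm, I₁.isOuterIn_iff.2 ⟨hy, k₃ hyo⟩, rfl⟩
  have hku := key u v huv hu hv hγ hδ hr
  have hkv := key v u huv.symm hv hu hδ hγ (Ne.symm hr)
  -- So both ends were already outer at the start of the bundle, where the roots agreed or both ends
  -- were free. Roots once equal stay equal, and two distinct free vertices are never in one
  -- structure.
  have hu₀ := (Q.new_out hu).resolve_right hku
  have hv₀ := (Q.new_out hv).resolve_right hkv
  rcases hfree u v huv hu₀ hv₀ with h | ⟨hfu, hfv⟩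
  · exact hr (Q.root (I₂.not_removed hγ) h)
  · exact huv.ne ((I₂.free_eq hfu hγ).trans (I₂.free_eq hfv hδ).symm)

theorem backtracked_outer {α : V} {w : Option (Set V)} (h : BacktrackedWork σ α w) {X : Set V}
    (hX : w = some X) : ∃ x ∈ (σ.str α).verts, x ∈ Out ∧ σ.root x = X := by
  cases h with
  | inactive => cases hX
  | atRoot => cases hX
  | up hW hne hXY hYW =>
    cases hX
    obtain ⟨x, hx, ho, rfl⟩ := I.work_outer hW
    obtain ⟨hne₁, a, b, hab, rfl, rfl⟩ := hXY
    obtain ⟨hne₂, c, d, hcd, hc, hd⟩ := hYW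
    have hc' : c ∉ Out := fun h =>
      (I.arc_alt hcd (by rw [hc, hd]; exact hne₂)).1 h (I.out_of_root_eq ho hd)
    exact ⟨a, (I.arc_mem hab).1, (I.arc_alt hab hne₁).2
      fun hb => hc' (I.out_of_root_eq hb hc), rfl⟩

/-- A vertex that ceases to be active in the backtracking of `S_γ` is in its working vertex. -/
theorem eq_work_of_backtracked {γ u : V} {W : Set V} {w : Option (Set V)}
    (h : BacktrackedWork σ γ w) (hW : (σ.str γ).work = some W) (hu : u ∈ Out)
    (hanc : σ.Anc γ (σ.root u) W) (hna : ∀ X, w = some X → ¬ σ.Anc γ (σ.root u) X) :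
    σ.root u = W := by
  cases h with
  | inactive h => cases hW.symm.trans h
  | atRoot h =>
    cases hW.symm.trans h
    exact I.anc_base hanc
  | @up X Y W' hW' hne hXY hYW =>
    cases hW.symm.trans hW'
    by_contra hne
    obtain ⟨x, hx, ho, rfl⟩ := I.work_outer hW
    have hY := I.anc_parent hanc hYW hne
    -- The proper ancestors of the working vertex are its parent `Y`, which is inner, and the
    -- ancestors of its grandparent `X`, which stay active.
    refine hna X rfl (I.anc_parent hY hXY fun e => ?_)
    obtain ⟨hne₂, c, d, hcd, hc, hd⟩ := hYW
    exact (I.arc_alt hcd (by rw [hc, hd]; exact hne₂)).1 (I.out_of_root_eq hu (hc.trans e.symm))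
      (I.out_of_root_eq ho hd)

/-- The invariants at the beginning of a pass-bundle are preserved. -/
theorem passBundle {h : ℝ} (hL : LabelBound M σ Out)
    (hfree : ∀ u v, G.Adj u v → u ∈ Out → v ∈ Out → σ.root u = σ.root v ∨
      IsFree M u ∧ IsFree M v) (hB : PassBundle M h σ σ') :
    ∃ Out', Inv M L σ' Out' ∧ LabelBound M σ' Out' ∧ NoOuterArc G σ' Out' := by
  obtain ⟨A₁, A₂, σ₁, σ₂, σ₃, hA₁, hA₂, h₁, h₂, hc, h₃, w, hw, hw', rfl⟩ := hB
  have I₀ : Inv M L (mark h σ) Out :=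
    I.with_work (w := fun α => (σ.str α).work) (fun α W h => I.work_outer h) _ _
  have hL₀ : LabelBound M (mark h σ) Out := hL
  obtain ⟨O₁, I₁, P₁⟩ := I₀.evolves_extend h₁
  obtain ⟨O₂, I₂, P₂⟩ := I₁.evolves_contractSteps h₂
  obtain ⟨O₃, I₃, P₃, hN⟩ := I₂.noOuterArc (σ := mark h σ) hA₂ hfree (P₁.trans I₂ P₂) hc h₃
  have P₁₃ := P₂.trans I₃ P₃
  have P₀₃ := P₁.trans I₃ P₁₃
  have hL₃ := P₀₃.labelBound hL₀
  refine ⟨O₃, I₃.with_work (fun α W hα => ?_) _ _, ?_, hN⟩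
  · by_cases hm : α ∈ σ₃.onHold ∨ α ∈ σ₃.modified
    · rw [hw α hm] at hα
      exact I₃.work_outer hα
    · exact I₃.backtracked_outer (hw' α hm) hα
  · intro u v t e hu ha hv hr huv hm hvt he
    -- A vertex inactive before backtracking is covered by `hL₃`. One that becomes inactive lies in
    -- the working vertex of a stuck structure, and the reading of `(u, v)` in the extending pass
    -- gives the bound.
    by_cases ha₃ : σ₃.Active u
    · obtain ⟨γ, W, hW, hanc⟩ := ha₃
      by_cases hγ : γ ∈ σ₃.onHold ∨ γ ∈ σ₃.modified
      · exact absurd ⟨γ, W, (hw γ hγ).trans hW, hanc⟩ ha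
      · obtain rfl := I₃.eq_work_of_backtracked (hw' γ hγ) hW hu hanc
          fun X hX hX' => ha ⟨γ, X, hX, hX'⟩
        push Not at hγ
        obtain ⟨σa, Oa, σb, Ob, Ia, Ib, hab, Pab, O', I', Pb⟩ :=
          I₀.exists_read h₁ ((hA₁.2 u v).2 huv)
        -- The history from the reading of `(u, v)` and the history of the whole pass end in the
        -- same state, so they can be composed with the rest of the bundle.
        obtain rfl := I'.out_unique I₁
        have key : σ₃.label v t ≤ e + 1 :=
          Ia.label_le_of_read I₃ hab Pab (Pb.trans I₃ P₁₃) hγ.2 hγ.1 hW hv hr hm hvt he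
        exact key
    · exact hL₃ u v t e hu ha₃ hv hr huv hm hvt he

end Inv

end PassBundle

end MatchingPhase

namespace MatchingPhase

open State

/-! ### The start of a phase, and following the augmenting path -/

section Phase

variable {V : Type*} {G : SimpleGraph V} {M : G.Subgraph} {σ : State V}

theorem init_str {α : V} (h : IsFree M α) (ε : ℝ) :
    (init M ε).str α = FreeStructure.single α := by
  simp [init, h]

theorem init_mem {ε : ℝ} {α x : V} (h : x ∈ ((init M ε).str α).verts) : x = α ∧ IsFree M α := by
  by_cases hα : IsFree M α
  · rw [init_str hα] at h
    exact ⟨h, hα⟩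
  · simp [init, hα, FreeStructure.empty] at h

theorem init_arc {ε : ℝ} {α : V} {a : V × V} : a ∉ ((init M ε).str α).arcs := by
  by_cases hα : IsFree M α
  · rw [init_str hα]
    exact fun h => h
  · simp [init, hα, FreeStructure.empty]

theorem init_blossom {ε : ℝ} {α : V} {B : Blossom V} (h : B ∈ ((init M ε).str α).blossoms) :
    B = Blossom.trivial α ∧ IsFree M α := by
  by_cases hα : IsFree M α
  · rw [init_str hα] at h
    exact ⟨h, hα⟩
  · simp [init, hα, FreeStructure.empty] at h

theorem init_root {ε : ℝ} {x y : V} (h : y ∈ (init M ε).root x) : y = x := by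
  rcases mem_root_iff.1 h with h | ⟨γ, B, hB, hx, hy⟩
  · exact h
  · obtain ⟨rfl, -⟩ := init_blossom hB
    exact (show y = γ from hy).trans (show x = γ from hx).symm

theorem init_root_eq {ε : ℝ} {x : V} : (init M ε).root x = {x} :=
  Set.Subset.antisymm (fun _ h => init_root h)
    (Set.singleton_subset_iff.2 (State.mem_root_self _ x))

theorem init_verts {ε : ℝ} {x : V} (h : IsFree M x) : x ∈ ((init M ε).str x).verts := by
  rw [init_str h]
  exact rfl

theorem init_inv (hM : M.IsMatching) (ε : ℝ) :
    Inv M (lmax ε) (init M ε) {x | IsFree M x} where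
  match_unique {a b c} h h' := (hM (M.edge_vert h)).unique h h'
  verts_unique h h' := (init_mem h).1.symm.trans (init_mem h').1
  arc_mem h := absurd h init_arc
  blossom_sub h hx := by
    obtain ⟨rfl, hα⟩ := init_blossom h
    obtain rfl : _ = _ := hx
    exact init_verts hα
  root_trans hy hz := by
    rw [init_root hy] at hz
    exact hz
  out_mem {x} hx := ⟨x, init_verts hx⟩
  out_root hy hx := by rwa [init_root hy]
  inner_trivial _ _ hy := init_root hy
  base hx := ⟨init_verts (init_mem hx).2, (init_mem hx).2, (init_mem hx).2⟩
  free_eq _ h := (init_mem h).1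
  free_mem hf _ := init_verts hf
  not_removed _ h := h
  match_mem {α x y} h hxy := by
    obtain ⟨rfl, hf⟩ := init_mem h
    exact absurd hxy (hf y)
  match_removed h _ := h.elim
  arc_alt h := absurd h init_arc
  inner_arc h := absurd h init_arc
  inner_match h ho := absurd ((init_mem h).1 ▸ (init_mem h).2) ho
  enter_unique h := absurd h init_arc
  enter_base h := absurd h init_arc
  enter_exists h hr := absurd (by rw [(init_mem h).1]) hr
  leave_unique {x a b a' b'} hx hb hb' hab := by
    rw [init_root hb] at hab
    exact absurd hab.symm (hx a)
  base_closed {α a b} h hb hab := by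
    rw [init_root hb] at hab
    exact absurd hab.symm ((init_mem h).2 a)
  label_lt h := absurd h init_arc
  label_visited _ h := absurd (show lmax ε + 1 ≤ lmax ε from h) (by omega)
  work_outer {α W} h := by
    by_cases hα : IsFree M α
    · rw [init_str hα] at h
      cases h
      exact ⟨α, init_verts hα, hα, init_root_eq⟩
    · simp [init, hα, FreeStructure.empty] at h

/-- At the start every outer vertex is the working vertex of its own structure, so the bound has
nothing to check. -/
theorem init_labelBound (ε : ℝ) : LabelBound M (init M ε) {x | IsFree M x} := by
  intro u v t e hu ha
  refine absurd ⟨u, {u}, by rw [init_str hu]; rfl, ?_⟩ ha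
  rw [init_root_eq]
  exact Relation.ReflTransGen.refl

/-- The invariants at the beginning of every pass-bundle. -/
theorem AtStartOf.inv (hM : M.IsMatching) {ε h : ℝ} {τ : ℕ} (hσ : AtStartOf M ε h τ σ) :
    ∃ Out, Inv M (lmax ε) σ Out ∧ LabelBound M σ Out ∧
      (σ = init M ε ∨ NoOuterArc G σ Out) := by
  induction hσ with
  | first => exact ⟨_, init_inv hM ε, init_labelBound ε, Or.inl rfl⟩
  | next _ hB ih =>
    obtain ⟨O, I, hL, hO⟩ := ih
    obtain ⟨O', I', hL', hO'⟩ := I.passBundle hL (fun u v huv hu hv => by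
      rcases hO with rfl | hO
      · obtain rfl := I.out_unique (init_inv hM ε)
        exact Or.inr ⟨hu, hv⟩
      · exact Or.inl (hO u v huv hu hv)) hB
    exact ⟨O', I', hL', Or.inr hO'⟩

theorem Inv.not_active_of_free {L : ℕ} {Out : Set V} (I : Inv M L σ Out) {α : V}
    (hα : IsFree M α) (h : ¬ σ.IsActive α) : ¬ σ.Active α := by
  rintro ⟨γ, W, hW, hanc⟩
  obtain ⟨w, hw, -, rfl⟩ := I.work_outer hW
  obtain ⟨y, hy, hr⟩ := I.mem_of_anc hanc hw
  obtain rfl := I.free_eq hα (I.mem_of_root_eq hy hr.symm)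
  exact h (by simp [State.IsActive, hW])

/-- The vertices of an augmenting path that misses all critical arcs and starts in an inactive
structure: each head of a matched arc is inactive and outer, of small distance, and the path has
entered its root blossom through the matched arc of that blossom. -/
theorem Inv.outer_of_path {L : ℕ} {Out : Set V} (I : Inv M L σ Out) (hL : LabelBound M σ Out)
    (hN : NoOuterArc G σ Out) {α β : V} {P : G.Walk α β} {k : ℕ} (hP : IsAugmentingPath M P k)
    (hk : k ≤ L) (hrem : ∀ x ∈ P.support, x ∉ σ.removed) (hα : ¬ σ.IsActive α)
    (hcrit : ∀ d ∈ P.darts, ¬ σ.IsCriticalArc d.fst d.snd) (i : ℕ) (hi : i ≤ k) :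
    P.getVert (2 * i) ∈ Out ∧ ¬ σ.Active (P.getVert (2 * i)) ∧
      (∃ e ≤ i, IsDistance M σ (σ.root (P.getVert (2 * i))) e) ∧
      (α ∈ σ.root (P.getVert (2 * i)) ∨ ∃ j, 2 * j + 2 ≤ 2 * i ∧
        P.getVert (2 * j + 2) ∈ σ.root (P.getVert (2 * i)) ∧
        P.getVert (2 * j + 1) ∉ σ.root (P.getVert (2 * i))) := by
  obtain ⟨hfα, hfβ, hpath, hlen, halt⟩ := hP
  have hr : ∀ j, P.getVert j ∉ σ.removed := fun j => hrem _ (P.getVert_mem_support j)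
  have hodd : ∀ j < k, M.Adj (P.getVert (2 * j + 1)) (P.getVert (2 * j + 2)) := fun j hj =>
    (halt (2 * j + 1) (by omega)).2 ⟨j, rfl⟩
  have hmα : α ∈ (σ.str α).verts := I.free_mem hfα (by simpa using hr 0)
  induction i with
  | zero =>
    rw [Nat.mul_zero, P.getVert_zero]
    exact ⟨(I.base hmα).2.2, I.not_active_of_free hfα hα,
      ⟨0, le_rfl, Or.inl ⟨⟨α, σ.mem_root_self α, hfα⟩, rfl⟩⟩, Or.inl (σ.mem_root_self α)⟩
  | succ i ih =>
    obtain ⟨ho, ha, ⟨e, hei, he⟩, hent⟩ := ih (by omega)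
    rw [show 2 * (i + 1) = 2 * i + 2 by ring]
    have hm := hodd i (by omega)
    have hadj : G.Adj (P.getVert (2 * i)) (P.getVert (2 * i + 1)) :=
      P.adj_getVert_succ (by omega)
    have hnm : ¬ M.Adj (P.getVert (2 * i)) (P.getVert (2 * i + 1)) := fun h =>
      Nat.not_odd_iff_even.2 ⟨i, two_mul i⟩ ((halt (2 * i) (by omega)).1 h)
    obtain ⟨γ, hγ⟩ := I.out_mem ho
    by_cases hvo : P.getVert (2 * i + 1) ∈ Out
    · have hreq := hN _ _ hadj ho hvo
      -- A matched edge leaving here is impossible if the blossom contains `α`. Otherwise it would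
      -- leave at the vertex where `P` came in through a matched edge, and the simple path would
      -- visit that vertex twice.
      have hin : P.getVert (2 * i + 2) ∈ σ.root (P.getVert (2 * i)) := by
        by_contra hout
        have hv := I.root_eq_iff.1 hreq.symm
        rcases hent with hent | ⟨j, hj, hj₁, hj₂⟩
        · obtain rfl := I.free_eq hfα (I.mem_of_mem_root hγ hent)
          have hα' := I.root_eq_iff.2 hent
          rw [← hα'] at hout hv
          exact hout (I.base_closed hmα hv hm.symm)
        · have h₁ := I.leave_unique ho hv hj₁ hm.symm (hodd j (by omega)) hout hj₂
          have h₂ := hpath.getVert_injOn (show 2 * i + 1 ≤ P.length by omega)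
            (show 2 * j + 2 ≤ P.length by omega) h₁
          omega
      have hreq' := I.root_eq_iff.2 hin
      refine ⟨I.out_root hin ho, ?_, ⟨e, by omega, hreq' ▸ he⟩, ?_⟩
      · unfold State.Active
        rwa [hreq']
      · rw [hreq']
        exact hent.imp_right fun ⟨j, hj, h⟩ => ⟨j, by omega, h⟩
    -- The label is at most `e + 1 ≤ i + 1 ≤ k ≤ L`, so the matched arc has been visited; it is then
    -- a tree arc, and its label is the distance of its head.
    · have hlab := hL _ _ _ e ho ha hvo (hr _) hadj hnm hm he
      obtain ⟨δ, hδ⟩ := (I.label_visited hm (by omega)).resolve_left (hr _)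
      have hto := I.out_of_inner hδ hvo hm
      have hne := I.root_ne_of_inner hδ hvo hm
      have harc := I.inner_match hδ hvo hm
      refine ⟨hto, ?_, ⟨_, by omega, I.distance_of_enter harc hne hto⟩, Or.inr ⟨i, le_rfl,
        σ.mem_root_self _, fun h => hne (I.root_eq_iff.2 h)⟩⟩
      -- If the head were active, the active path would come to it through its parent, making this
      -- arc of `P` critical.
      rintro ⟨γ', W, hW, hanc⟩
      obtain ⟨w, hw, -, rfl⟩ := I.work_outer hW
      obtain ⟨y, hy, hyr⟩ := I.mem_of_anc hanc hw
      obtain rfl := I.verts_unique (I.mem_of_root_eq hy hyr.symm) (I.arc_mem harc).2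
      have hlt : 2 * i + 1 < P.darts.length := by
        rw [P.length_darts]
        omega
      refine hcrit _ (List.getElem_mem hlt) ?_
      rw [SimpleGraph.Walk.darts_getElem_eq_getVert]
      exact ⟨hne, γ', _, hW, I.base_anc hδ, I.treeArc_of_inner hδ hvo hm, hanc⟩

/-- The last edge puts `β` into the blossom reached by `P`. If this blossom contains `α`, two
distinct free vertices share a structure; otherwise `P` entered by a matched edge the blossom of a
tree root, which no matched edge leaves. -/
theorem Inv.exists_critical {L : ℕ} {Out : Set V} (I : Inv M L σ Out) (hL : LabelBound M σ Out)
    (hN : NoOuterArc G σ Out) {α β : V} {P : G.Walk α β} {k : ℕ} (hP : IsAugmentingPath M P k)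
    (hk : k ≤ L) (hrem : ∀ x ∈ P.support, x ∉ σ.removed) (hα : ¬ σ.IsActive α) :
    ∃ d ∈ P.darts, σ.IsCriticalArc d.fst d.snd := by
  by_contra! hcrit
  obtain ⟨ho, -, -, hent⟩ := I.outer_of_path hL hN hP hk hrem hα hcrit k le_rfl
  obtain ⟨hfα, hfβ, hpath, hlen, halt⟩ := hP
  have hadj : G.Adj (P.getVert (2 * k)) (P.getVert (2 * k + 1)) := P.adj_getVert_succ (by omega)
  rw [← hlen, P.getVert_length] at hadj
  have hβ : β ∈ (σ.str β).verts := I.free_mem hfβ (hrem _ P.end_mem_support)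
  have hr := hN _ _ hadj ho (I.base hβ).2.2
  rw [hr] at hent
  rcases hent with h | ⟨j, hj, h₁, h₂⟩
  · obtain rfl := I.free_eq hfα (I.mem_of_mem_root hβ h)
    have := SimpleGraph.Walk.length_eq_zero_iff.2 (SimpleGraph.Walk.isPath_iff_nil.1 hpath)
    omega
  · exact h₂ (I.base_closed hβ h₁ ((halt (2 * j + 1) (by omega)).2 ⟨j, rfl⟩))

end Phase

end MatchingPhase

theorem mainTheorem4 {V : Type*} [Finite V] (G : SimpleGraph V) (M : G.Subgraph)
    (hM : M.IsMatching)
    (ε h : ℝ) (e : ℕ) (hε : ε = (1 / 2) ^ e)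
    (i : ℕ) (hi : 1 ≤ i) (hh : h = (1 / 2) ^ i) (hmin : ε ^ 2 / 64 ≤ h)
    (τ : ℕ) (σ : MatchingPhase.State V) (hσ : MatchingPhase.AtStartOf M ε h τ σ)
    (α β : V) (P : G.Walk α β) (k : ℕ) (hP : MatchingPhase.IsAugmentingPath M P k)
    (hk : (k : ℝ) ≤ 3 / ε) (hrem : ∀ x ∈ P.support, x ∉ σ.removed) :
    σ.IsActive α ∨ ∃ d ∈ P.darts, σ.IsCriticalArc d.fst d.snd := by
  by_cases hα : σ.IsActive α
  · exact Or.inl hα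
  obtain ⟨Out, I, hL, rfl | hN⟩ := hσ.inv hM
  · refine absurd ?_ hα
    simp [MatchingPhase.State.IsActive, MatchingPhase.init_str hP.1,
      MatchingPhase.FreeStructure.single]
  · exact Or.inr (I.exists_critical hL hN hP (Nat.le_floor hk) hrem hα)
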